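/- For $0<\gamma<1$ let $\Phi_\gamma(z)=\sum_{n\ge 0}\frac{(-z)^n}{n!\,\Gamma(-\gamma n+1-\gamma)}$ be the Wright function (with $1/\Gamma=0$ at the poles of $\Gamma$) and put $\varphi_{t,\gamma}(s)=t^{-\gamma}\Phi_\gamma(s\,t^{-\gamma})$ for $t,s>0$. For $\alpha>0$ put $g_\alpha(t)=t^{\alpha-1}/\Gamma(\alpha)$. An $\alpha$-times resolvent family for a linear operator $A$ with domain $D(A)$ in a Banach space $B$ is a strongly continuous family $(S(t))_{t\ge 0}$ of bounded linear operators on $B$ such that $S(0)=I$, $S(t)D(A)\subset D(A)$, $AS(t)x=S(t)Ax$ and $S(t)x=x+\int_0^t g_\alpha(t-\tau)AS(\tau)x\,d\tau$ for all $x\in D(A)$, $t\ge 0$. Theorem 5. For each $0<\alpha<1$ there is a constant $C>0$ depending only on $\alpha$ such that the following holds. Let $A$ be the generator of a $C_0$-semigroup $(T(t))_{t\ge 0}$ in a real or complex Banach space $B$ such that $\|T(t)\|\le Me^{\omega t}$ for all $t\ge 0$, where $\omega\ge 0$. Then: 1. there is an $\alpha$-times resolvent family $(S_\alpha(t))_{t\ge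 0}$ for $A$ with $S_\alpha(t)x=\int_0^\infty \varphi_{t,\alpha}(s)\,T(s)x\,ds$ for all $t>0$, $x\in B$ (the integral converging absolutely); 2. every integer $n>\omega$ lies in the resolvent set of $A$, and for the (bounded) Yosida approximation $A_n=n^2R(n,A)-nI$, where $R(n,A)=(nI-A)^{-1}$, there is an $\alpha$-times resolvent family $(S_{\alpha,n}(t))_{t\ge 0}$ for $A_n$ with $S_{\alpha,n}(t)=\int_0^\infty\varphi_{t,\alpha}(s)\,e^{sA_n}\,ds$ for all $t>0$ (the integral converging absolutely in operator norm); 3. $\|S_{\alpha,n}(t)\|\le MC\,e^{(2\omega)^{1/\alpha}t}$ for all $t\ge 0$ and all integers $n>\omega$ with $n\ge 2\omega$; 4. $S_{\alpha,n}(t)x\to S_\alpha(t)x$ as $n\to\infty$ for all $x\in B$ and $t\ge 0$, uniformly in $t$ on every compact subset of $[0,\infty)$. -/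

import Mathlib

open Set Filter Topology MeasureTheory

noncomputable section

namespace FracVolterra

section Operators

variable {𝕜 B : Type*} [RCLike 𝕜] [NormedAddCommGroup B] [NormedSpace 𝕜 B]

/-- `C₀`-semigroup of bounded operators on `B`; only the values `T t` with `0 ≤ t` matter. -/
structure IsC0Semigroup (T : ℝ → B →L[𝕜] B) : Prop where
  map_zero : T 0 = 1
  map_add : ∀ s t : ℝ, 0 ≤ s → 0 ≤ t → T (s + t) = T s * T t
  tendsto_zero : ∀ x : B, Tendsto (fun t : ℝ => T t x) (𝓝[>] 0) (𝓝 x)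

/-- `A` is the infinitesimal generator of `T`: `x ∈ D(A)` with `A x = y` if and only if
`(T t x - x) / t` tends to `y` as `t` decreases to `0`. -/
def IsGenerator (T : ℝ → B →L[𝕜] B) (A : B →ₗ.[𝕜] B) : Prop :=
  ∀ x y : B, (x, y) ∈ A.graph ↔
    Tendsto (fun t : ℝ => ((t⁻¹ : ℝ) : 𝕜) • (T t x - x)) (𝓝[>] 0) (𝓝 y)

open Classical in
/-- The value `A x`, extended by `0` off the domain so that it can be written under integrals. -/
def opApply (A : B →ₗ.[𝕜] B) (x : B) : B :=
  if h : x ∈ A.domain then A ⟨x, h⟩ else 0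

/-- `R` is a bounded two-sided inverse of `μ I - A : D(A) → B`. -/
structure IsResolventOp (A : B →ₗ.[𝕜] B) (μ : 𝕜) (R : B →L[𝕜] B) : Prop where
  mem_domain : ∀ y : B, R y ∈ A.domain
  right_inv : ∀ y : B, μ • R y - opApply A (R y) = y
  left_inv : ∀ x ∈ A.domain, R (μ • x - opApply A x) = x

/-- The resolvent set of the operator `A`. -/
def resolventSetOp (A : B →ₗ.[𝕜] B) : Set 𝕜 :=
  {μ | ∃ R : B →L[𝕜] B, IsResolventOp A μ R}

open Classical in
/-- The resolvent operator `R(μ, A) = (μ I - A)⁻¹` for `μ` in the resolvent set (`0` otherwise). -/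
def resolventOp (A : B →ₗ.[𝕜] B) (μ : 𝕜) : B →L[𝕜] B :=
  if h : μ ∈ resolventSetOp A then Classical.choose h else 0

/-- The Yosida approximation `A_n = n² R(n, A) - n I`, equal to `n A R(n, A)`. -/
def yosida (A : B →ₗ.[𝕜] B) (n : ℕ) : B →L[𝕜] B :=
  ((n : 𝕜) ^ 2) • resolventOp A (n : 𝕜) - (n : 𝕜) • (1 : B →L[𝕜] B)

/-- A bounded operator, viewed as an operator with domain the whole space. -/
def ofBounded (A : B →L[𝕜] B) : B →ₗ.[𝕜] B :=
  (A : B →ₗ[𝕜] B).toPMap ⊤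

/-- `S` is a resolvent for the pair `(A, a)`; only the values `S t` with `0 ≤ t` matter. -/
structure IsResolventFamily [NormedSpace ℝ B] (A : B →ₗ.[𝕜] B) (a : ℝ → ℝ)
    (S : ℝ → B →L[𝕜] B) : Prop where
  map_zero : S 0 = 1
  continuousOn : ∀ x : B, ContinuousOn (fun t : ℝ => S t x) (Ici 0)
  mem_domain : ∀ t : ℝ, 0 ≤ t → ∀ x ∈ A.domain, S t x ∈ A.domain
  commutes : ∀ t : ℝ, 0 ≤ t → ∀ x ∈ A.domain, opApply A (S t x) = S t (opApply A x)
  intervalIntegrable : ∀ t : ℝ, 0 ≤ t → ∀ x ∈ A.domain,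
    IntervalIntegrable (fun τ : ℝ => a (t - τ) • opApply A (S τ x)) volume 0 t
  resolvent_eq : ∀ t : ℝ, 0 ≤ t → ∀ x ∈ A.domain,
    S t x = x + ∫ τ in (0 : ℝ)..t, a (t - τ) • opApply A (S τ x)

end Operators

/-- The kernel `g_α(t) = t ^ (α - 1) / Γ(α)`. -/
def fracKernel (α t : ℝ) : ℝ := t ^ (α - 1) / Real.Gamma α

/-- `S` is an `α`-times resolvent family for `A`. -/
def IsFracResolventFamily {𝕜 B : Type*} [RCLike 𝕜] [NormedAddCommGroup B] [NormedSpace 𝕜 B]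
    [NormedSpace ℝ B] (α : ℝ) (A : B →ₗ.[𝕜] B) (S : ℝ → B →L[𝕜] B) : Prop :=
  IsResolventFamily A (fracKernel α) S

/-- The Wright function `Φ_γ(z) = ∑ (-z)ⁿ / (n! Γ(-γ n + 1 - γ))`. At the poles of `Γ` the
quotient is `0`, as `Real.Gamma` is `0` there, in accordance with the entire function `1 / Γ`. -/
def wright (γ z : ℝ) : ℝ :=
  ∑' n : ℕ, (-z) ^ n / ((n.factorial : ℝ) * Real.Gamma (-γ * n + 1 - γ))

/-- The subordination kernel `φ_{t,γ}(s) = t ^ (-γ) Φ_γ(s t ^ (-γ))`. -/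
def wrightKernel (γ t s : ℝ) : ℝ := t ^ (-γ) * wright γ (s * t ^ (-γ))

end FracVolterra

end

noncomputable section

namespace FracVolterra

/-! ### Hankel contours -/

section Hankel

/-! The substitution s = t^α z turns the subordination integral into S(t)x = ∫ Φ_α(z) T(t^α z)x dz,
so the theorem rests on three facts about Φ_α on [0, ∞).

Decay: inserting Hankel's integral for 1/Γ into the series writes Φ_α(z) as a contour integral of
exp(e^ζ + αζ - z e^(αζ)). Moving the contour to the right shows that Φ_α decays faster than every
exponential (`exists_abs_wright_le`), so all the integrals converge.

Moments: Fubini on the same contour gives ∫ Φ_α(z) z^k dz = k!/Γ(αk+1) (`integral_wright_mul_pow`).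
Hence ∫ Φ_α(z) e^(xz) dz is the Mittag-Leffler function E_α(x), and E_α(y^α) ≤ C e^y by comparison
with the exponential series (`exists_integral_wright_mul_exp_le`).

Positivity, in the weak form ∫ Φ_α(z) z^k e^(-xz) dz ≥ 0, that is, complete monotonicity of x ↦
E_α(-x) (`integral_wright_mul_pow_mul_exp_nonneg`). The moments are limits of products obtained from
geometric sequences by operations that preserve this property; pointwise positivity of Φ_α is never
needed.

Exponential bound: with R = R(n, A), e^(sA_n) = e^(-ns) e^(sn²R). By positivity, the subordinated
family is a power series in R with nonnegative coefficients, and ‖R^j‖ ≤ M/(n-ω)^j. Its norm is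
therefore at most M E_α(t^α nω/(n-ω)), where nω/(n-ω) ≤ 2ω once n ≥ 2ω.

Resolvent families: for bounded X the subordinated family is ∑ t^(αk) X^k/Γ(αk+1), and the Beta
integral shows that convolution with g_α moves each term to the next. For A itself, e^(sA_n)x →
T(s)x on D(A) with an explicit error; subordination keeps it, and density with uniform bounds
extends it to B. The equation for A is the limit of the equations for A_n. -/

lemma linear_le_mul_exp {a b : ℝ} (ha : 0 < a) (hb : 0 ≤ b) (t : ℝ) :
    b * t ≤ a * Real.exp t + b * (b / a) := by
  have h1 : t - b / a + 1 ≤ Real.exp (t - b / a) := Real.add_one_le_exp _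
  have h2 : b / a + 1 ≤ Real.exp (b / a) := Real.add_one_le_exp _
  have h3 : Real.exp (t - b / a) * Real.exp (b / a) = Real.exp t := by
    rw [← Real.exp_add]; ring_nf
  have h4 : b ≤ a * Real.exp (b / a) := by
    have : a * (b / a) = b := by field_simp
    nlinarith
  have h5 := Real.exp_pos (t - b / a)
  nlinarith [mul_le_mul_of_nonneg_left h4 h5.le]

/-- Since γ < 1, the term a e^x wins as soon as (1 - γ)x ≥ z/a; before that threshold, z e^(γx) is
at most its value there. -/
lemma mul_exp_mul_le_mul_exp {γ : ℝ} (h0 : 0 < γ) (h1 : γ < 1) {a z : ℝ} (ha : 0 < a)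
    (hz : 0 ≤ z) (x : ℝ) :
    z * Real.exp (γ * x) ≤ a * Real.exp x + z * Real.exp (γ * (z / a / (1 - γ))) := by
  have h1' : 0 < 1 - γ := by linarith
  rcases le_total x (z / a / (1 - γ)) with h | h
  · have : Real.exp (γ * x) ≤ Real.exp (γ * (z / a / (1 - γ))) := by gcongr
    have h2 := Real.exp_pos x
    nlinarith
  · have h2 : z / a ≤ (1 - γ) * x := by
      rw [div_le_iff₀ h1'] at h; linarith
    have h3 : z / a ≤ Real.exp ((1 - γ) * x) := by
      linarith [Real.add_one_le_exp ((1 - γ) * x)]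
    have h4 : z ≤ a * Real.exp ((1 - γ) * x) := by
      rw [div_le_iff₀ ha] at h3; linarith
    have h5 : Real.exp ((1 - γ) * x) * Real.exp (γ * x) = Real.exp x := by
      rw [← Real.exp_add]; ring_nf
    have h6 := Real.exp_pos (γ * x)
    have h7 := Real.exp_pos (γ * (z / a / (1 - γ)))
    nlinarith [mul_le_mul_of_nonneg_right h4 h6.le, mul_nonneg hz h7.le]

/-- Half of κ e^x absorbs z e^(γx), the other half absorbs (s + 1)(x - L), and one unit of linear
decay is left over. -/
lemma exp_neg_exp_le {γ : ℝ} (h0 : 0 < γ) (h1 : γ < 1) {κ z : ℝ} (hκ : 0 < κ)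
    (hz : 0 ≤ z) (s L : ℝ) :
    ∃ K, 0 < K ∧ ∀ x, L ≤ x →
      Real.exp (-κ * Real.exp x + z * Real.exp (γ * x) + s * x) ≤ K * Real.exp (-(x - L)) := by
  set c₁ := z * Real.exp (γ * (z / (κ / 2) / (1 - γ)))
  set a := κ / 2 * Real.exp L
  set c₂ := |s + 1| * (|s + 1| / a)
  refine ⟨Real.exp (c₁ + c₂ + s * L), Real.exp_pos _, fun x hx => ?_⟩
  rw [← Real.exp_add, Real.exp_le_exp]
  have e1 := mul_exp_mul_le_mul_exp h0 h1 (half_pos hκ) hz x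
  have e2 := linear_le_mul_exp (a := a) (b := |s + 1|) (by positivity) (abs_nonneg _) (x - L)
  have e3 : (s + 1) * (x - L) ≤ |s + 1| * (x - L) :=
    mul_le_mul_of_nonneg_right (le_abs_self _) (by linarith)
  have e4 : a * Real.exp (x - L) = κ / 2 * Real.exp x := by
    simp only [a]; rw [mul_assoc, ← Real.exp_add]; ring_nf
  rw [e4] at e2
  change _ ≤ _ + c₁ at e1
  change _ ≤ _ + c₂ at e2
  linarith

/-- Real part of the Hankel path. -/
def hankelRe (L ψ y : ℝ) : ℝ := L + max (|y| - ψ) 0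

/-- Imaginary part of the Hankel path. -/
def hankelIm (ψ y : ℝ) : ℝ := max (-ψ) (min ψ y)

/-- The logarithm of a Hankel contour: it comes from `+∞ - iψ` to `L - iψ`, runs vertically to
`L + iψ`, and goes back to `+∞ + iψ`. -/
def hankelPath (L ψ y : ℝ) : ℂ := (hankelRe L ψ y : ℂ) + (hankelIm ψ y : ℂ) * Complex.I

/-- The velocity of the Hankel path. -/
def hankelDir (ψ y : ℝ) : ℂ := if y ≤ -ψ then -1 else if y ≤ ψ then Complex.I else 1

variable {L ψ y : ℝ}

@[simp] lemma hankelPath_re : (hankelPath L ψ y).re = hankelRe L ψ y := by simp [hankelPath]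

@[simp] lemma hankelPath_im : (hankelPath L ψ y).im = hankelIm ψ y := by simp [hankelPath]

lemma continuous_hankelRe : Continuous (hankelRe L ψ) := by unfold hankelRe; fun_prop

lemma continuous_hankelIm : Continuous (hankelIm ψ) := by unfold hankelIm; fun_prop

@[fun_prop]
lemma continuous_hankelPath : Continuous (hankelPath L ψ) := by
  have := continuous_hankelRe (L := L) (ψ := ψ)
  have := continuous_hankelIm (ψ := ψ)
  unfold hankelPath; fun_prop

lemma measurable_hankelDir : Measurable (hankelDir ψ) := by
  unfold hankelDir
  exact Measurable.ite measurableSet_Iic measurable_const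
    (Measurable.ite measurableSet_Iic measurable_const measurable_const)

lemma norm_hankelDir (ψ y : ℝ) : ‖hankelDir ψ y‖ = 1 := by
  unfold hankelDir; split_ifs <;> simp

lemma le_hankelRe : L ≤ hankelRe L ψ y := by
  unfold hankelRe; linarith [le_max_right (|y| - ψ) 0]

lemma abs_sub_le_hankelRe : |y| - ψ ≤ hankelRe L ψ y - L := by
  unfold hankelRe; linarith [le_max_left (|y| - ψ) 0]

lemma abs_hankelIm_le (hψ : 0 < ψ) : |hankelIm ψ y| ≤ ψ := by
  unfold hankelIm
  rw [abs_le]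
  exact ⟨le_max_left _ _, max_le (by linarith) (min_le_left _ _)⟩

lemma hankelPath_of_ge (hψ : 0 < ψ) (h : ψ ≤ y) :
    hankelPath L ψ y = ((L + (y - ψ) : ℝ) : ℂ) + ψ * Complex.I := by
  have : |y| = y := abs_of_pos (by linarith)
  simp only [hankelPath, hankelRe, hankelIm, this, max_eq_left (sub_nonneg.2 h), min_eq_left h,
    max_eq_right (by linarith : -ψ ≤ ψ)]

lemma hankelPath_of_le (hψ : 0 < ψ) (h : y ≤ -ψ) :
    hankelPath L ψ y = ((L + (-ψ - y) : ℝ) : ℂ) - ψ * Complex.I := by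
  have h1 : |y| = -y := abs_of_neg (by linarith)
  simp only [hankelPath, hankelRe, hankelIm, h1, max_eq_left (by linarith : 0 ≤ -y - ψ),
    min_eq_right (by linarith : y ≤ ψ), max_eq_left h]
  push_cast; ring

lemma hankelPath_of_mem (h : y ∈ Icc (-ψ) ψ) :
    hankelPath L ψ y = (L : ℂ) + y * Complex.I := by
  have h1 : |y| ≤ ψ := abs_le.2 h
  simp only [hankelPath, hankelRe, hankelIm, max_eq_right (by linarith : |y| - ψ ≤ 0),
    min_eq_right h.2, max_eq_right h.1, add_zero]

/-- The right side covers both pieces of the path: on the segment the real part is L and cos ≤ 1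
suffices, while on the rays the cosine equals cos ψ. -/
lemma exp_mul_cos_hankelIm_le (hψ : Real.pi / 2 < ψ) :
    Real.exp (hankelRe L ψ y) * Real.cos (hankelIm ψ y) ≤
      (1 - Real.cos ψ) * Real.exp L + Real.cos ψ * Real.exp (hankelRe L ψ y) := by
  have hpi := Real.pi_pos
  have hψ0 : 0 < ψ := by linarith
  rcases le_total |y| ψ with h | h
  · have : hankelRe L ψ y = L := by simp [hankelRe, h]
    rw [this]
    have := Real.cos_le_one (hankelIm ψ y)
    have := Real.exp_pos L
    nlinarith
  · have : Real.cos (hankelIm ψ y) = Real.cos ψ := by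
      rcases le_abs'.1 h with h | h
      · have : hankelIm ψ y = -ψ := by
          simp [hankelIm, h, min_eq_right (by linarith : y ≤ ψ)]
        rw [this, Real.cos_neg]
      · have : hankelIm ψ y = ψ := by simp [hankelIm, h, hψ0.le]
        rw [this]
    rw [this]
    have := Real.cos_le_one ψ
    have := Real.exp_pos L
    nlinarith

/-- Integrands `exp (exp ζ + s ζ)`, even multiplied by `exp (z * exp (γ * re ζ))`, decay
exponentially along Hankel paths. -/
lemma exists_hankel_bound {γ : ℝ} (h0 : 0 < γ) (h1 : γ < 1) (hψ : Real.pi / 2 < ψ)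
    (hψ' : ψ < Real.pi) {z : ℝ} (hz : 0 ≤ z) (s L : ℝ) :
    ∃ K, 0 < K ∧ ∀ y, Real.exp (Real.exp (hankelRe L ψ y) * Real.cos (hankelIm ψ y) +
      z * Real.exp (γ * hankelRe L ψ y) + s * hankelRe L ψ y) ≤ K * Real.exp (-|y|) := by
  have hκ : 0 < -Real.cos ψ := by
    have := Real.cos_neg_of_pi_div_two_lt_of_lt hψ (by linarith [Real.pi_pos])
    linarith
  obtain ⟨K, hK, hb⟩ := exp_neg_exp_le h0 h1 hκ hz s L
  refine ⟨Real.exp ((1 - Real.cos ψ) * Real.exp L) * K * Real.exp ψ, by positivity, fun y => ?_⟩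
  have e1 := exp_mul_cos_hankelIm_le (L := L) (y := y) hψ
  have e2 := hb (hankelRe L ψ y) le_hankelRe
  have e3 := abs_sub_le_hankelRe (L := L) (ψ := ψ) (y := y)
  calc _ ≤ Real.exp ((1 - Real.cos ψ) * Real.exp L + (- -Real.cos ψ * Real.exp (hankelRe L ψ y) +
      z * Real.exp (γ * hankelRe L ψ y) + s * hankelRe L ψ y)) := by
        apply Real.exp_le_exp.2; linarith
    _ ≤ Real.exp ((1 - Real.cos ψ) * Real.exp L) * (K * Real.exp (-(hankelRe L ψ y - L))) := by
        rw [Real.exp_add]; gcongr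
    _ ≤ Real.exp ((1 - Real.cos ψ) * Real.exp L) * (K * Real.exp (ψ + -|y|)) := by
        gcongr; linarith
    _ = _ := by rw [Real.exp_add]; ring

lemma integrable_exp_neg_abs : Integrable (fun y : ℝ => Real.exp (-|y|)) := by
  rw [← integrableOn_univ, ← Iic_union_Ioi (a := (0 : ℝ))]
  refine IntegrableOn.union ?_ ?_
  · refine (integrableOn_exp_Iic 0).congr_fun (fun y hy => ?_) measurableSet_Iic
    simp only [abs_of_nonpos (mem_Iic.1 hy), neg_neg]
  · refine (integrableOn_exp_neg_Ioi 0).congr_fun (fun y hy => ?_) measurableSet_Ioi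
    simp only [abs_of_pos (mem_Ioi.1 hy)]

lemma integrable_of_hankel_bound {f : ℝ → ℂ} (hf : AEStronglyMeasurable f)
    {γ : ℝ} (h0 : 0 < γ) (h1 : γ < 1) (hψ : Real.pi / 2 < ψ)
    (hψ' : ψ < Real.pi) {z : ℝ} (hz : 0 ≤ z) {s L : ℝ}
    (hb : ∀ y, ‖f y‖ ≤ Real.exp (Real.exp (hankelRe L ψ y) * Real.cos (hankelIm ψ y) +
      z * Real.exp (γ * hankelRe L ψ y) + s * hankelRe L ψ y)) : Integrable f := by
  obtain ⟨K, hK, h⟩ := exists_hankel_bound h0 h1 hψ hψ' hz s L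
  exact (integrable_exp_neg_abs.const_mul K).mono' hf
    (Eventually.of_forall fun y => (hb y).trans (h y))

lemma norm_exp_exp_add (s : ℝ) (ζ : ℂ) : ‖Complex.exp (Complex.exp ζ + s * ζ)‖ =
    Real.exp (Real.exp ζ.re * Real.cos ζ.im + s * ζ.re) := by
  rw [Complex.norm_exp]; simp [Complex.exp_re]

lemma integrable_hankel (hψ : Real.pi / 2 < ψ) (hψ' : ψ < Real.pi) (s L : ℝ) :
    Integrable (fun y => Complex.exp (Complex.exp (hankelPath L ψ y) + s * hankelPath L ψ y) *
      hankelDir ψ y) := by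
  -- With z = 0 the value of γ is immaterial.
  refine integrable_of_hankel_bound (γ := 1 / 2) (z := 0) (s := s) (L := L) (ψ := ψ) ?_ (by norm_num)
    (by norm_num) hψ hψ' le_rfl fun y => ?_
  · exact (by fun_prop : Continuous fun y => Complex.exp (Complex.exp (hankelPath L ψ y) +
      s * hankelPath L ψ y)).aestronglyMeasurable.mul
        measurable_hankelDir.aestronglyMeasurable
  · rw [norm_mul, norm_hankelDir, mul_one, norm_exp_exp_add]
    simp

/-- A Hankel integral as a sum of integrals over the two rays and the vertical segment. -/
lemma integral_hankel_eq (hψ : 0 < ψ) {f : ℂ → ℂ}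
    (hf : Integrable (fun y => f (hankelPath L ψ y) * hankelDir ψ y)) :
    ∫ y, f (hankelPath L ψ y) * hankelDir ψ y =
      (∫ x in Ioi L, f (x + ψ * Complex.I)) - (∫ x in Ioi L, f (x - ψ * Complex.I)) +
        Complex.I * ∫ y in (-ψ)..ψ, f (L + y * Complex.I) := by
  set g := fun y => f (hankelPath L ψ y) * hankelDir ψ y with hg
  have e1 : ∫ y in Iic (-ψ), g y = - ∫ x in Ioi L, f (x - ψ * Complex.I) := by
    have : ∫ y in Iic (-ψ), g y =
        ∫ y in Iic (-ψ), -f (((L + (-ψ - y) : ℝ) : ℂ) - ψ * Complex.I) := by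
      refine setIntegral_congr_fun measurableSet_Iic fun y hy => ?_
      simp only [hg, hankelPath_of_le hψ hy, hankelDir, if_pos (mem_Iic.1 hy)]
      ring
    rw [this, integral_neg]
    congr 1
    have h3 := (integral_comp_neg_Iic (-ψ)
      (fun y : ℝ => f (((L - ψ + y : ℝ) : ℂ) - ψ * Complex.I)))
    have h4 : ∫ x in Ioi ψ, f (((L - ψ + x : ℝ) : ℂ) - ψ * Complex.I) =
        ∫ x in Ioi L, f (x - ψ * Complex.I) := by
      have := (measurePreserving_add_left volume (L - ψ)).setIntegral_preimage_emb
        (measurableEmbedding_addLeft (L - ψ)) (fun x : ℝ => f (x - ψ * Complex.I)) (Ioi L)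
      rw [← this]
      congr 2
      ext x; simp
    rw [neg_neg] at h3
    rw [← h4, ← h3]
    refine setIntegral_congr_fun measurableSet_Iic fun y _ => ?_
    show f _ = f _; congr 2; push_cast; ring
  have e2 : ∫ y in Ioi ψ, g y = ∫ x in Ioi L, f (x + ψ * Complex.I) := by
    have h4 : ∫ x in Ioi ψ, f (((L - ψ + x : ℝ) : ℂ) + ψ * Complex.I) =
        ∫ x in Ioi L, f (x + ψ * Complex.I) := by
      have := (measurePreserving_add_left volume (L - ψ)).setIntegral_preimage_emb
        (measurableEmbedding_addLeft (L - ψ)) (fun x : ℝ => f (x + ψ * Complex.I)) (Ioi L)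
      rw [← this]
      congr 2
      ext x; simp
    rw [← h4]
    refine setIntegral_congr_fun measurableSet_Ioi fun y hy => ?_
    have hy' := mem_Ioi.1 hy
    simp only [hg, hankelPath_of_ge hψ hy'.le, hankelDir, if_neg (by linarith : ¬ y ≤ -ψ),
      if_neg (not_le.2 hy'), mul_one]
    congr 3; ring
  have e3 : ∫ y in (-ψ)..ψ, g y = Complex.I * ∫ y in (-ψ)..ψ, f (L + y * Complex.I) := by
    rw [← intervalIntegral.integral_const_mul, intervalIntegral.integral_of_le (by linarith),
      intervalIntegral.integral_of_le (by linarith)]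
    refine setIntegral_congr_fun measurableSet_Ioc fun y hy => ?_
    simp only [hg, hankelPath_of_mem (Ioc_subset_Icc_self hy), hankelDir, if_neg (not_le.2 hy.1),
      if_pos hy.2]
    ring
  have e4 : ∫ y, g y = (∫ y in Iic (-ψ), g y) + ((∫ y in (-ψ)..ψ, g y) + ∫ y in Ioi ψ, g y) := by
    rw [← intervalIntegral.integral_Iic_add_Ioi hf.integrableOn hf.integrableOn (b := -ψ)]
    congr 1
    rw [intervalIntegral.integral_of_le (by linarith), ← setIntegral_union _ measurableSet_Ioi
      hf.integrableOn hf.integrableOn, Ioc_union_Ioi_eq_Ioi (by linarith)]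
    exact Set.disjoint_left.2 fun a ha hb => not_lt.2 ha.2 hb
  rw [e4, e1, e2, e3]; ring

end Hankel

/-! ### Hankel's integral for the reciprocal Gamma function -/

section HankelGamma

open Complex (I)

variable {L ψ : ℝ}

/-- The integrand of Hankel's integral for `1 / Γ`, in logarithmic coordinates. -/
def hankelFun (s : ℝ) (ζ : ℂ) : ℂ := Complex.exp (Complex.exp ζ + s * ζ)

lemma differentiable_hankelFun (s : ℝ) : Differentiable ℂ (hankelFun s) := by
  unfold hankelFun; fun_prop

@[fun_prop]
lemma continuous_hankelFun (s : ℝ) : Continuous (hankelFun s) :=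
  (differentiable_hankelFun s).continuous

lemma norm_hankelFun (s x θ : ℝ) : ‖hankelFun s (x + θ * I)‖ =
    Real.exp (Real.exp x * Real.cos θ + s * x) := by
  rw [hankelFun, norm_exp_exp_add]; simp

lemma norm_hankelFun_le {κ : ℝ} (hκ : 0 < κ) (s L : ℝ) :
    ∃ K, 0 < K ∧ ∀ x θ : ℝ, L ≤ x → Real.cos θ ≤ -κ →
      ‖hankelFun s (x + θ * I)‖ ≤ K * Real.exp (-(x - L)) := by
  obtain ⟨K, hK, h⟩ := exp_neg_exp_le (γ := 1 / 2) (by norm_num) (by norm_num) hκ le_rfl s L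
  refine ⟨K, hK, fun x θ hx hθ => ?_⟩
  rw [norm_hankelFun]
  refine le_trans ?_ (h x hx)
  apply Real.exp_le_exp.2
  nlinarith [Real.exp_pos x]

lemma integrableOn_exp_neg_sub (L : ℝ) : IntegrableOn (fun x => Real.exp (-(x - L))) (Ioi L) := by
  have := (integrableOn_exp_neg_Ioi L).const_mul (Real.exp L)
  refine this.congr (Eventually.of_forall fun x => ?_)
  simp only [← Real.exp_add]; congr 1; ring

lemma integrableOn_hankelFun_ray {θ : ℝ} (hθ : Real.cos θ < 0) (s L : ℝ) :
    IntegrableOn (fun x : ℝ => hankelFun s (x + θ * I)) (Ioi L) := by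
  obtain ⟨K, hK, h⟩ := norm_hankelFun_le (κ := -Real.cos θ) (by linarith) s L
  refine ((integrableOn_exp_neg_sub L).const_mul K).mono'
    (Continuous.aestronglyMeasurable (by fun_prop)) ?_
  filter_upwards [self_mem_ae_restrict measurableSet_Ioi] with x hx
  exact h x θ (le_of_lt hx) (by simp)

lemma hankelFun_rect (s x₁ x₂ θ₁ θ₂ : ℝ) :
    (∫ x in x₁..x₂, hankelFun s (x + θ₁ * I)) - (∫ x in x₁..x₂, hankelFun s (x + θ₂ * I)) +
      I * (∫ y in θ₁..θ₂, hankelFun s (x₂ + y * I)) -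
      I * (∫ y in θ₁..θ₂, hankelFun s (x₁ + y * I)) = 0 := by
  simpa using Complex.integral_boundary_rect_eq_zero_of_differentiableOn (hankelFun s)
    (x₁ + θ₁ * I) (x₂ + θ₂ * I) (differentiable_hankelFun s).differentiableOn

/-- Cauchy's theorem on a rectangle whose right edge recedes to infinity; the condition on cos θ
makes that edge vanish. This lets the rays at heights ±ψ be moved to ±π. -/
lemma hankelFun_halfStrip {κ θ₁ θ₂ : ℝ} (hκ : 0 < κ) (h12 : θ₁ ≤ θ₂)
    (h : ∀ θ ∈ Icc θ₁ θ₂, Real.cos θ ≤ -κ) (s L : ℝ) :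
    (∫ x in Ioi L, hankelFun s (x + θ₁ * I)) - (∫ x in Ioi L, hankelFun s (x + θ₂ * I)) -
      I * (∫ y in θ₁..θ₂, hankelFun s (L + y * I)) = 0 := by
  have t1 := intervalIntegral_tendsto_integral_Ioi L
    (integrableOn_hankelFun_ray (by linarith [h θ₁ (left_mem_Icc.2 h12)]) s L) tendsto_id
  have t2 := intervalIntegral_tendsto_integral_Ioi L
    (integrableOn_hankelFun_ray (by linarith [h θ₂ (right_mem_Icc.2 h12)]) s L) tendsto_id
  have t3 : Tendsto (fun R : ℝ => ∫ y in θ₁..θ₂, hankelFun s (R + y * I)) atTop (𝓝 0) := by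
    obtain ⟨K, hK, hb⟩ := norm_hankelFun_le hκ s L
    have t : Tendsto (fun R : ℝ => K * Real.exp (-(R - L)) * |θ₂ - θ₁|) atTop (𝓝 0) := by
      have : Tendsto (fun R : ℝ => Real.exp (-(R - L))) atTop (𝓝 0) :=
        Real.tendsto_exp_neg_atTop_nhds_zero.comp (tendsto_atTop_add_const_right _ (-L) tendsto_id)
      simpa using (this.const_mul K).mul_const |θ₂ - θ₁|
    refine squeeze_zero_norm' ?_ t
    filter_upwards [eventually_ge_atTop L] with R hR
    refine intervalIntegral.norm_integral_le_of_norm_le_const fun y hy => ?_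
    rw [uIoc_of_le h12] at hy
    exact hb R y hR (h y (Ioc_subset_Icc_self hy))
  have t4 := ((t1.sub t2).add (t3.const_mul I)).sub_const
    (I * (∫ y in θ₁..θ₂, hankelFun s (L + y * I)))
  simp only [id, hankelFun_rect, mul_zero, add_zero] at t4
  exact (tendsto_nhds_unique t4 tendsto_const_nhds)

lemma hankelFun_add_pi (s x : ℝ) : hankelFun s (x + Real.pi * I) =
    Real.exp (-Real.exp x + s * x) * Complex.exp (s * Real.pi * I) := by
  rw [hankelFun, Complex.exp_add (x : ℂ), Complex.exp_pi_mul_I, Complex.ofReal_exp,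
    ← Complex.exp_add]
  push_cast; ring_nf

lemma hankelFun_sub_pi (s x : ℝ) : hankelFun s (x + (-Real.pi : ℝ) * I) =
    Real.exp (-Real.exp x + s * x) * Complex.exp (-(s * Real.pi * I)) := by
  have : Complex.exp (((-Real.pi : ℝ) : ℂ) * I) = -1 := by
    push_cast; rw [neg_mul, Complex.exp_neg, Complex.exp_pi_mul_I]; norm_num
  rw [hankelFun, Complex.exp_add (x : ℂ), this, Complex.ofReal_exp, ← Complex.exp_add]
  push_cast; ring_nf

lemma integrable_hankelFun (hψ : Real.pi / 2 < ψ) (hψ' : ψ < Real.pi) (s L : ℝ) :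
    Integrable (fun y => hankelFun s (hankelPath L ψ y) * hankelDir ψ y) :=
  integrable_hankel hψ hψ' s L

/-- On both sides of the cut e^ζ is the same negative number; only the phases e^(±iπs) differ, and
their difference is the sine of the reflection formula. -/
lemma integral_hankelFun_pi_sub (s R : ℝ) :
    (∫ x in Ioi R, hankelFun s (x + Real.pi * I)) -
      (∫ x in Ioi R, hankelFun s (x + (-Real.pi : ℝ) * I)) =
      2 * I * Real.sin (Real.pi * s) * (∫ x in Ioi R, Real.exp (-Real.exp x + s * x) : ℝ) := by
  simp only [hankelFun_add_pi, hankelFun_sub_pi]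
  rw [integral_mul_const, integral_mul_const, integral_complex_ofReal, ← mul_sub]
  have : Complex.exp (s * Real.pi * I) - Complex.exp (-(s * Real.pi * I)) =
      2 * I * Real.sin (Real.pi * s) := by
    rw [Complex.ofReal_sin, Complex.sin]
    push_cast
    have h1 : (s : ℂ) * Real.pi * I = Real.pi * s * I := by ring
    rw [h1, neg_mul]
    linear_combination (Complex.exp (-(Real.pi * s * I)) - Complex.exp (Real.pi * s * I)) *
      (-Complex.I_mul_I)
  rw [this]; ring

/-- Hankel's integral, the contour being deformed onto both sides of the negative axis. -/
lemma integral_hankel_eq_collapsed (hψ : Real.pi / 2 < ψ) (hψ' : ψ < Real.pi) (s L R : ℝ) :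
    ∫ y, hankelFun s (hankelPath L ψ y) * hankelDir ψ y =
      2 * I * Real.sin (Real.pi * s) * (∫ x in Ioi R, Real.exp (-Real.exp x + s * x) : ℝ) +
      I * ∫ y in (-Real.pi)..Real.pi, hankelFun s (R + y * I) := by
  have hpi := Real.pi_pos
  have hcos : Real.cos ψ < 0 := Real.cos_neg_of_pi_div_two_lt_of_lt hψ (by linarith)
  have hmono : ∀ θ ∈ Icc ψ Real.pi, Real.cos θ ≤ -(-Real.cos ψ) := fun θ hθ => by
    rw [neg_neg]; exact Real.cos_le_cos_of_nonneg_of_le_pi (by linarith) hθ.2 hθ.1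
  rw [integral_hankel_eq (f := hankelFun s) (by linarith) (integrable_hankelFun hψ hψ' s L)]
  -- `j1` and `j2` move the rays from ±ψ to ±π, and `j3` shifts the vertical segment from abscissa L
  -- to R.
  have j1 := hankelFun_halfStrip (by linarith) hψ'.le hmono s L
  have j2 := hankelFun_halfStrip (θ₁ := -Real.pi) (θ₂ := -ψ) (κ := -Real.cos ψ)
    (by linarith) (by linarith) (fun θ hθ => by
      rw [← Real.cos_neg]; exact hmono _ ⟨by linarith [hθ.2], by linarith [hθ.1]⟩) s L
  have j3 := hankelFun_rect s R L (-Real.pi) Real.pi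
  -- The bookkeeping of the contour pieces is pure linear algebra, so it is isolated from the
  -- integrals.
  have alg : ∀ a1 a2 a3 a4 a5 a6 a7 a8 a9 b1 b2 b3 c1 c2 d a2' : ℂ, a1 - a3 - I * b3 = 0 →
      a4 - a2 - I * b2 = 0 → a5 - a6 + I * a7 - I * a8 = 0 → b2 + a9 = b1 → b1 + b3 = a7 →
      a6 + a3 = c1 → a5 + a4 = c2 → c1 - c2 = d → a2' = a2 →
      a1 - a2' + I * a9 = d + I * a8 := by
    intro a1 a2 a3 a4 a5 a6 a7 a8 a9 b1 b2 b3 c1 c2 d a2' j1 j2 j3 k1 k2 k3 k4 k5 e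
    linear_combination j1 + j2 + j3 + I * k1 + I * k2 + k3 - k4 + k5 - e
  have cc : Continuous fun y : ℝ => hankelFun s (L + y * I) := by fun_prop
  have k1 := intervalIntegral.integral_add_adjacent_intervals
    (cc.intervalIntegrable (-Real.pi) (-ψ)) (cc.intervalIntegrable (-ψ) ψ) (μ := volume)
  have k2 := intervalIntegral.integral_add_adjacent_intervals
    (cc.intervalIntegrable (-Real.pi) ψ) (cc.intervalIntegrable ψ Real.pi) (μ := volume)
  have i1 := integrableOn_hankelFun_ray (θ := Real.pi) (by simp) s
  have i2 := integrableOn_hankelFun_ray (θ := -Real.pi) (by simp) s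
  have k3 := intervalIntegral.integral_interval_add_Ioi (i1 R) (i1 L)
  have k4 := intervalIntegral.integral_interval_add_Ioi (i2 R) (i2 L)
  have e : (fun x : ℝ => hankelFun s (x - ψ * I)) =
    fun x : ℝ => hankelFun s (x + (-ψ : ℝ) * I) := by ext x; push_cast; ring_nf
  have e' : ∫ x in Ioi L, hankelFun s (x - ψ * I) =
      ∫ x in Ioi L, hankelFun s (x + (-ψ : ℝ) * I) := by rw [e]
  exact alg _ _ _ _ _ _ _ _ _ _ _ _ _ _ _ _ j1 j2 j3 k1 k2 k3 k4
    (integral_hankelFun_pi_sub s R) e'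

/-- The substitution u = e^x gives Euler's integral over (e^R, ∞), and e^R → 0. -/
lemma tendsto_integral_exp_neg_exp {s : ℝ} (hs : 0 < s) :
    Tendsto (fun R => ∫ x in Ioi R, Real.exp (-Real.exp x + s * x)) atBot
      (𝓝 (Real.Gamma s)) := by
  have e : ∀ R : ℝ, ∫ x in Ioi R, Real.exp (-Real.exp x + s * x) =
      ∫ u in Ioi (Real.exp R), Real.exp (-u) * u ^ (s - 1) := fun R => by
    rw [← integral_comp_exp_Ioi (fun u => Real.exp (-u) * u ^ (s - 1))]
    refine setIntegral_congr_fun measurableSet_Ioi fun x _ => ?_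
    simp only [smul_eq_mul]
    rw [← Real.exp_mul, ← Real.exp_add, ← Real.exp_add]; ring_nf
  simp only [e, Real.Gamma_eq_integral hs]
  have h1 : AECover (volume.restrict (Ioi (0 : ℝ))) atBot fun R : ℝ => Ioi (Real.exp R) :=
    aecover_Ioi_of_Ioi Real.tendsto_exp_atBot
  have h2 := h1.integral_tendsto_of_countably_generated (Real.GammaIntegral_convergent hs)
  refine h2.congr fun R => ?_
  rw [Measure.restrict_restrict measurableSet_Ioi,
    inter_eq_left.2 (Ioi_subset_Ioi (Real.exp_pos R).le)]

/-- The segment at abscissa R is, in the variable e^ζ, the circle of radius e^R about the origin.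
The integrand has size about e^(sR), so the circle contributes in the limit only if s = 0. -/
lemma tendsto_integral_hankelFun_atBot {s : ℝ} (hs : 0 ≤ s) :
    Tendsto (fun R : ℝ => ∫ y in (-Real.pi)..Real.pi, hankelFun s (R + y * I)) atBot
      (𝓝 (if s = 0 then 2 * Real.pi else 0)) := by
  have key : Tendsto (fun R : ℝ => ∫ y in (-Real.pi)..Real.pi, hankelFun s (R + y * I)) atBot
      (𝓝 (∫ y in (-Real.pi)..Real.pi, if s = 0 then 1 else 0)) := by
    refine intervalIntegral.tendsto_integral_filter_of_dominated_convergence (fun _ => Real.exp 1)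
      (Eventually.of_forall fun R => Continuous.aestronglyMeasurable (by fun_prop)) ?_
      (by simp) (Eventually.of_forall fun y _ => ?_)
    · filter_upwards [eventually_le_atBot 0] with R hR
      refine Eventually.of_forall fun y _ => ?_
      rw [norm_hankelFun, Real.exp_le_exp]
      have h1 : Real.exp R ≤ 1 := Real.exp_le_one_iff.2 hR
      have h2 := Real.cos_le_one y
      have h3 := Real.exp_pos R
      nlinarith
    · have t0 : Tendsto (fun R : ℝ => ((Real.exp R : ℝ) : ℂ)) atBot (𝓝 0) := by
        simpa [Function.comp_def] using
          (Complex.continuous_ofReal.tendsto 0).comp Real.tendsto_exp_atBot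
      have t1 : Tendsto (fun R : ℝ => Complex.exp (Complex.exp (R + y * I))) atBot (𝓝 1) := by
        have : Tendsto (fun R : ℝ => ((Real.exp R : ℝ) : ℂ) * Complex.exp (y * I)) atBot (𝓝 0) := by
          simpa using t0.mul_const (Complex.exp (y * I))
        have h := (Complex.continuous_exp.tendsto 0).comp this
        simp only [Complex.exp_zero] at h
        refine h.congr fun R => ?_
        simp [Complex.exp_add]
      split_ifs with h
      · refine t1.congr fun R => ?_
        simp [hankelFun, h]
      · have hs' : 0 < s := lt_of_le_of_ne hs (Ne.symm h)
        have t2 : Tendsto (fun R : ℝ => Complex.exp (s * (R + y * I))) atBot (𝓝 0) := by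
          rw [tendsto_zero_iff_norm_tendsto_zero]
          have : Tendsto (fun R : ℝ => Real.exp (s * R)) atBot (𝓝 0) :=
            Real.tendsto_exp_atBot.comp (tendsto_id.const_mul_atBot hs')
          refine this.congr fun R => ?_
          rw [Complex.norm_exp]; simp
        have := t1.mul t2
        rw [mul_zero] at this
        refine this.congr fun R => ?_
        rw [hankelFun, Complex.exp_add (Complex.exp _)]
  convert! key using 2
  split_ifs
  · simp; ring
  · simp

/-- The collapsed form does not depend on R, so it equals its limit as R → -∞: the circle alone if s
= 0, the two sides of the cut and the reflection formula if s > 0. -/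
lemma integral_hankelFun_of_nonneg (hψ : Real.pi / 2 < ψ) (hψ' : ψ < Real.pi) {s : ℝ}
    (hs : 0 ≤ s) (L : ℝ) : ∫ y, hankelFun s (hankelPath L ψ y) * hankelDir ψ y =
      2 * Real.pi * I * ((Real.Gamma (1 - s))⁻¹ : ℝ) := by
  rcases hs.eq_or_lt with rfl | hs'
  · have t := (tendsto_integral_hankelFun_atBot le_rfl).const_mul I
    have e : ∀ R : ℝ, I * ∫ y in (-Real.pi)..Real.pi, hankelFun 0 (R + y * I) =
        ∫ y, hankelFun 0 (hankelPath L ψ y) * hankelDir ψ y := fun R => by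
      rw [integral_hankel_eq_collapsed hψ hψ' 0 L R]; simp
    simp only [e] at t
    rw [tendsto_nhds_unique tendsto_const_nhds t]
    simp; ring
  · have t := (tendsto_integral_hankelFun_atBot hs).const_mul I
    have t2 := ((Complex.continuous_ofReal.tendsto _).comp
      (tendsto_integral_exp_neg_exp hs')).const_mul (2 * I * Real.sin (Real.pi * s))
    have t3 := t2.add t
    simp only [Function.comp_def, ← integral_hankel_eq_collapsed hψ hψ' s L] at t3
    rw [tendsto_nhds_unique tendsto_const_nhds t3, if_neg hs'.ne']
    have h1 := Real.Gamma_mul_Gamma_one_sub s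
    have h2 := (Real.Gamma_pos_of_pos hs').ne'
    have h3 : Real.sin (Real.pi * s) * Real.Gamma s = Real.pi * (Real.Gamma (1 - s))⁻¹ := by
      -- If the sine vanishes, 1 - s is a pole of Γ; there `Real.Gamma` is 0 and so is its inverse,
      -- and both sides are 0.
      by_cases h : Real.sin (Real.pi * s) = 0
      · rw [h, div_zero] at h1
        rcases mul_eq_zero.1 h1 with h4 | h4
        · exact absurd h4 h2
        · simp [h, h4]
      · rw [eq_div_iff h] at h1
        have h4 : Real.Gamma (1 - s) ≠ 0 := fun h4 => by
          rw [h4] at h1; simp at h1; exact Real.pi_ne_zero h1.symm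
        field_simp
        linarith
    have h5 : ((Real.sin (Real.pi * s) : ℝ) : ℂ) * (Real.Gamma s : ℝ) =
      (Real.pi : ℝ) * ((Real.Gamma (1 - s))⁻¹ : ℝ) := by exact_mod_cast h3
    linear_combination 2 * I * h5

lemma hasDerivAt_hankelFun (s : ℝ) (ζ : ℂ) :
    HasDerivAt (hankelFun s) (hankelFun (s + 1) ζ + s * hankelFun s ζ) ζ := by
  have h := (((Complex.hasDerivAt_exp ζ).add ((hasDerivAt_id ζ).const_mul (s : ℂ))).cexp)
  convert! h using 1
  simp only [hankelFun, id]
  have : Complex.exp ζ + ((s + 1 : ℝ) : ℂ) * ζ = (Complex.exp ζ + s * ζ) + ζ := by push_cast; ring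
  rw [this, Complex.exp_add _ ζ]
  simp only [Pi.add_apply]
  ring

/-- `hankelFun s` vanishes at both ends of the contour, so its derivative, computed in
`hasDerivAt_hankelFun`, integrates to 0. This is the functional equation that carries Hankel's
formula to negative s. -/
lemma integral_hankelFun_add_one (hψ : Real.pi / 2 < ψ) (hψ' : ψ < Real.pi) (s L : ℝ) :
    ∫ y, hankelFun (s + 1) (hankelPath L ψ y) * hankelDir ψ y =
      -s * ∫ y, hankelFun s (hankelPath L ψ y) * hankelDir ψ y := by
  have hpi := Real.pi_pos
  have hcos : Real.cos ψ < 0 := Real.cos_neg_of_pi_div_two_lt_of_lt hψ (by linarith)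
  have hcos' : Real.cos (-ψ) < 0 := by rwa [Real.cos_neg]
  have i1 := integrable_hankelFun hψ hψ' (s + 1) L
  have i2 := (integrable_hankelFun hψ hψ' s L).const_mul (s : ℂ)
  set F : ℂ → ℂ := fun ζ => hankelFun (s + 1) ζ + s * hankelFun s ζ with hF
  have i3 : Integrable (fun y => F (hankelPath L ψ y) * hankelDir ψ y) :=
    (i1.add i2).congr (Eventually.of_forall fun y => by simp only [hF, Pi.add_apply]; ring)
  have key : ∫ y, F (hankelPath L ψ y) * hankelDir ψ y = 0 := by
    rw [integral_hankel_eq (by linarith) i3]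
    have ray : ∀ θ : ℝ, Real.cos θ < 0 →
        ∫ x in Ioi L, F (x + θ * I) = 0 - hankelFun s (L + θ * I) := fun θ hθ => by
      refine integral_Ioi_of_hasDerivAt_of_tendsto' (f := fun x : ℝ => hankelFun s (x + θ * I))
        (fun x _ => ?_) ?_ ?_
      · have h1 : HasDerivAt (fun x : ℝ => (x : ℂ) + θ * I) 1 x :=
          (Complex.ofRealCLM.hasDerivAt).add_const _
        simpa [Function.comp_def] using (hasDerivAt_hankelFun s (x + θ * I)).scomp x h1
      · exact (integrableOn_hankelFun_ray hθ _ L).add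
          ((integrableOn_hankelFun_ray hθ s L).const_mul _)
      · obtain ⟨K, hK, hb⟩ := norm_hankelFun_le (κ := -Real.cos θ) (by linarith) s L
        have : Tendsto (fun R : ℝ => K * Real.exp (-(R - L))) atTop (𝓝 0) := by
          simpa [Function.comp_def, ← sub_eq_add_neg] using (Real.tendsto_exp_neg_atTop_nhds_zero.comp
            (tendsto_atTop_add_const_right _ (-L) tendsto_id)).const_mul K
        refine squeeze_zero_norm' ?_ this
        filter_upwards [eventually_ge_atTop L] with R hR
        exact hb R θ hR (by simp)
    have seg : I * ∫ y in (-ψ)..ψ, F (L + y * I) =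
        hankelFun s (L + ψ * I) - hankelFun s (L + (-ψ : ℝ) * I) := by
      rw [← intervalIntegral.integral_const_mul]
      refine intervalIntegral.integral_eq_sub_of_hasDerivAt
        (f := fun y : ℝ => hankelFun s (L + y * I)) (fun y _ => ?_) ?_
      · have h1 : HasDerivAt (fun y : ℝ => (L : ℂ) + y * I) I y := by
          simpa using ((Complex.ofRealCLM.hasDerivAt (x := y)).mul_const I).const_add (L : ℂ)
        simpa [Function.comp_def] using (hasDerivAt_hankelFun s (L + y * I)).scomp y h1
      · exact Continuous.intervalIntegrable (by simp only [hF]; fun_prop) _ _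
    have e : (fun x : ℝ => F (x - ψ * I)) =
      fun x : ℝ => F (x + (-ψ : ℝ) * I) := by ext x; push_cast; ring_nf
    rw [e, ray ψ hcos, ray (-ψ) hcos', seg]
    ring
  have h2 : ∫ y, F (hankelPath L ψ y) * hankelDir ψ y =
      (∫ y, hankelFun (s + 1) (hankelPath L ψ y) * hankelDir ψ y) +
      s * ∫ y, hankelFun s (hankelPath L ψ y) * hankelDir ψ y := by
    rw [← integral_const_mul]
    refine (integral_congr_ae (Eventually.of_forall fun y => ?_)).trans (integral_add i1 i2)
    simp only [hF]; ring
  rw [key] at h2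
  linear_combination -h2

/-- **Hankel's integral** for the reciprocal of the Gamma function. -/
theorem integral_hankelFun (hψ : Real.pi / 2 < ψ) (hψ' : ψ < Real.pi) (s L : ℝ) :
    ∫ y, hankelFun s (hankelPath L ψ y) * hankelDir ψ y =
      2 * Real.pi * I * ((Real.Gamma (1 - s))⁻¹ : ℝ) := by
  -- Each induction step extends the formula one unit further to the left by the functional
  -- equation.
  suffices h : ∀ (n : ℕ) (s : ℝ), -(n : ℝ) ≤ s →
      ∫ y, hankelFun s (hankelPath L ψ y) * hankelDir ψ y =
        2 * Real.pi * I * ((Real.Gamma (1 - s))⁻¹ : ℝ) by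
    obtain ⟨n, hn⟩ := exists_nat_ge (-s)
    exact h n s (by linarith)
  intro n
  induction n with
  | zero => exact fun s hs => integral_hankelFun_of_nonneg hψ hψ' (by simpa using hs) L
  | succ n ih =>
    intro s hs
    rcases le_or_gt 0 s with h | h
    · exact integral_hankelFun_of_nonneg hψ hψ' h L
    · have h1 := ih (s + 1) (by push_cast at hs; linarith)
      rw [integral_hankelFun_add_one hψ hψ'] at h1
      have h2 := Real.Gamma_add_one (s := -s) (by linarith)
      have h3 : Real.Gamma (1 - (s + 1)) ≠ 0 := (Real.Gamma_pos_of_pos (by linarith)).ne'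
      rw [show -s + 1 = 1 - s by ring, show -s = 1 - (s + 1) by ring] at h2
      have h4 : ((Real.Gamma (1 - (s + 1)))⁻¹ : ℝ) = -s * (Real.Gamma (1 - s))⁻¹ := by
        have h5 : s ≠ 0 := h.ne
        rw [h2, mul_inv, show (1 - (s + 1))⁻¹ = (-s)⁻¹ by ring_nf, ← mul_assoc,
          mul_inv_cancel₀ (neg_ne_zero.2 h5), one_mul]
      rw [h4] at h1
      have h5 : (s : ℂ) ≠ 0 := by exact_mod_cast h.ne
      push_cast at h1 ⊢
      apply mul_left_cancel₀ (neg_ne_zero.2 h5)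
      linear_combination h1

end HankelGamma

/-! ### The Wright function: contour integral, decay, moments -/

section Wright

open Complex (I)

variable {γ L ψ : ℝ}

/-- ψ > π/2 makes exp(e^ζ) decay along the rays, and γψ < π/2 keeps e^(γζ) in the right half-plane
along the whole path. The two are compatible because γ < 1. -/
lemma exists_hankel_angle (h0 : 0 < γ) (h1 : γ < 1) :
    ∃ ψ, Real.pi / 2 < ψ ∧ ψ < Real.pi ∧ γ * ψ < Real.pi / 2 := by
  have hpi := Real.pi_pos
  have h : Real.pi / 2 < min Real.pi (Real.pi / 2 / γ) := by
    refine lt_min (by linarith) ?_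
    rw [lt_div_iff₀ h0]; nlinarith
  obtain ⟨ψ, h2, h3⟩ := exists_between h
  refine ⟨ψ, h2, h3.trans_le (min_le_left _ _), ?_⟩
  have := h3.trans_le (min_le_right _ _)
  rw [lt_div_iff₀ h0] at this
  linarith

/-- The exponential factor of the contour integral for the Wright function. -/
def wrightExp (γ z : ℝ) (ζ : ℂ) : ℂ := Complex.exp (-(z * Complex.exp (γ * ζ)))

lemma norm_wrightExp (γ z : ℝ) (ζ : ℂ) :
    ‖wrightExp γ z ζ‖ = Real.exp (-(z * (Real.exp (γ * ζ.re) * Real.cos (γ * ζ.im)))) := by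
  rw [wrightExp, Complex.norm_exp]; simp [Complex.exp_re]

/-- The real part of e^(γζ) is bounded below on the path by combining the least real part L with the
largest angle ψ. The resulting decay rate in z grows with L. -/
lemma norm_wrightExp_hankelPath_le (h0 : 0 < γ) (hψ : 0 < ψ) (hγψ : γ * ψ < Real.pi / 2)
    {z : ℝ} (hz : 0 ≤ z) (y : ℝ) : ‖wrightExp γ z (hankelPath L ψ y)‖ ≤
      Real.exp (-(z * (Real.exp (γ * L) * Real.cos (γ * ψ)))) := by
  rw [norm_wrightExp, hankelPath_re, hankelPath_im, Real.exp_le_exp, neg_le_neg_iff]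
  have h1 : Real.exp (γ * L) ≤ Real.exp (γ * hankelRe L ψ y) :=
    Real.exp_le_exp.2 (mul_le_mul_of_nonneg_left le_hankelRe h0.le)
  have hpi := Real.pi_pos
  have h2 : Real.cos (γ * ψ) ≤ Real.cos (γ * hankelIm ψ y) := by
    rw [← Real.cos_abs (γ * hankelIm ψ y), abs_mul, abs_of_pos h0]
    exact Real.cos_le_cos_of_nonneg_of_le_pi (by positivity) (by linarith)
      (mul_le_mul_of_nonneg_left (abs_hankelIm_le hψ) h0.le)
  have h3 : 0 ≤ Real.cos (γ * ψ) :=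
    Real.cos_nonneg_of_neg_pi_div_two_le_of_le (by nlinarith) hγψ.le
  gcongr

/-- Expand `wrightExp` in powers of z; Hankel's formula with s = γ(n+1) evaluates each term. The sum
of the absolute values is again an exponential, which `exists_hankel_bound` makes integrable. -/
lemma hasSum_wright (h0 : 0 < γ) (h1 : γ < 1) (hψ : Real.pi / 2 < ψ) (hψ' : ψ < Real.pi)
    (L : ℝ) {z : ℝ} (hz : 0 ≤ z) :
    HasSum (fun n : ℕ => (((-z) ^ n / ((n.factorial : ℝ) * Real.Gamma (-γ * n + 1 - γ)) : ℝ) : ℂ))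
      ((2 * Real.pi * I)⁻¹ *
        ∫ y, wrightExp γ z (hankelPath L ψ y) * (hankelFun γ (hankelPath L ψ y) * hankelDir ψ y)) := by
  have hpi : (2 * Real.pi * I : ℂ) ≠ 0 := Complex.two_pi_I_ne_zero
  have term : ∀ n : ℕ,
      (((-z) ^ n / ((n.factorial : ℝ) * Real.Gamma (-γ * n + 1 - γ)) : ℝ) : ℂ) =
      (2 * Real.pi * I)⁻¹ * ∫ y, ((-z : ℂ) ^ n / n.factorial) *
        (hankelFun (γ * (n + 1)) (hankelPath L ψ y) * hankelDir ψ y) := fun n => by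
    rw [integral_const_mul, integral_hankelFun hψ hψ',
      show 1 - γ * (n + 1) = -γ * n + 1 - γ by ring]
    push_cast
    field_simp
  simp only [term]
  refine HasSum.mul_left _ ?_
  have hs : ∀ y, HasSum (fun n : ℕ => (z ^ n / n.factorial) *
      Real.exp (Real.exp (hankelRe L ψ y) * Real.cos (hankelIm ψ y) +
        γ * (n + 1) * hankelRe L ψ y)) (Real.exp (Real.exp (hankelRe L ψ y) *
        Real.cos (hankelIm ψ y) + z * Real.exp (γ * hankelRe L ψ y) + γ * hankelRe L ψ y)) :=
    fun y => by
      have h := (NormedSpace.expSeries_div_hasSum_exp (z * Real.exp (γ * hankelRe L ψ y))).mul_left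
        (Real.exp (Real.exp (hankelRe L ψ y) * Real.cos (hankelIm ψ y) + γ * hankelRe L ψ y))
      rw [← Real.exp_eq_exp_ℝ, ← Real.exp_add] at h
      convert! h using 1
      · ext n
        have e : Real.exp (Real.exp (hankelRe L ψ y) * Real.cos (hankelIm ψ y) +
            γ * (n + 1) * hankelRe L ψ y) = Real.exp (Real.exp (hankelRe L ψ y) *
            Real.cos (hankelIm ψ y) + γ * hankelRe L ψ y) * Real.exp (γ * hankelRe L ψ y) ^ n := by
          rw [← Real.exp_nat_mul, ← Real.exp_add]; ring_nf
        rw [mul_pow, e]; ring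
      · congr 1; ring
  refine hasSum_integral_of_dominated_convergence (fun n y => (z ^ n / n.factorial) *
    Real.exp (Real.exp (hankelRe L ψ y) * Real.cos (hankelIm ψ y) + γ * (n + 1) * hankelRe L ψ y))
    (fun n => ?_) (fun n => ?_) ?_ ?_ ?_
  · exact ((integrable_hankelFun hψ hψ' _ L).const_mul _).aestronglyMeasurable
  · refine Eventually.of_forall fun y => ?_
    rw [norm_mul, norm_mul, norm_hankelDir, mul_one, hankelPath, norm_hankelFun, norm_div, norm_pow,
      norm_neg]
    simp [abs_of_nonneg hz]
  · exact Eventually.of_forall fun y => (hs y).summable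
  · simp only [fun y => (hs y).tsum_eq]
    have hm : Continuous fun y => Real.exp (Real.exp (hankelRe L ψ y) *
          Real.cos (hankelIm ψ y) + z * Real.exp (γ * hankelRe L ψ y) + γ * hankelRe L ψ y) := by
      have := continuous_hankelRe (L := L) (ψ := ψ)
      have := continuous_hankelIm (ψ := ψ)
      fun_prop
    obtain ⟨K, hK, h⟩ := exists_hankel_bound h0 h1 hψ hψ' hz γ L
    refine (integrable_exp_neg_abs.const_mul K).mono' hm.aestronglyMeasurable
      (Eventually.of_forall fun y => ?_)
    rw [Real.norm_of_nonneg (Real.exp_pos _).le]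
    exact h y
  · refine Eventually.of_forall fun y => ?_
    have h := (NormedSpace.expSeries_div_hasSum_exp
      (-(z * Complex.exp (γ * hankelPath L ψ y)))).mul_right
      (hankelFun γ (hankelPath L ψ y) * hankelDir ψ y)
    rw [← Complex.exp_eq_exp_ℂ] at h
    convert! h using 1
    ext n
    have e : hankelFun (γ * (n + 1)) (hankelPath L ψ y) =
        Complex.exp (γ * hankelPath L ψ y) ^ n * hankelFun γ (hankelPath L ψ y) := by
      rw [hankelFun, hankelFun, ← Complex.exp_nat_mul, ← Complex.exp_add]
      push_cast; ring_nf
    rw [e, ← neg_mul, mul_pow]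
    ring

/-- The Wright function as a contour integral. -/
lemma wright_eq_integral (h0 : 0 < γ) (h1 : γ < 1) (hψ : Real.pi / 2 < ψ) (hψ' : ψ < Real.pi)
    (L : ℝ) {z : ℝ} (hz : 0 ≤ z) :
    (wright γ z : ℂ) = (2 * Real.pi * I)⁻¹ *
      ∫ y, wrightExp γ z (hankelPath L ψ y) * (hankelFun γ (hankelPath L ψ y) * hankelDir ψ y) := by
  rw [wright, Complex.ofReal_tsum]
  exact (hasSum_wright h0 h1 hψ hψ' L hz).tsum_eq

/-- The Wright function decays faster than any exponential. -/
theorem exists_abs_wright_le (h0 : 0 < γ) (h1 : γ < 1) (c : ℝ) :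
    ∃ D, 0 ≤ D ∧ ∀ z, 0 ≤ z → |wright γ z| ≤ D * Real.exp (-(c * z)) := by
  obtain ⟨ψ, hψ, hψ', hγψ⟩ := exists_hankel_angle h0 h1
  have hpi := Real.pi_pos
  have hcos : 0 < Real.cos (γ * ψ) := Real.cos_pos_of_mem_Ioo ⟨by nlinarith, hγψ⟩
  -- Any rate c is reached by shifting the contour far enough to the right; e^v ≥ v for v = c /
  -- cos(γψ) gives an explicit L.
  obtain ⟨L, hL⟩ : ∃ L : ℝ, c ≤ Real.exp (γ * L) * Real.cos (γ * ψ) := by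
    refine ⟨(c / Real.cos (γ * ψ)) / γ, ?_⟩
    rw [mul_div_cancel₀ _ h0.ne', ← div_le_iff₀ hcos]
    linarith [Real.add_one_le_exp (c / Real.cos (γ * ψ))]
  set H : ℝ → ℂ := fun y => hankelFun γ (hankelPath L ψ y) * hankelDir ψ y with hH
  have iH : Integrable H := integrable_hankelFun hψ hψ' γ L
  refine ⟨‖(2 * Real.pi * I : ℂ)⁻¹‖ * ∫ y, ‖H y‖,
    mul_nonneg (norm_nonneg _) (integral_nonneg fun _ => norm_nonneg _), fun z hz => ?_⟩
  have hb : ∀ y, ‖wrightExp γ z (hankelPath L ψ y) * H y‖ ≤ Real.exp (-(c * z)) * ‖H y‖ :=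
    fun y => by
      rw [norm_mul]
      refine mul_le_mul_of_nonneg_right ?_ (norm_nonneg (H y))
      refine (norm_wrightExp_hankelPath_le h0 (by linarith) hγψ hz y).trans (Real.exp_le_exp.2 ?_)
      nlinarith
  have hi := norm_integral_le_of_norm_le (iH.norm.const_mul (Real.exp (-(c * z))))
    (Eventually.of_forall hb)
  rw [integral_const_mul] at hi
  rw [← Real.norm_eq_abs, ← Complex.norm_real, wright_eq_integral h0 h1 hψ hψ' L hz, norm_mul]
  rw [mul_assoc (‖(2 * Real.pi * I : ℂ)⁻¹‖), mul_comm (∫ y, ‖H y‖)]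
  exact mul_le_mul_of_nonneg_left hi (norm_nonneg ((2 * Real.pi * I : ℂ)⁻¹))

lemma continuousOn_wright (h0 : 0 < γ) (h1 : γ < 1) : ContinuousOn (wright γ) (Ici 0) := by
  obtain ⟨ψ, hψ, hψ', hγψ⟩ := exists_hankel_angle h0 h1
  have hpi := Real.pi_pos
  have h : ContinuousOn (fun z => ∫ y, wrightExp γ z (hankelPath 0 ψ y) *
      (hankelFun γ (hankelPath 0 ψ y) * hankelDir ψ y)) (Ici 0) := by
    refine continuousOn_of_dominated
      (bound := fun y => ‖hankelFun γ (hankelPath 0 ψ y) * hankelDir ψ y‖) (fun z _ => ?_)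
      (fun z hz => Eventually.of_forall fun y => ?_)
      (integrable_hankelFun hψ hψ' γ 0).norm (Eventually.of_forall fun y => ?_)
    · exact (Continuous.aestronglyMeasurable (by unfold wrightExp; fun_prop)).mul
        (integrable_hankelFun hψ hψ' γ 0).aestronglyMeasurable
    · rw [norm_mul]
      refine mul_le_of_le_one_left (norm_nonneg _) ?_
      refine (norm_wrightExp_hankelPath_le h0 (by linarith) hγψ hz y).trans ?_
      rw [Real.exp_le_one_iff]
      have : 0 ≤ Real.cos (γ * ψ) := Real.cos_nonneg_of_neg_pi_div_two_le_of_le (by nlinarith) hγψ.le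
      have := mul_nonneg hz (mul_nonneg (Real.exp_pos (γ * 0)).le this)
      linarith
    · unfold wrightExp; fun_prop
  have h2 := Complex.continuous_re.comp_continuousOn (h.const_smul ((2 * Real.pi * I : ℂ)⁻¹))
  refine h2.congr fun z hz => ?_
  simp only [Function.comp_apply, Pi.smul_apply, smul_eq_mul]
  rw [← wright_eq_integral h0 h1 hψ hψ' 0 hz, Complex.ofReal_re]

lemma integrableOn_pow_mul_exp {w : ℂ} (hw : 0 < w.re) (k : ℕ) :
    IntegrableOn (fun z : ℝ => (z : ℂ) ^ k * Complex.exp (-(z * w))) (Ioi 0) := by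
  have h := integrableOn_rpow_mul_exp_neg_mul_rpow (p := 1) (s := k) (b := w.re)
    (by linarith [(Nat.cast_nonneg k : (0 : ℝ) ≤ k)]) one_pos hw
  refine h.mono' (Continuous.aestronglyMeasurable (by fun_prop)) ?_
  filter_upwards [self_mem_ae_restrict measurableSet_Ioi] with z hz
  rw [norm_mul, norm_pow, Complex.norm_exp]
  simp [abs_of_pos (mem_Ioi.1 hz), mul_comm]

lemma tendsto_pow_mul_exp {w : ℂ} (hw : 0 < w.re) (k : ℕ) :
    Tendsto (fun z : ℝ => (z : ℂ) ^ k * Complex.exp (-(z * w))) atTop (𝓝 0) := by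
  rw [tendsto_zero_iff_norm_tendsto_zero]
  refine (tendsto_rpow_mul_exp_neg_mul_atTop_nhds_zero k w.re hw).congr' ?_
  filter_upwards [eventually_ge_atTop 0] with z hz
  rw [norm_mul, norm_pow, Complex.norm_exp]
  simp [abs_of_nonneg hz, mul_comm]

lemma integral_pow_mul_exp {w : ℂ} (hw : 0 < w.re) (k : ℕ) :
    ∫ z in Ioi (0 : ℝ), (z : ℂ) ^ k * Complex.exp (-(z * w)) = k.factorial / w ^ (k + 1) := by
  have hw0 : w ≠ 0 := fun h => by simp [h] at hw
  have hexp : ∀ z : ℝ, HasDerivAt (fun z : ℝ => Complex.exp (-(z * w)))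
      (-w * Complex.exp (-(z * w))) z := fun z => by
    have := (((Complex.ofRealCLM.hasDerivAt (x := z)).mul_const w).neg).cexp
    simpa [mul_comm] using this
  induction k with
  | zero =>
    have := integral_Ioi_of_hasDerivAt_of_tendsto' (a := 0) (fun z _ => hexp z)
      (IntegrableOn.congr_fun ((integrableOn_pow_mul_exp hw 0).const_mul (-w))
        (fun z _ => by simp) measurableSet_Ioi) (by simpa using tendsto_pow_mul_exp hw 0)
    rw [integral_const_mul] at this
    simp only [pow_zero, one_mul, Nat.factorial_zero, Nat.cast_one, zero_add, pow_one]
    rw [eq_div_iff hw0]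
    simp at this
    linear_combination this
  | succ k ih =>
    have i1 := (integrableOn_pow_mul_exp hw k).const_mul (k + 1 : ℂ)
    have i2 := (integrableOn_pow_mul_exp hw (k + 1)).const_mul w
    have := integral_Ioi_of_hasDerivAt_of_tendsto' (a := 0)
      (f := fun z : ℝ => (z : ℂ) ^ (k + 1) * Complex.exp (-(z * w)))
      (f' := fun z : ℝ => (k + 1 : ℂ) * ((z : ℂ) ^ k * Complex.exp (-(z * w))) -
        w * ((z : ℂ) ^ (k + 1) * Complex.exp (-(z * w))))
      (fun z _ => by
        have h1 : HasDerivAt (fun z : ℝ => (z : ℂ) ^ (k + 1)) ((k + 1 : ℂ) * (z : ℂ) ^ k) z := by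
          have := (Complex.ofRealCLM.hasDerivAt (x := z)).fun_pow (k + 1)
          simpa using this
        convert! h1.mul (hexp z) using 1
        ring) (i1.sub i2) (tendsto_pow_mul_exp hw (k + 1))
    rw [integral_sub i1 i2, integral_const_mul, integral_const_mul, ih] at this
    simp only [Complex.ofReal_zero, zero_pow (Nat.succ_ne_zero k), zero_mul, sub_zero] at this
    rw [sub_eq_zero] at this
    apply mul_left_cancel₀ hw0
    rw [← this, Nat.factorial_succ]
    push_cast
    field_simp
    ring

/-- Decay at rate c + 1 beats growth at rate c and leaves e^(-z). -/
lemma integrableOn_wright_of_le (h0 : 0 < γ) (h1 : γ < 1) {E : Type*} [NormedAddCommGroup E]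
    [NormedSpace ℝ E] {f : ℝ → E} (hf : ContinuousOn f (Ioi 0)) {K c : ℝ}
    (hb : ∀ z, 0 < z → ‖f z‖ ≤ K * Real.exp (c * z)) :
    IntegrableOn (fun z => wright γ z • f z) (Ioi 0) := by
  obtain ⟨D, hD, h⟩ := exists_abs_wright_le h0 h1 (c + 1)
  have i1 := (integrableOn_exp_neg_Ioi 0).const_mul (D * K)
  refine i1.mono' ?_ ?_
  · exact ContinuousOn.aestronglyMeasurable
      (((continuousOn_wright h0 h1).mono Ioi_subset_Ici_self).smul hf) measurableSet_Ioi
  · filter_upwards [self_mem_ae_restrict measurableSet_Ioi] with z hz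
    rw [norm_smul, Real.norm_eq_abs]
    calc _ ≤ (D * Real.exp (-((c + 1) * z))) * (K * Real.exp (c * z)) :=
          mul_le_mul (h z (le_of_lt hz)) (hb z hz) (norm_nonneg _)
            (mul_nonneg hD (Real.exp_pos _).le)
      _ = D * K * (Real.exp (-((c + 1) * z)) * Real.exp (c * z)) := by ring
      _ = _ := by rw [← Real.exp_add]; congr 2; ring

/-- The moments of the Wright function. -/
theorem integral_wright_mul_pow (h0 : 0 < γ) (h1 : γ < 1) (k : ℕ) :
    ∫ z in Ioi (0 : ℝ), wright γ z * z ^ k = k.factorial / Real.Gamma (γ * k + 1) := by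
  obtain ⟨ψ, hψ, hψ', hγψ⟩ := exists_hankel_angle h0 h1
  have hpi := Real.pi_pos
  have hcos : 0 < Real.cos (γ * ψ) := Real.cos_pos_of_mem_Ioo ⟨by nlinarith, hγψ⟩
  set c := Real.exp (γ * 0) * Real.cos (γ * ψ) with hc
  have hc0 : 0 < c := mul_pos (Real.exp_pos _) hcos
  set P := hankelPath 0 ψ with hP
  set G : ℝ → ℂ := fun y => hankelFun γ (P y) * hankelDir ψ y with hG
  have iG : Integrable G := integrable_hankelFun hψ hψ' γ 0
  have hre : ∀ y, 0 < (Complex.exp (γ * P y)).re := fun y => by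
    rw [Complex.exp_re]
    simp only [Complex.mul_re, Complex.ofReal_re, Complex.ofReal_im, Complex.mul_im, zero_mul,
      sub_zero, add_zero, hP, hankelPath_im]
    refine mul_pos (Real.exp_pos _) ?_
    have := abs_hankelIm_le (ψ := ψ) (y := y) (by linarith)
    have : |γ * hankelIm ψ y| < Real.pi / 2 := by
      rw [abs_mul, abs_of_pos h0]
      exact (mul_le_mul_of_nonneg_left this h0.le).trans_lt hγψ
    exact Real.cos_pos_of_mem_Ioo (abs_lt.1 this)
  have e1 : ((∫ z in Ioi (0 : ℝ), wright γ z * z ^ k : ℝ) : ℂ) =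
      (2 * Real.pi * I)⁻¹ * ∫ z in Ioi (0 : ℝ), ∫ y, (z : ℂ) ^ k * wrightExp γ z (P y) * G y := by
    rw [← integral_complex_ofReal, ← integral_const_mul]
    refine setIntegral_congr_fun measurableSet_Ioi fun z hz => ?_
    push_cast
    rw [wright_eq_integral h0 h1 hψ hψ' 0 (le_of_lt hz), mul_assoc, ← integral_mul_const]
    congr 1
    refine integral_congr_ae (Eventually.of_forall fun y => ?_)
    simp only [hG, hP]; ring
  have iprod : Integrable (Function.uncurry fun (z : ℝ) (y : ℝ) =>
      (z : ℂ) ^ k * wrightExp γ z (P y) * G y) ((volume.restrict (Ioi 0)).prod volume) := by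
    have hb := (integrableOn_pow_mul_exp (w := c) (by simpa using hc0) k).norm.mul_prod iG.norm
    refine hb.mono' ?_ ?_
    · refine AEStronglyMeasurable.mul ?_ (iG.aestronglyMeasurable.comp_snd)
      refine Continuous.aestronglyMeasurable ?_
      have : Continuous P := continuous_hankelPath
      unfold wrightExp; fun_prop
    · have hm : ∀ᵐ p ∂((volume.restrict (Ioi (0 : ℝ))).prod (volume : Measure ℝ)), p.1 ∈ Ioi (0 : ℝ) :=
        Measure.quasiMeasurePreserving_fst.ae (self_mem_ae_restrict measurableSet_Ioi)
      filter_upwards [hm] with p hp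
      simp only [Function.uncurry, norm_mul]
      refine mul_le_mul_of_nonneg_right ?_ (by positivity)
      refine mul_le_mul_of_nonneg_left ?_ (by positivity)
      refine (norm_wrightExp_hankelPath_le h0 (by linarith) hγψ (le_of_lt hp) _).trans ?_
      rw [Complex.norm_exp]
      simp only [Complex.neg_re, Complex.re_mul_ofReal, Complex.ofReal_re, hc]; exact le_rfl
  have e2 := integral_integral_swap iprod
  -- With w = e^(γζ), integration in z yields k! e^(-γ(k+1)ζ). This changes the exponent of
  -- `hankelFun` from γ to -γk, for which Hankel's formula gives 1/Γ(γk+1).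
  have e3 : ∀ y, ∫ z in Ioi (0 : ℝ), (z : ℂ) ^ k * wrightExp γ z (P y) * G y =
      k.factorial * (hankelFun (-γ * k) (P y) * hankelDir ψ y) := fun y => by
    rw [integral_mul_const]
    simp only [wrightExp]
    rw [integral_pow_mul_exp (hre y) k, hG, ← Complex.exp_nat_mul, div_mul_eq_mul_div, mul_div_assoc]
    congr 1
    rw [mul_div_right_comm]
    congr 1
    rw [hankelFun, hankelFun, ← Complex.exp_sub]
    push_cast; ring_nf
  rw [← Complex.ofReal_inj, e1, e2]
  simp only [e3]
  rw [integral_const_mul, integral_hankelFun hψ hψ']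
  have hpi' : (2 * Real.pi * I : ℂ) ≠ 0 := Complex.two_pi_I_ne_zero
  rw [show 1 - -γ * (k : ℝ) = γ * k + 1 by ring]
  push_cast
  field_simp

end Wright

/-! ### Termwise integration against the Wright function -/

section Series

variable {γ : ℝ} {E : Type*} [NormedAddCommGroup E] [NormedSpace ℝ E]

lemma norm_sum_pow_smul_le {K r : ℝ} {e : ℕ → E}
    (he : ∀ j, ‖e j‖ ≤ K * r ^ j / j.factorial) {z : ℝ} (hz : 0 ≤ z) (j : ℕ) :
    ‖z ^ j • e j‖ ≤ K * ((r * z) ^ j / j.factorial) := by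
  rw [norm_smul, norm_pow, Real.norm_of_nonneg hz, mul_pow]
  calc z ^ j * ‖e j‖ ≤ z ^ j * (K * r ^ j / j.factorial) := by gcongr; exact he j
    _ = _ := by ring

lemma hasSum_exp_div (K x : ℝ) :
    HasSum (fun j : ℕ => K * (x ^ j / j.factorial)) (K * Real.exp x) := by
  have h := NormedSpace.expSeries_div_hasSum_exp x
  rw [← Real.exp_eq_exp_ℝ] at h
  exact h.mul_left K

/-- Termwise integration of a power series against the Wright function with a weight `h`. -/
lemma hasSum_integral_wright [CompleteSpace E] (h0 : 0 < γ) (h1 : γ < 1) {h : ℝ → ℝ}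
    (hh : ContinuousOn h (Ioi 0)) {H c : ℝ} (hb : ∀ z, 0 < z → |h z| ≤ H * Real.exp (c * z))
    {K r : ℝ} {e : ℕ → E} (he : ∀ j, ‖e j‖ ≤ K * r ^ j / j.factorial)
    {g : ℝ → E} (hg : ∀ z, 0 < z → HasSum (fun j => z ^ j • e j) (g z)) :
    HasSum (fun j => (∫ z in Ioi (0 : ℝ), wright γ z * (h z * z ^ j)) • e j)
      (∫ z in Ioi (0 : ℝ), (wright γ z * h z) • g z) := by
  have hK : 0 ≤ K := by simpa using (norm_nonneg _).trans (he 0)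
  have e1 : ∀ j, (∫ z in Ioi (0 : ℝ), wright γ z * (h z * z ^ j)) • e j =
      ∫ z in Ioi (0 : ℝ), (wright γ z * h z) • (z ^ j • e j) := fun j => by
    rw [← integral_smul_const]
    simp only [smul_smul, mul_assoc]
  simp only [e1]
  have hw : ContinuousOn (fun z => wright γ z * h z) (Ioi 0) :=
    ((continuousOn_wright h0 h1).mono Ioi_subset_Ici_self).mul hh
  have hs : ∀ z, HasSum (fun j : ℕ => |wright γ z * h z| * (K * ((r * z) ^ j / j.factorial)))
      (|wright γ z * h z| * (K * Real.exp (r * z))) := fun z =>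
    (hasSum_exp_div K (r * z)).mul_left _
  refine hasSum_integral_of_dominated_convergence
    (fun j z => |wright γ z * h z| * (K * ((r * z) ^ j / j.factorial))) (fun j => ?_) (fun j => ?_)
    ?_ ?_ ?_
  · exact ContinuousOn.aestronglyMeasurable (hw.smul (by fun_prop)) measurableSet_Ioi
  · filter_upwards [self_mem_ae_restrict measurableSet_Ioi] with z hz
    rw [norm_smul, Real.norm_eq_abs]
    exact mul_le_mul_of_nonneg_left (norm_sum_pow_smul_le he (le_of_lt hz) j) (abs_nonneg _)
  · exact Eventually.of_forall fun z => (hs z).summable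
  · simp only [fun z => (hs z).tsum_eq]
    have := (integrableOn_wright_of_le h0 h1 (f := fun z => h z * (K * Real.exp (r * z)))
      (K := H * K) (c := c + r) (hh.mul (by fun_prop)) fun z hz => by
        rw [norm_mul, norm_mul, Real.norm_eq_abs, Real.norm_eq_abs, Real.norm_eq_abs, Real.abs_exp,
          abs_of_nonneg hK, add_mul, Real.exp_add]
        have := mul_le_mul_of_nonneg_right (hb z hz)
          (mul_nonneg hK (Real.exp_pos (r * z)).le)
        linarith)
    refine IntegrableOn.congr_fun this.norm (fun z _ => ?_) measurableSet_Ioi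
    simp only [norm_smul, norm_mul, Real.norm_eq_abs, Real.abs_exp, abs_mul, abs_of_nonneg hK]
    ring
  · filter_upwards [self_mem_ae_restrict measurableSet_Ioi] with z hz
    exact (hg z hz).const_smul _

/-- The moments of the Wright function. -/
def wrightMoment (γ : ℝ) (k : ℕ) : ℝ := k.factorial / Real.Gamma (γ * k + 1)

lemma pow_le_factorial_mul_exp {z : ℝ} (hz : 0 ≤ z) (k : ℕ) : z ^ k ≤ k.factorial * Real.exp z := by
  have := Real.pow_div_factorial_le_exp z hz k
  rwa [div_le_iff₀ (by positivity), mul_comm] at this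

/-- Laplace transforms of `z ^ k * wright γ z` as power series. -/
lemma hasSum_wrightMoment (h0 : 0 < γ) (h1 : γ < 1) (k : ℕ) (x : ℝ) :
    HasSum (fun j : ℕ => wrightMoment γ (j + k) * (x ^ j / j.factorial))
      (∫ z in Ioi (0 : ℝ), (wright γ z * z ^ k) * Real.exp (x * z)) := by
  have := hasSum_integral_wright h0 h1 (h := fun z => z ^ k) (H := k.factorial) (c := 1)
    (by fun_prop) (fun z hz => by
      rw [abs_of_nonneg (by positivity), one_mul]; exact pow_le_factorial_mul_exp hz.le k)
    (K := 1) (r := |x|) (e := fun j => x ^ j / j.factorial) (fun j => by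
      simp)
    (g := fun z => Real.exp (x * z)) (fun z _ => by
      convert! hasSum_exp_div 1 (x * z) using 1
      · ext j; rw [smul_eq_mul]; ring
      · rw [one_mul])
  simp only [smul_eq_mul] at this
  convert! this using 1
  ext j
  rw [wrightMoment, ← integral_wright_mul_pow h0 h1]
  simp only [pow_add, mul_comm]

end Series

/-! ### Complete monotonicity of the Laplace transform -/

section CompletelyMonotone

/-- Sequences `a` with at most geometric growth for which all the functions
`x ↦ ∑ⱼ (-x)ʲ / j! * a (j + k)` are nonnegative on `[0, ∞)`. -/
def IsAlternatingNonneg (c : ℝ) (a : ℕ → ℝ) : Prop :=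
  (∀ j, |a j| ≤ c ^ j) ∧ ∀ (k : ℕ) (x : ℝ), 0 ≤ x → 0 ≤ ∑' j : ℕ, (-x) ^ j / j.factorial * a (j + k)

variable {c : ℝ} {a : ℕ → ℝ}

lemma abs_alternating_term_le (ha : ∀ j, |a j| ≤ c ^ j) {x : ℝ} (k j : ℕ) :
    |(-x) ^ j / j.factorial * a (j + k)| ≤ c ^ k * ((|x| * c) ^ j / j.factorial) := by
  rw [abs_mul, abs_div, abs_pow, abs_neg, Nat.abs_cast, mul_pow]
  calc _ ≤ |x| ^ j / j.factorial * c ^ (j + k) := by gcongr; exact ha _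
    _ = _ := by rw [pow_add]; ring

lemma summable_alternating (ha : ∀ j, |a j| ≤ c ^ j) (x : ℝ) (k : ℕ) :
    Summable fun j : ℕ => (-x) ^ j / j.factorial * a (j + k) :=
  (hasSum_exp_div (c ^ k) (|x| * c)).summable.of_norm_bounded fun j =>
    abs_alternating_term_le ha k j

/-- The functions in question are c^k e^(-cx); this is the sequence from which the approximations
are built. -/
lemma isAlternatingNonneg_pow (hc : 0 ≤ c) : IsAlternatingNonneg c fun j => c ^ j := by
  refine ⟨fun j => by rw [abs_of_nonneg (by positivity)], fun k x _ => ?_⟩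
  have h : HasSum (fun j : ℕ => (-x) ^ j / j.factorial * c ^ (j + k))
      (c ^ k * Real.exp (-x * c)) := by
    convert! hasSum_exp_div (c ^ k) (-x * c) using 1
    ext j; rw [pow_add, mul_pow]; ring
  rw [h.tsum_eq]; positivity

/-- Since (n+1)/(n+1+j) = ∫₀¹ (n+1) uⁿ uʲ du, multiplying the sequence by this factor averages the
function over the dilations x ↦ xu with a positive weight. The full factor is a convex combination
of the identity and this averaging. -/
lemma IsAlternatingNonneg.mul_factor (h : IsAlternatingNonneg c a) (hc : 0 ≤ c) {γ : ℝ}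
    (h0 : 0 ≤ γ) (h1 : γ ≤ 1) (n : ℕ) :
    IsAlternatingNonneg c fun j => (γ + (1 - γ) * ((n + 1) / (n + 1 + j))) * a j := by
  have hγ : 0 ≤ 1 - γ := by linarith
  have hfrac : ∀ j : ℕ, 0 ≤ ((n : ℝ) + 1) / (n + 1 + j) ∧ ((n : ℝ) + 1) / (n + 1 + j) ≤ 1 := fun j =>
    ⟨by positivity, by rw [div_le_one (by positivity)]; linarith [(Nat.cast_nonneg j : (0 : ℝ) ≤ j)]⟩
  refine ⟨fun j => ?_, fun k x hx => ?_⟩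
  · rw [abs_mul, abs_of_nonneg (by have := (hfrac j).1; positivity)]
    have h2 : γ + (1 - γ) * ((n + 1) / (n + 1 + j)) ≤ 1 := by
      nlinarith [(hfrac j).2]
    calc _ ≤ 1 * |a j| := by gcongr
      _ ≤ _ := by rw [one_mul]; exact h.1 j
  -- For the k-th function the weight is (n+1) u^(n+k), because the moment that occurs has index j +
  -- k.
  · have hint : HasSum (fun j : ℕ => ∫ u in (0 : ℝ)..1, (n + 1) * u ^ (n + k) *
        ((-(x * u)) ^ j / j.factorial * a (j + k)))
        (∫ u in (0 : ℝ)..1, (n + 1) * u ^ (n + k) *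
          ∑' j : ℕ, (-(x * u)) ^ j / j.factorial * a (j + k)) := by
      refine intervalIntegral.hasSum_integral_of_dominated_convergence
        (fun j _ => (n + 1) * (c ^ k * ((x * c) ^ j / j.factorial)))
        (fun j => Continuous.aestronglyMeasurable (by fun_prop))
        (fun j => Eventually.of_forall fun u hu => ?_)
        (Eventually.of_forall fun u _ => (hasSum_exp_div (c ^ k) (x * c)).summable.mul_left _)
        (by simp) (Eventually.of_forall fun u _ => ?_)
      · rw [uIoc_of_le zero_le_one] at hu
        rw [norm_mul, Real.norm_of_nonneg (by have := hu.1; positivity), Real.norm_eq_abs]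
        have h2 := abs_alternating_term_le h.1 (x := x * u) k j
        rw [abs_of_nonneg (mul_nonneg hx hu.1.le)] at h2
        have h3 : c ^ k * ((x * u * c) ^ j / j.factorial) ≤ c ^ k * ((x * c) ^ j / j.factorial) := by
          have : 0 ≤ x * u * c := mul_nonneg (mul_nonneg hx hu.1.le) hc
          have : x * u * c ≤ x * c := by nlinarith [hu.2, mul_nonneg hx hc]
          gcongr
        have h4 : u ^ (n + k) ≤ 1 := pow_le_one₀ hu.1.le hu.2
        have h5 : ((n : ℝ) + 1) * u ^ (n + k) ≤ n + 1 := by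
          have : (0 : ℝ) ≤ n + 1 := by positivity
          nlinarith
        exact mul_le_mul h5 (h2.trans h3) (abs_nonneg _) (by positivity)
      · exact (summable_alternating h.1 _ k).hasSum.mul_left _
    have hterm : ∀ j : ℕ, ∫ u in (0 : ℝ)..1, (n + 1) * u ^ (n + k) *
        ((-(x * u)) ^ j / j.factorial * a (j + k)) =
        (-x) ^ j / j.factorial * ((n + 1) / (n + 1 + (j + k : ℕ)) * a (j + k)) := fun j => by
      have : ∀ u : ℝ, (n + 1) * u ^ (n + k) * ((-(x * u)) ^ j / j.factorial * a (j + k)) =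
          ((n + 1) * ((-x) ^ j / j.factorial * a (j + k))) * u ^ (n + k + j) := fun u => by
        rw [← neg_mul, mul_pow, pow_add u (n + k) j]; ring
      simp only [this]
      rw [intervalIntegral.integral_const_mul, integral_pow]
      push_cast
      rw [one_pow, zero_pow (by omega)]
      have : (n : ℝ) + k + j + 1 = n + 1 + (j + k) := by ring
      rw [this]; ring
    simp only [hterm] at hint
    have hsum := ((summable_alternating h.1 x k).hasSum.mul_left γ).add (hint.mul_left (1 - γ))
    have hpos : 0 ≤ ∫ u in (0 : ℝ)..1, (n + 1) * u ^ (n + k) *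
          ∑' j : ℕ, (-(x * u)) ^ j / j.factorial * a (j + k) := by
      refine intervalIntegral.integral_nonneg zero_le_one fun u hu => ?_
      have := hu.1
      exact mul_nonneg (by positivity) (h.2 k (x * u) (mul_nonneg hx hu.1))
    have e : (fun j : ℕ => (-x) ^ j / j.factorial *
        ((γ + (1 - γ) * ((n + 1) / (n + 1 + (j + k : ℕ)))) * a (j + k))) =
        fun j : ℕ => γ * ((-x) ^ j / j.factorial * a (j + k)) +
        (1 - γ) * ((-x) ^ j / j.factorial * ((n + 1) / (n + 1 + (j + k : ℕ)) * a (j + k))) := by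
      ext j; ring
    rw [e, hsum.tsum_eq]
    have := h.2 k x hx
    positivity

variable {γ : ℝ}

/-- Euler-type approximations to the moments of the Wright function. -/
def wrightMomentSeq (γ : ℝ) (N k : ℕ) : ℝ :=
  ((N : ℝ) ^ (1 - γ)) ^ k * ∏ j ∈ Finset.range (N + 1), (γ + (1 - γ) * ((j + 1) / (j + 1 + k)))

lemma isAlternatingNonneg_wrightMomentSeq (h0 : 0 < γ) (h1 : γ < 1) (N : ℕ) :
    IsAlternatingNonneg ((N : ℝ) ^ (1 - γ)) (wrightMomentSeq γ N) := by
  have hc : 0 ≤ (N : ℝ) ^ (1 - γ) := by positivity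
  unfold wrightMomentSeq
  generalize N + 1 = m
  induction m with
  | zero => simpa using isAlternatingNonneg_pow hc
  | succ m ih =>
    convert! ih.mul_factor hc h0.le h1.le m using 1
    ext k
    rw [Finset.prod_range_succ]; ring

/-- Each convex combination simplifies to (γk+1+j)/(k+1+j), so the product is a quotient of the
products in Euler's limit for Γ. -/
lemma wrightMomentSeq_eq (N k : ℕ) : wrightMomentSeq γ N k =
    ((N : ℝ) ^ (1 - γ)) ^ k * ((∏ j ∈ Finset.range (N + 1), (γ * k + 1 + j)) /
      ∏ j ∈ Finset.range (N + 1), ((k : ℝ) + 1 + j)) := by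
  rw [wrightMomentSeq, ← Finset.prod_div_distrib]
  congr 1
  refine Finset.prod_congr rfl fun j _ => ?_
  have : (j : ℝ) + 1 + k ≠ 0 := by positivity
  have : (k : ℝ) + 1 + j ≠ 0 := by positivity
  field_simp
  ring

/-- The sequence is `GammaSeq (k+1)` divided by `GammaSeq (γk+1)`; the power N^((1-γ)k) is what
remains of their powers of N. -/
lemma tendsto_wrightMomentSeq (h0 : 0 < γ) (k : ℕ) :
    Tendsto (fun N => wrightMomentSeq γ N k) atTop (𝓝 (wrightMoment γ k)) := by
  have hk : 0 < γ * k + 1 := by positivity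
  have t := (Real.GammaSeq_tendsto_Gamma (k + 1)).div (Real.GammaSeq_tendsto_Gamma (γ * k + 1))
    (Real.Gamma_pos_of_pos hk).ne'
  rw [Real.Gamma_nat_eq_factorial] at t
  refine t.congr' ?_
  filter_upwards [eventually_gt_atTop 0] with N hN
  have hN' : (0 : ℝ) < N := by exact_mod_cast hN
  rw [wrightMomentSeq_eq, ← Real.rpow_natCast, ← Real.rpow_mul hN'.le]
  simp only [Pi.div_apply, Real.GammaSeq]
  have e : (N : ℝ) ^ ((k : ℝ) + 1) = (N : ℝ) ^ ((1 - γ) * k) * (N : ℝ) ^ (γ * k + 1) := by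
    rw [← Real.rpow_add hN']; ring_nf
  have p1 : (∏ j ∈ Finset.range (N + 1), (γ * k + 1 + (j : ℝ))) ≠ 0 :=
    (Finset.prod_pos fun j _ => by positivity).ne'
  have p2 : (∏ j ∈ Finset.range (N + 1), ((k : ℝ) + 1 + (j : ℝ))) ≠ 0 :=
    (Finset.prod_pos fun j _ => by positivity).ne'
  have p3 : (N : ℝ) ^ (γ * k + 1) ≠ 0 := by positivity
  rw [e]
  field_simp

lemma Gamma_add_nat_eq_mul_prod {s : ℝ} (hs : 0 < s) (n : ℕ) :
    Real.Gamma (s + n) = Real.Gamma s * ∏ j ∈ Finset.range n, (s + j) := by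
  induction n with
  | zero => simp
  | succ n ih =>
    rw [Finset.prod_range_succ, ← mul_assoc, ← ih, Nat.cast_succ, ← add_assoc,
      Real.Gamma_add_one (by positivity), mul_comm]

/-- Log-convexity of Γ between N+2 and N+2+k bounds Γ at γk+N+2, and (N+1)! N^k ≤ (N+1+k)! absorbs
the power of N. The inequality supplies the majorant for the passage to the limit under the sum. -/
lemma wrightMomentSeq_le (h0 : 0 < γ) (h1 : γ < 1) (N k : ℕ) :
    wrightMomentSeq γ N k ≤ wrightMoment γ k := by
  have hk : 0 < γ * k + 1 := by positivity
  have g1 := Gamma_add_nat_eq_mul_prod hk (N + 1)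
  have g2 := Gamma_add_nat_eq_mul_prod (s := (k : ℝ) + 1) (by positivity) (N + 1)
  have g3 := Real.Gamma_pos_of_pos hk
  have g4 := Real.Gamma_mul_add_mul_le_rpow_Gamma_mul_rpow_Gamma
    (s := (k : ℝ) + 1 + (N + 1 : ℕ)) (t := ((N + 1 : ℕ) : ℝ) + 1) (a := γ) (b := 1 - γ)
    (by positivity) (by positivity) h0 (by linarith) (by ring)
  have e4 : γ * ((k : ℝ) + 1 + (N + 1 : ℕ)) + (1 - γ) * (((N + 1 : ℕ) : ℝ) + 1) =
    γ * k + 1 + (N + 1 : ℕ) := by push_cast; ring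
  rw [e4] at g4
  have e5 : (k : ℝ) + 1 + (N + 1 : ℕ) = ((N + 1 + k : ℕ) : ℝ) + 1 := by push_cast; ring
  rw [e5] at g2 g4
  rw [Real.Gamma_nat_eq_factorial] at g2 g4
  rw [Real.Gamma_nat_eq_factorial] at g2 g4
  have g5 : ((N + 1).factorial : ℝ) * (N : ℝ) ^ k ≤ (N + 1 + k).factorial := by
    have : ((N + 1).factorial * (N + 1 + 1) ^ k : ℕ) ≤ (N + 1 + k).factorial :=
      Nat.factorial_mul_pow_le_factorial
    have h2 : ((N + 1).factorial : ℝ) * ((N : ℝ) + 1 + 1) ^ k ≤ (N + 1 + k).factorial := by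
      exact_mod_cast this
    refine le_trans ?_ h2
    gcongr
    linarith
  set F : ℝ := (Nat.factorial (N + 1 + k) : ℝ) with hF
  set F' : ℝ := (Nat.factorial (N + 1) : ℝ) with hF'
  have hFpos : 0 < F := by simp only [hF]; positivity
  have hF'pos : 0 < F' := by simp only [hF']; positivity
  set P := ∏ j ∈ Finset.range (N + 1), (γ * k + 1 + (j : ℝ)) with hP
  set Q := ∏ j ∈ Finset.range (N + 1), ((k : ℝ) + 1 + (j : ℝ)) with hQ
  have hQpos : 0 < Q := Finset.prod_pos fun j _ => by positivity
  have hN : ((N : ℝ) ^ (1 - γ)) ^ k = ((N : ℝ) ^ k) ^ (1 - γ) := by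
    rw [← Real.rpow_natCast, ← Real.rpow_mul (Nat.cast_nonneg _), ← Real.rpow_natCast,
      ← Real.rpow_mul (Nat.cast_nonneg _), mul_comm]
  rw [wrightMomentSeq_eq, wrightMoment, hN, le_div_iff₀ g3]
  calc ((N : ℝ) ^ k) ^ (1 - γ) * (P / Q) * Real.Gamma (γ * k + 1)
      = ((N : ℝ) ^ k) ^ (1 - γ) * (Real.Gamma (γ * k + 1) * P) / Q := by ring
    _ ≤ ((N : ℝ) ^ k) ^ (1 - γ) * (F ^ γ * F' ^ (1 - γ)) / Q := by
        rw [← g1]; gcongr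
    _ = F ^ γ * (F' * (N : ℝ) ^ k) ^ (1 - γ) / Q := by
        rw [Real.mul_rpow hF'pos.le (by positivity)]; ring
    _ ≤ F ^ γ * F ^ (1 - γ) / Q := by
        have : 0 ≤ 1 - γ := by linarith
        gcongr
    _ = k.factorial := by
        rw [← Real.rpow_add hFpos, show γ + (1 - γ) = 1 by ring, Real.rpow_one, g2]
        field_simp

/-- All the derivatives of the Laplace transform of the Wright function alternate in sign. -/
theorem integral_wright_mul_pow_mul_exp_nonneg (h0 : 0 < γ) (h1 : γ < 1) (k : ℕ) {x : ℝ}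
    (hx : 0 ≤ x) : 0 ≤ ∫ z in Ioi (0 : ℝ), (wright γ z * z ^ k) * Real.exp (-x * z) := by
  rw [← (hasSum_wrightMoment h0 h1 k (-x)).tsum_eq]
  have hs := (hasSum_wrightMoment h0 h1 k x).summable
  have t : Tendsto (fun N => ∑' j : ℕ, (-x) ^ j / j.factorial * wrightMomentSeq γ N (j + k)) atTop
      (𝓝 (∑' j : ℕ, wrightMoment γ (j + k) * ((-x) ^ j / j.factorial))) := by
    -- The majorant is the moment series at +x, which converges.
    refine tendsto_tsum_of_dominated_convergence hs (fun j => ?_)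
      (Eventually.of_forall fun N j => ?_)
    · rw [mul_comm]
      exact (tendsto_wrightMomentSeq h0 (j + k)).const_mul _
    · have hn : 0 ≤ wrightMomentSeq γ N (j + k) := by
        have : 0 ≤ 1 - γ := by linarith
        exact mul_nonneg (by positivity) (Finset.prod_nonneg fun i _ => by positivity)
      rw [norm_mul, norm_div, norm_pow, norm_neg, Real.norm_of_nonneg hx, Real.norm_of_nonneg hn,
        Real.norm_natCast, mul_comm]
      gcongr
      exact wrightMomentSeq_le h0 h1 N _
  exact ge_of_tendsto' t fun N => (isAlternatingNonneg_wrightMomentSeq h0 h1 N).2 k x hx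

end CompletelyMonotone

/-! ### Growth of the Mittag-Leffler function -/

section MittagLeffler

variable {γ : ℝ}

/-- With θ the fractional part of s, the point m + 2 is the θ-combination of s + 1 and s + 2, so
log-convexity bounds 1/Γ(s+1) by factorials. Then v^θ ≤ 1 + v with v = y/(m+1) leaves two
neighbouring terms of the exponential series. -/
lemma rpow_div_Gamma_le {y s : ℝ} (hy : 0 ≤ y) (hs : 0 ≤ s) :
    y ^ s / Real.Gamma (s + 1) ≤ 2 * (y ^ ⌊s⌋₊ / (⌊s⌋₊).factorial +
      y ^ (⌊s⌋₊ + 1) / (⌊s⌋₊ + 1).factorial) := by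
  set m := ⌊s⌋₊ with hm
  set θ := s - m with hθ
  have hθ0 : 0 ≤ θ := sub_nonneg.2 (Nat.floor_le hs)
  have hθ1 : θ < 1 := by have := Nat.lt_floor_add_one s; simp only [hθ]; linarith
  have hG := Real.Gamma_pos_of_pos (show 0 < s + 1 by linarith)
  have key : ((m + 1).factorial : ℝ) ≤ Real.Gamma (s + 1) * (s + 1) ^ (1 - θ) := by
    rcases hθ0.eq_or_lt with h | h
    · have : s = m := by linarith
      rw [← h, sub_zero, Real.rpow_one, this, Real.Gamma_nat_eq_factorial, Nat.factorial_succ]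
      push_cast; linarith [mul_comm ((m : ℝ) + 1) m.factorial]
    · have g := Real.Gamma_mul_add_mul_le_rpow_Gamma_mul_rpow_Gamma
        (s := s + 1) (t := s + 1 + 1) (a := θ) (b := 1 - θ) (by linarith) (by linarith) h
        (by linarith) (by ring)
      rw [Real.Gamma_add_one (s := s + 1) (by linarith), Real.mul_rpow (by linarith) hG.le,
        show θ * (s + 1) + (1 - θ) * (s + 1 + 1) = ((m + 1 : ℕ) : ℝ) + 1 by
          simp only [hθ]; push_cast; ring, Real.Gamma_nat_eq_factorial] at g
      have e : Real.Gamma (s + 1) ^ θ * Real.Gamma (s + 1) ^ (1 - θ) = Real.Gamma (s + 1) := by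
        rw [← Real.rpow_add hG]; simp
      calc _ ≤ _ := g
        _ = (Real.Gamma (s + 1) ^ θ * Real.Gamma (s + 1) ^ (1 - θ)) * (s + 1) ^ (1 - θ) := by ring
        _ = _ := by rw [e]
  have hm1 : (0 : ℝ) < m + 1 := by positivity
  have h2 : (s + 1) ^ (1 - θ) ≤ 2 * ((m : ℝ) + 1) ^ (1 - θ) := by
    have h3 : s + 1 ≤ 2 * ((m : ℝ) + 1) := by
      have : s < m + 1 := Nat.lt_floor_add_one s
      linarith [(Nat.cast_nonneg m : (0 : ℝ) ≤ m)]
    calc (s + 1) ^ (1 - θ) ≤ (2 * ((m : ℝ) + 1)) ^ (1 - θ) := by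
          apply Real.rpow_le_rpow (by linarith) h3 (by linarith)
      _ = 2 ^ (1 - θ) * ((m : ℝ) + 1) ^ (1 - θ) := Real.mul_rpow (by norm_num) hm1.le
      _ ≤ 2 ^ (1 : ℝ) * ((m : ℝ) + 1) ^ (1 - θ) := by
          gcongr
          · norm_num
          · linarith
      _ = _ := by rw [Real.rpow_one]
  have hv : (y / (m + 1)) ^ θ ≤ 1 + y / (m + 1) := by
    have hv0 : 0 ≤ y / ((m : ℝ) + 1) := by positivity
    rcases le_total (y / ((m : ℝ) + 1)) 1 with h | h
    · linarith [Real.rpow_le_one hv0 h hθ0]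
    · have := Real.rpow_le_rpow_of_exponent_le h hθ1.le
      rw [Real.rpow_one] at this
      linarith
  have hf : (0 : ℝ) < m.factorial := by positivity
  have hinv : 1 / Real.Gamma (s + 1) ≤ 2 * ((m : ℝ) + 1) ^ (1 - θ) / (m + 1).factorial := by
    rw [div_le_div_iff₀ hG (by positivity)]
    nlinarith
  have hys : y ^ s = y ^ m * y ^ θ := by
    rw [← Real.rpow_natCast, ← Real.rpow_add_of_nonneg hy (Nat.cast_nonneg _) hθ0]
    congr 1; simp only [hθ]; ring
  have hpow : ((m : ℝ) + 1) ^ (1 - θ) = (m + 1) / ((m : ℝ) + 1) ^ θ := by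
    rw [Real.rpow_sub hm1, Real.rpow_one]
  rw [Real.div_rpow hy hm1.le] at hv
  have hpp : 0 < ((m : ℝ) + 1) ^ θ := by positivity
  calc y ^ s / Real.Gamma (s + 1) = y ^ m * y ^ θ * (1 / Real.Gamma (s + 1)) := by rw [hys]; ring
    _ ≤ y ^ m * y ^ θ * (2 * ((m : ℝ) + 1) ^ (1 - θ) / (m + 1).factorial) := by gcongr
    _ = 2 * (y ^ m / m.factorial) * (y ^ θ / ((m : ℝ) + 1) ^ θ) := by
        rw [hpow, Nat.factorial_succ]; push_cast; field_simp
    _ ≤ 2 * (y ^ m / m.factorial) * (1 + y / (m + 1)) := by gcongr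
    _ = _ := by rw [Nat.factorial_succ, pow_succ]; push_cast; field_simp

/-- The indices counted lie in a half-open interval of length 1/γ starting at m/γ. -/
lemma card_filter_floor_le (h0 : 0 < γ) (s : Finset ℕ) (m : ℕ) :
    (s.filter fun k : ℕ => ⌊γ * k⌋₊ = m).card ≤ ⌈1 / γ⌉₊ := by
  have hsub : (s.filter fun k : ℕ => ⌊γ * k⌋₊ = m) ⊆
      Finset.Ico ⌈m / γ⌉₊ (⌈m / γ⌉₊ + ⌈1 / γ⌉₊) := fun k hk => by
    rw [Finset.mem_filter] at hk
    have h1 := Nat.floor_le (show 0 ≤ γ * (k : ℝ) by positivity)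
    have h2 := Nat.lt_floor_add_one (γ * (k : ℝ))
    rw [hk.2] at h1 h2
    rw [Finset.mem_Ico]
    constructor
    · rw [Nat.ceil_le, div_le_iff₀ h0]; linarith
    · have h3 : (k : ℝ) < m / γ + 1 / γ := by
        rw [← add_div, lt_div_iff₀ h0]; linarith
      have h4 := Nat.le_ceil ((m : ℝ) / γ)
      have h5 := Nat.le_ceil (1 / γ)
      have : (k : ℝ) < (⌈(m : ℝ) / γ⌉₊ + ⌈1 / γ⌉₊ : ℕ) := by push_cast; linarith
      exact_mod_cast this
  refine (Finset.card_le_card hsub).trans ?_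
  simp

/-- The Laplace transform of the Wright function is the Mittag-Leffler function, which grows at
most as fast as `y ↦ exp (y ^ (1 / γ))`. -/
theorem exists_integral_wright_mul_exp_le (h0 : 0 < γ) (h1 : γ < 1) :
    ∃ C, 0 < C ∧ ∀ y, 0 ≤ y →
      ∫ z in Ioi (0 : ℝ), wright γ z * Real.exp (y ^ γ * z) ≤ C * Real.exp y := by
  -- Each m is the floor of γk for at most ⌈1/γ⌉ values of k; the 4 is the factor 2 of
  -- `rpow_div_Gamma_le` times its two neighbouring terms.
  refine ⟨⌈1 / γ⌉₊ * 4, by positivity, fun y hy => ?_⟩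
  have hs := hasSum_wrightMoment h0 h1 0 (y ^ γ)
  simp only [pow_zero, mul_one, add_zero] at hs
  set f : ℕ → ℝ := fun m => 2 * (y ^ m / m.factorial + y ^ (m + 1) / (m + 1).factorial) with hf
  have hf0 : ∀ m, 0 ≤ f m := fun m => by positivity
  have hfs : Summable f := by
    have := (hasSum_exp_div 1 y).summable
    simp only [one_mul] at this
    exact ((this.add ((summable_nat_add_iff 1).2 this)).mul_left 2)
  have hftsum : ∑' m, f m ≤ 4 * Real.exp y := by
    have h2 := hasSum_exp_div 1 y
    simp only [one_mul] at h2
    have h3 := h2.summable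
    have h4 := h3.tsum_eq_zero_add
    have h5 := (summable_nat_add_iff 1).2 h3
    rw [h2.tsum_eq] at h4
    simp only [hf]
    rw [tsum_mul_left, h3.tsum_add h5, h2.tsum_eq]
    simp only [pow_zero, Nat.factorial_zero, Nat.cast_one, div_one] at h4
    linarith
  refine le_of_tendsto' hs fun F => ?_
  calc ∑ k ∈ F, wrightMoment γ k * ((y ^ γ) ^ k / k.factorial)
      ≤ ∑ k ∈ F, f ⌊γ * k⌋₊ := by
        refine Finset.sum_le_sum fun k _ => ?_
        have := rpow_div_Gamma_le hy (show 0 ≤ γ * (k : ℝ) by positivity)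
        rw [Real.rpow_mul hy, Real.rpow_natCast] at this
        refine le_trans (le_of_eq ?_) this
        rw [wrightMoment]
        have : (k.factorial : ℝ) ≠ 0 := by positivity
        field_simp
    _ = ∑ m ∈ F.image (fun k : ℕ => ⌊γ * k⌋₊), (F.filter fun k : ℕ => ⌊γ * k⌋₊ = m).card • f m :=
        Finset.sum_comp f _
    _ ≤ ∑ m ∈ F.image (fun k : ℕ => ⌊γ * k⌋₊), (⌈1 / γ⌉₊ : ℝ) * f m := by
        refine Finset.sum_le_sum fun m _ => ?_
        rw [nsmul_eq_mul]
        gcongr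
        exact card_filter_floor_le h0 F m
    _ ≤ ⌈1 / γ⌉₊ * ∑' m, f m := by
        rw [← Finset.mul_sum]
        gcongr
        exact hfs.sum_le_tsum _ fun m _ => hf0 m
    _ ≤ _ := by rw [mul_assoc]; gcongr

end MittagLeffler

/-! ### Exponentials in Banach algebras over ℝ or ℂ -/

section Algebra

lemma exp_add_of_commute_rclike (𝕜 : Type*) {𝔸 : Type*} [RCLike 𝕜] [NormedRing 𝔸]
    [NormedAlgebra 𝕜 𝔸] [CompleteSpace 𝔸] {x y : 𝔸} (h : Commute x y) :
    NormedSpace.exp (x + y) = NormedSpace.exp x * NormedSpace.exp y := by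
  let _ : NormedAlgebra ℚ 𝔸 := NormedAlgebra.restrictScalars ℚ 𝕜 𝔸
  exact NormedSpace.exp_add_of_commute h

lemma hasSum_exp_smul {𝕜 𝔸 : Type*} [RCLike 𝕜] [NormedRing 𝔸]
    [NormedAlgebra 𝕜 𝔸] [CompleteSpace 𝔸] (c : 𝕜) (x : 𝔸) :
    HasSum (fun k : ℕ => (c ^ k / k.factorial) • x ^ k) (NormedSpace.exp (c • x)) := by
  have := NormedSpace.exp_series_hasSum_exp' (𝕂 := 𝕜) (c • x)
  convert! this using 1
  ext k
  rw [smul_pow, smul_smul, div_eq_inv_mul]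

lemma exp_smul_one {𝕜 𝔸 : Type*} [RCLike 𝕜] [NormedRing 𝔸] [NormedAlgebra 𝕜 𝔸] (c : 𝕜) :
    NormedSpace.exp (c • (1 : 𝔸)) = NormedSpace.exp c • (1 : 𝔸) := by
  rw [← Algebra.algebraMap_eq_smul_one, ← Algebra.algebraMap_eq_smul_one,
    NormedSpace.algebraMap_exp_comm]

end Algebra

/-! ### Semigroups, generators and the Laplace transform resolvent -/

section Semigroup

variable {𝕜 B : Type*} [RCLike 𝕜] [NormedAddCommGroup B] [NormedSpace 𝕜 B]

/-- A `C₀`-semigroup with `‖T t‖ ≤ M e ^ (ω t)`, where `ω ≥ 0`. -/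
structure IsExpBoundedSemigroup (T : ℝ → B →L[𝕜] B) (M ω : ℝ) : Prop extends
    IsC0Semigroup T where
  omega_nonneg : 0 ≤ ω
  norm_le : ∀ t : ℝ, 0 ≤ t → ‖T t‖ ≤ M * Real.exp (ω * t)

namespace IsExpBoundedSemigroup

variable {T : ℝ → B →L[𝕜] B} {M ω : ℝ}

lemma M_nonneg (h : IsExpBoundedSemigroup T M ω) : 0 ≤ M := by
  have := (norm_nonneg _).trans (h.norm_le 0 le_rfl)
  simpa using this

lemma norm_apply_le (h : IsExpBoundedSemigroup T M ω) {t : ℝ} (ht : 0 ≤ t) (x : B) :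
    ‖T t x‖ ≤ M * ‖x‖ * Real.exp (ω * t) := by
  refine ((T t).le_opNorm x).trans ?_
  have := mul_le_mul_of_nonneg_right (h.norm_le t ht) (norm_nonneg x)
  linarith

lemma comm (h : IsExpBoundedSemigroup T M ω) {s t : ℝ} (hs : 0 ≤ s) (ht : 0 ≤ t) :
    Commute (T s) (T t) := by
  rw [Commute, SemiconjBy, ← h.map_add s t hs ht, ← h.map_add t s ht hs, add_comm]

lemma map_add_apply (h : IsExpBoundedSemigroup T M ω) {s t : ℝ} (hs : 0 ≤ s) (ht : 0 ≤ t)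
    (x : B) : T (s + t) x = T s (T t x) := by
  rw [h.map_add s t hs ht]; rfl

lemma tendsto_zero' (h : IsExpBoundedSemigroup T M ω) (x : B) :
    Tendsto (fun t : ℝ => T t x) (𝓝[≥] 0) (𝓝 x) := by
  have h0 : T 0 x = x := by rw [h.map_zero]; rfl
  have : ContinuousWithinAt (fun t : ℝ => T t x) (Ioi 0) 0 := by
    rw [ContinuousWithinAt, h0]; exact h.tendsto_zero x
  have := continuousWithinAt_Ioi_iff_Ici.1 this
  rwa [ContinuousWithinAt, h0] at this

lemma continuousOn (h : IsExpBoundedSemigroup T M ω) (x : B) :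
    ContinuousOn (fun t : ℝ => T t x) (Ici 0) := by
  intro t ht
  have ht : 0 ≤ t := ht
  set c := M * Real.exp (ω * t) with hc
  have hM := h.M_nonneg
  -- Factoring out T at the smaller of the two times treats left and right continuity together; that
  -- time is at most t, hence the constant M e^(ωt).
  have key : ∀ s, 0 ≤ s → ‖T s x - T t x‖ ≤ c * ‖T |s - t| x - x‖ := fun s hs => by
    have hbd : ∀ r, 0 ≤ r → r ≤ t → ‖T r (T |s - t| x - x)‖ ≤ c * ‖T |s - t| x - x‖ :=
      fun r hr hrt => by
        refine (h.norm_apply_le hr _).trans ?_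
        have : Real.exp (ω * r) ≤ Real.exp (ω * t) :=
          Real.exp_le_exp.2 (mul_le_mul_of_nonneg_left hrt h.omega_nonneg)
        have := mul_le_mul_of_nonneg_left this (mul_nonneg hM (norm_nonneg (T |s - t| x - x)))
        simp only [hc]; linarith
    rcases le_total s t with hst | hst
    · have e : |s - t| = t - s := by rw [abs_of_nonpos (by linarith)]; ring
      have := h.map_add_apply hs (sub_nonneg.2 hst) x
      rw [add_sub_cancel] at this
      rw [norm_sub_rev, this, ← map_sub, ← e]
      exact hbd s hs hst
    · have e : |s - t| = s - t := abs_of_nonneg (by linarith)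
      have := h.map_add_apply ht (sub_nonneg.2 hst) x
      rw [add_sub_cancel] at this
      have h2 := hbd t ht le_rfl
      rw [this, ← map_sub]
      rwa [e] at h2 ⊢
  have t1 : Tendsto (fun s : ℝ => |s - t|) (𝓝[Ici 0] t) (𝓝[≥] 0) := by
    refine tendsto_nhdsWithin_iff.2 ⟨?_, Eventually.of_forall fun s => abs_nonneg (s - t)⟩
    have : Continuous fun s : ℝ => |s - t| := by fun_prop
    have := (this.tendsto t).mono_left (nhdsWithin_le_nhds (s := Ici 0))
    simpa using this
  have t2 : Tendsto (fun s : ℝ => c * ‖T |s - t| x - x‖) (𝓝[Ici 0] t) (𝓝 0) := by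
    have := (((h.tendsto_zero' x).comp t1).sub_const x).norm.const_mul c
    simpa using this
  rw [ContinuousWithinAt, tendsto_iff_norm_sub_tendsto_zero]
  exact squeeze_zero' (Eventually.of_forall fun _ => norm_nonneg _)
    (eventually_nhdsWithin_of_forall key) t2

lemma continuousOn_comp_mul (h : IsExpBoundedSemigroup T M ω) {c : ℝ} (hc : 0 ≤ c) (x : B) :
    ContinuousOn (fun z => T (c * z) x) (Ici 0) :=
  (h.continuousOn x).comp (by fun_prop) fun _ hz => mul_nonneg hc hz

end IsExpBoundedSemigroup

lemma opApply_eq {A : B →ₗ.[𝕜] B} {x y : B} (h : (x, y) ∈ A.graph) :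
    x ∈ A.domain ∧ opApply A x = y := by
  obtain ⟨z, hz, hy⟩ := (LinearPMap.mem_graph_iff A).1 h
  simp only at hz hy
  subst hz
  refine ⟨z.2, ?_⟩
  rw [opApply, dif_pos z.2]; exact hy

lemma mem_graph_opApply {A : B →ₗ.[𝕜] B} {x : B} (h : x ∈ A.domain) :
    (x, opApply A x) ∈ A.graph := by
  rw [LinearPMap.mem_graph_iff]
  exact ⟨⟨x, h⟩, rfl, by simp only [opApply, dif_pos h]⟩

lemma IsResolventOp.unique {A : B →ₗ.[𝕜] B} {μ : 𝕜} {R R' : B →L[𝕜] B}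
    (h : IsResolventOp A μ R) (h' : IsResolventOp A μ R') : R = R' := by
  ext y
  have := h'.left_inv (R y) (h.mem_domain y)
  rw [h.right_inv] at this
  exact this.symm

lemma IsResolventOp.resolventOp_eq {A : B →ₗ.[𝕜] B} {μ : 𝕜} {R : B →L[𝕜] B}
    (h : IsResolventOp A μ R) : resolventOp A μ = R := by
  have hμ : μ ∈ resolventSetOp A := ⟨R, h⟩
  rw [resolventOp, dif_pos hμ]
  exact (Classical.choose_spec hμ).unique h

variable [NormedSpace ℝ B]

lemma IsGenerator.mem_graph_iff [IsScalarTower ℝ 𝕜 B] {T : ℝ → B →L[𝕜] B} {A : B →ₗ.[𝕜] B}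
    (hA : IsGenerator T A)
    (x y : B) : (x, y) ∈ A.graph ↔
      Tendsto (fun t : ℝ => t⁻¹ • (T t x - x)) (𝓝[>] 0) (𝓝 y) := by
  rw [hA x y]
  simp only [RCLike.real_smul_eq_coe_smul (K := 𝕜)]

/-- An operator commuting with the semigroup commutes with the generator. -/
lemma IsGenerator.commute [IsScalarTower ℝ 𝕜 B] {T : ℝ → B →L[𝕜] B} {A : B →ₗ.[𝕜] B}
    (hA : IsGenerator T A)
    {U : B →L[𝕜] B} (hU : ∀ t, 0 ≤ t → Commute (T t) U) {x : B} (hx : x ∈ A.domain) :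
    U x ∈ A.domain ∧ opApply A (U x) = U (opApply A x) := by
  apply opApply_eq
  rw [hA.mem_graph_iff]
  have h1 := (hA.mem_graph_iff _ _).1 (mem_graph_opApply hx)
  refine ((U.continuous.tendsto _).comp h1).congr' ?_
  filter_upwards [self_mem_nhdsWithin] with t ht
  have : T t (U x) = U (T t x) := congrArg (fun V : B →L[𝕜] B => V x) (hU t (le_of_lt ht)).eq
  simp only [Function.comp_apply]
  rw [this, ← map_sub, RCLike.real_smul_eq_coe_smul (K := 𝕜), map_smul,
    ← RCLike.real_smul_eq_coe_smul (K := 𝕜)]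

/-- Strong integrals of dominated operator-valued functions are bounded operators. -/
lemma exists_clm_integral [IsScalarTower ℝ 𝕜 B] {X : Type*} [MeasurableSpace X] {μ : Measure X}
    {V : X → B →L[𝕜] B}
    (hV : ∀ x, AEStronglyMeasurable (fun s => V s x) μ) {g : X → ℝ} (hg : Integrable g μ)
    (hVg : ∀ᵐ s ∂μ, ‖V s‖ ≤ g s) :
    ∃ R : B →L[𝕜] B, ‖R‖ ≤ ∫ s, g s ∂μ ∧
      ∀ x, Integrable (fun s => V s x) μ ∧ R x = ∫ s, V s x ∂μ := by
  have hle : ∀ x, ∀ᵐ s ∂μ, ‖V s x‖ ≤ g s * ‖x‖ := fun x => by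
    filter_upwards [hVg] with s hs
    exact ((V s).le_opNorm x).trans (mul_le_mul_of_nonneg_right hs (norm_nonneg x))
  have hi : ∀ x, Integrable (fun s => V s x) μ := fun x =>
    (hg.mul_const ‖x‖).mono' (hV x) (hle x)
  let f : B →ₗ[𝕜] B :=
    { toFun := fun x => ∫ s, V s x ∂μ
      map_add' := fun x y => by simp only [map_add]; exact integral_add (hi x) (hi y)
      map_smul' := fun c x => by
        simp only [map_smul, RingHom.id_apply]; exact integral_smul c _ }
  have hf : ∀ x, ‖f x‖ ≤ (∫ s, g s ∂μ) * ‖x‖ := fun x => by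
    rw [← integral_mul_const]
    exact norm_integral_le_of_norm_le (hg.mul_const ‖x‖) (hle x)
  have h0 : 0 ≤ ∫ s, g s ∂μ := integral_nonneg_of_ae (hVg.mono fun s hs => (norm_nonneg _).trans hs)
  exact ⟨f.mkContinuous _ hf, f.mkContinuous_norm_le h0 hf, fun x => ⟨hi x, rfl⟩⟩

lemma setIntegral_Ioi_comp_add {E : Type*} [NormedAddCommGroup E] [NormedSpace ℝ E] (f : ℝ → E)
    (a h : ℝ) : ∫ s in Ioi a, f (s + h) = ∫ s in Ioi (a + h), f s := by
  have := (measurePreserving_add_right volume h).setIntegral_preimage_emb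
    (measurableEmbedding_addRight h) f (Ioi (a + h))
  rw [← this]
  congr 2
  ext x; simp

namespace IsExpBoundedSemigroup

variable {T : ℝ → B →L[𝕜] B} {M ω : ℝ}

lemma integrableOn_laplace (h : IsExpBoundedSemigroup T M ω) {μ : ℝ} (hμ : ω < μ) (x : B) :
    IntegrableOn (fun s : ℝ => Real.exp (-(μ * s)) • T s x) (Ioi 0) := by
  have i1 : IntegrableOn (fun s => M * ‖x‖ * Real.exp ((ω - μ) * s)) (Ioi 0) :=
    (integrableOn_exp_mul_Ioi (by linarith) 0).const_mul _
  refine i1.mono' ?_ ?_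
  · refine ContinuousOn.aestronglyMeasurable (ContinuousOn.smul (by fun_prop) ?_) measurableSet_Ioi
    exact (h.continuousOn x).mono Ioi_subset_Ici_self
  · filter_upwards [self_mem_ae_restrict measurableSet_Ioi] with s hs
    rw [norm_smul, Real.norm_eq_abs, Real.abs_exp]
    calc _ ≤ Real.exp (-(μ * s)) * (M * ‖x‖ * Real.exp (ω * s)) := by
          gcongr; exact h.norm_apply_le (le_of_lt hs) x
      _ = M * ‖x‖ * (Real.exp (-(μ * s)) * Real.exp (ω * s)) := by ring
      _ = _ := by rw [← Real.exp_add]; congr 2; ring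

variable [IsScalarTower ℝ 𝕜 B]

lemma exists_laplace (h : IsExpBoundedSemigroup T M ω) {μ : ℝ} (hμ : ω < μ) :
    ∃ R : B →L[𝕜] B, ∀ x, R x = ∫ s in Ioi (0 : ℝ), Real.exp (-(μ * s)) • T s x := by
  have i1 : IntegrableOn (fun s => M * Real.exp ((ω - μ) * s)) (Ioi 0) :=
    (integrableOn_exp_mul_Ioi (by linarith) 0).const_mul _
  obtain ⟨R, -, hR⟩ := exists_clm_integral (V := fun s => Real.exp (-(μ * s)) • T s)
    (fun x => (h.integrableOn_laplace hμ x).aestronglyMeasurable) i1 (by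
      filter_upwards [self_mem_ae_restrict measurableSet_Ioi] with s hs
      rw [norm_smul, Real.norm_eq_abs, Real.abs_exp]
      calc _ ≤ Real.exp (-(μ * s)) * (M * Real.exp (ω * s)) := by
            gcongr; exact h.norm_le s (le_of_lt hs)
        _ = M * (Real.exp (-(μ * s)) * Real.exp (ω * s)) := by ring
        _ = _ := by rw [← Real.exp_add]; congr 2; ring)
  exact ⟨R, fun x => (hR x).2⟩

variable [CompleteSpace B] {R : B →L[𝕜] B} {μ : ℝ}

lemma apply_laplace (h : IsExpBoundedSemigroup T M ω) (hμ : ω < μ)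
    (hR : ∀ x, R x = ∫ s in Ioi (0 : ℝ), Real.exp (-(μ * s)) • T s x) {t : ℝ} (ht : 0 ≤ t) (x : B) :
    T t (R x) = ∫ s in Ioi (0 : ℝ), Real.exp (-(μ * s)) • T (s + t) x := by
  rw [hR, ← ContinuousLinearMap.integral_comp_comm _ (h.integrableOn_laplace hμ x)]
  refine setIntegral_congr_fun measurableSet_Ioi fun s hs => ?_
  simp only [RCLike.real_smul_eq_coe_smul (K := 𝕜), map_smul]
  rw [add_comm, h.map_add_apply ht (le_of_lt hs)]

lemma commute_laplace (h : IsExpBoundedSemigroup T M ω) (hμ : ω < μ)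
    (hR : ∀ x, R x = ∫ s in Ioi (0 : ℝ), Real.exp (-(μ * s)) • T s x) {t : ℝ} (ht : 0 ≤ t) :
    Commute (T t) R := by
  ext x
  change T t (R x) = R (T t x)
  rw [h.apply_laplace hμ hR ht, hR]
  refine setIntegral_congr_fun measurableSet_Ioi fun s hs => ?_
  rw [h.map_add_apply (le_of_lt hs) ht]

/-- Shifting the integration variable leaves only an integral over [0, t], so differentiability of t
↦ T(t)Rx at 0 becomes the fundamental theorem of calculus. -/
lemma apply_laplace_eq (h : IsExpBoundedSemigroup T M ω) (hμ : ω < μ)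
    (hR : ∀ x, R x = ∫ s in Ioi (0 : ℝ), Real.exp (-(μ * s)) • T s x) {t : ℝ} (ht : 0 ≤ t) (x : B) :
    T t (R x) = Real.exp (μ * t) • (R x - ∫ s in (0 : ℝ)..t, Real.exp (-(μ * s)) • T s x) := by
  have i := h.integrableOn_laplace hμ x
  have e1 : ∀ s, Real.exp (-(μ * s)) • T (s + t) x =
      Real.exp (μ * t) • (Real.exp (-(μ * (s + t))) • T (s + t) x) := fun s => by
    rw [smul_smul, ← Real.exp_add]; congr 2; ring
  rw [h.apply_laplace hμ hR ht]
  simp only [e1]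
  rw [integral_smul, setIntegral_Ioi_comp_add (fun s => Real.exp (-(μ * s)) • T s x), zero_add]
  congr 1
  rw [hR, ← intervalIntegral.integral_interval_add_Ioi i (i.mono_set (Ioi_subset_Ioi ht))]
  abel

lemma tendsto_slope_laplace (h : IsExpBoundedSemigroup T M ω) (hμ : ω < μ)
    (hR : ∀ x, R x = ∫ s in Ioi (0 : ℝ), Real.exp (-(μ * s)) • T s x) (x : B) :
    Tendsto (fun t : ℝ => t⁻¹ • (T t (R x) - R x)) (𝓝[>] 0) (𝓝 (μ • R x - x)) := by
  set f : ℝ → B := fun s => Real.exp (-(μ * s)) • T s x with hf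
  have hfc : ContinuousOn f (Ici 0) := ContinuousOn.smul (by fun_prop) (h.continuousOn x)
  have hf0 : f 0 = x := by simp [hf, h.map_zero]
  have d1 : HasDerivWithinAt (fun u => ∫ s in (0 : ℝ)..u, f s) (f 0) (Ici 0) 0 := by
    refine intervalIntegral.integral_hasDerivWithinAt_right (t := Ioi 0) (by simp) ?_
      ((hfc 0 self_mem_Ici).mono Ioi_subset_Ici_self)
    exact ⟨Ioi 0, self_mem_nhdsWithin,
      (hfc.mono Ioi_subset_Ici_self).aestronglyMeasurable measurableSet_Ioi⟩
  have d2 : HasDerivWithinAt (fun t => Real.exp (μ * t)) μ (Ici 0) 0 := by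
    have := ((hasDerivAt_id (0 : ℝ)).const_mul μ).exp
    simpa using this.hasDerivWithinAt
  have d3 := d2.smul ((hasDerivWithinAt_const (0 : ℝ) (Ici 0) (R x)).sub d1)
  have d4 := (hasDerivWithinAt_iff_tendsto_slope' (s := Ioi 0) (by simp)).1
    (d3.mono Ioi_subset_Ici_self)
  simp only [hf0] at d4
  simp only [Pi.sub_apply, mul_zero, Real.exp_zero, one_smul, zero_sub,
    intervalIntegral.integral_same, sub_zero, neg_add_eq_sub] at d4
  refine d4.congr' ?_
  filter_upwards [self_mem_nhdsWithin] with t ht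
  rw [h.apply_laplace_eq hμ hR (le_of_lt ht) x]
  simp [slope_def_module, hf]

/-- The slope limit says AR = μR - 1, which is the right inverse; the left inverse follows because R
commutes with the semigroup and hence with A. -/
lemma isResolventOp_laplace (h : IsExpBoundedSemigroup T M ω) {A : B →ₗ.[𝕜] B}
    (hA : IsGenerator T A) (hμ : ω < μ)
    (hR : ∀ x, R x = ∫ s in Ioi (0 : ℝ), Real.exp (-(μ * s)) • T s x) :
    IsResolventOp A (μ : 𝕜) R := by
  have key : ∀ x, R x ∈ A.domain ∧ opApply A (R x) = μ • R x - x := fun x =>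
    opApply_eq ((hA.mem_graph_iff _ _).2 (h.tendsto_slope_laplace hμ hR x))
  refine ⟨fun x => (key x).1, fun x => ?_, fun x hx => ?_⟩
  · rw [(key x).2, RCLike.real_smul_eq_coe_smul (K := 𝕜)]; abel
  · have := hA.commute (fun t ht => h.commute_laplace hμ hR ht) hx
    rw [map_sub, ← this.2, (key x).2, map_smul, RCLike.real_smul_eq_coe_smul (K := 𝕜)]; abel

/-- The hypothesis on y bounds its whole orbit, and R reproduces it with K/(μ - ω). Iteration
therefore gives M/(μ - ω)^k for R^k, with M occurring only once. -/
lemma norm_apply_laplace_le (h : IsExpBoundedSemigroup T M ω) (hμ : ω < μ)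
    (hR : ∀ x, R x = ∫ s in Ioi (0 : ℝ), Real.exp (-(μ * s)) • T s x) {K : ℝ} {y : B}
    (hy : ∀ t, 0 ≤ t → ‖T t y‖ ≤ K * Real.exp (ω * t)) {t : ℝ} (ht : 0 ≤ t) :
    ‖T t (R y)‖ ≤ K / (μ - ω) * Real.exp (ω * t) := by
  rw [h.apply_laplace hμ hR ht]
  have i1 : IntegrableOn (fun s => K * Real.exp (ω * t) * Real.exp ((ω - μ) * s)) (Ioi 0) :=
    (integrableOn_exp_mul_Ioi (by linarith) 0).const_mul _
  refine (norm_integral_le_of_norm_le i1 ?_).trans (le_of_eq ?_)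
  · filter_upwards [self_mem_ae_restrict measurableSet_Ioi] with s hs
    have hs : 0 < s := hs
    rw [norm_smul, Real.norm_eq_abs, Real.abs_exp]
    calc _ ≤ Real.exp (-(μ * s)) * (K * Real.exp (ω * (s + t))) := by
          gcongr; exact hy _ (by linarith)
      _ = _ := by
          rw [mul_add, Real.exp_add, show (ω - μ) * s = -(μ * s) + ω * s by ring, Real.exp_add]
          ring
  · rw [integral_const_mul, integral_exp_mul_Ioi (by linarith) 0, mul_zero, Real.exp_zero]
    have : μ - ω ≠ 0 := by linarith
    have : ω - μ ≠ 0 := by linarith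
    field_simp
    ring

lemma norm_apply_laplace_pow_le (h : IsExpBoundedSemigroup T M ω) (hμ : ω < μ)
    (hR : ∀ x, R x = ∫ s in Ioi (0 : ℝ), Real.exp (-(μ * s)) • T s x) (y : B) (k : ℕ) {t : ℝ}
    (ht : 0 ≤ t) : ‖T t ((R ^ k) y)‖ ≤ M * ‖y‖ / (μ - ω) ^ k * Real.exp (ω * t) := by
  induction k generalizing t with
  | zero => simpa using h.norm_apply_le ht y
  | succ k ih =>
    rw [pow_succ']
    have := h.norm_apply_laplace_le hμ hR (fun t ht => ih ht) ht
    rwa [div_div, ← pow_succ] at this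

end IsExpBoundedSemigroup

end Semigroup

/-! ### Subordination to a semigroup -/

section Subordination

variable {α : ℝ}

/-- The substitution s = t^α z moves all dependence on t into the argument of f; the resulting
integral also makes sense at t = 0. -/
lemma wrightKernel_smul_comp_mul {E : Type*} [NormedAddCommGroup E] [NormedSpace ℝ E] (f : ℝ → E)
    {t : ℝ} (ht : 0 < t) (z : ℝ) : wrightKernel α t (t ^ α * z) • f (t ^ α * z) =
      (t ^ α)⁻¹ • (wright α z • f (t ^ α * z)) := by
  have hc : t ^ α ≠ 0 := (Real.rpow_pos_of_pos ht α).ne'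
  rw [wrightKernel, Real.rpow_neg ht.le, smul_smul]
  congr 3
  field_simp

lemma integrableOn_wrightKernel_iff {E : Type*} [NormedAddCommGroup E] [NormedSpace ℝ E]
    (f : ℝ → E) {t : ℝ} (ht : 0 < t) :
    IntegrableOn (fun s => wrightKernel α t s • f s) (Ioi 0) ↔
      IntegrableOn (fun z => wright α z • f (t ^ α * z)) (Ioi 0) := by
  have hc : 0 < t ^ α := Real.rpow_pos_of_pos ht α
  have h1 := integrableOn_Ioi_comp_mul_left_iff (fun s => wrightKernel α t s • f s) 0 hc
  rw [mul_zero] at h1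
  rw [← h1]
  simp only [wrightKernel_smul_comp_mul f ht]
  exact integrable_smul_iff (inv_ne_zero hc.ne') _

lemma integral_wrightKernel {E : Type*} [NormedAddCommGroup E] [NormedSpace ℝ E]
    (f : ℝ → E) {t : ℝ} (ht : 0 < t) :
    ∫ s in Ioi (0 : ℝ), wrightKernel α t s • f s =
      ∫ z in Ioi (0 : ℝ), wright α z • f (t ^ α * z) := by
  have hc : 0 < t ^ α := Real.rpow_pos_of_pos ht α
  have h1 := integral_comp_mul_left_Ioi (fun s => wrightKernel α t s • f s) 0 hc
  rw [mul_zero] at h1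
  simp only [wrightKernel_smul_comp_mul f ht] at h1
  rw [integral_smul] at h1
  exact ((smul_right_injective E (inv_ne_zero hc.ne')) h1).symm

/-- `∫₀^∞ |Φ_α(z)| e ^ (c z) dz`. -/
def wrightAbsLaplace (α c : ℝ) : ℝ := ∫ z in Ioi (0 : ℝ), |wright α z| * Real.exp (c * z)

lemma integrableOn_abs_wright_mul_exp (h0 : 0 < α) (h1 : α < 1) (c : ℝ) :
    IntegrableOn (fun z => |wright α z| * Real.exp (c * z)) (Ioi 0) := by
  have := integrableOn_wright_of_le h0 h1 (f := fun z => Real.exp (c * z)) (K := 1) (c := c)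
    (by fun_prop) (fun z _ => by simp)
  refine IntegrableOn.congr_fun this.norm (fun z _ => ?_) measurableSet_Ioi
  simp

lemma wrightAbsLaplace_nonneg (α c : ℝ) : 0 ≤ wrightAbsLaplace α c :=
  integral_nonneg fun z => by positivity

lemma wrightAbsLaplace_mono (h0 : 0 < α) (h1 : α < 1) {c c' : ℝ} (h : c ≤ c') :
    wrightAbsLaplace α c ≤ wrightAbsLaplace α c' := by
  refine setIntegral_mono_on (integrableOn_abs_wright_mul_exp h0 h1 c)
    (integrableOn_abs_wright_mul_exp h0 h1 c') measurableSet_Ioi fun z hz => ?_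
  have hz : 0 < z := hz
  gcongr

lemma integral_wright_smul_const (h0 : 0 < α) (h1 : α < 1) {E : Type*} [NormedAddCommGroup E]
    [NormedSpace ℝ E] [CompleteSpace E] (x : E) : ∫ z in Ioi (0 : ℝ), wright α z • x = x := by
  have := integral_wright_mul_pow h0 h1 0
  simp only [pow_zero, mul_one, Nat.factorial_zero, Nat.cast_one, Nat.cast_zero, mul_zero, zero_add,
    Real.Gamma_one, div_one] at this
  rw [integral_smul_const, this, one_smul]

variable {𝕜 B : Type*} [RCLike 𝕜] [NormedAddCommGroup B] [NormedSpace 𝕜 B] [NormedSpace ℝ B]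

open Classical in
/-- The family `x ↦ ∫₀^∞ Φ_α(z) U(t ^ α z) x dz` subordinated to `U`. -/
def subordinated (α : ℝ) (U : ℝ → B →L[𝕜] B) (t : ℝ) : B →L[𝕜] B :=
  if h : ∃ R : B →L[𝕜] B, ∀ x, R x = ∫ z in Ioi (0 : ℝ), wright α z • U (t ^ α * z) x then
    Classical.choose h else 0

namespace IsExpBoundedSemigroup

variable {U : ℝ → B →L[𝕜] B} {M ω : ℝ}

lemma integrableOn_wright (h : IsExpBoundedSemigroup U M ω) (h0 : 0 < α) (h1 : α < 1) {t : ℝ}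
    (ht : 0 ≤ t) (x : B) : IntegrableOn (fun z => wright α z • U (t ^ α * z) x) (Ioi 0) := by
  have hc : 0 ≤ t ^ α := Real.rpow_nonneg ht α
  refine integrableOn_wright_of_le h0 h1 (K := M * ‖x‖) (c := ω * t ^ α)
    ((h.continuousOn_comp_mul hc x).mono Ioi_subset_Ici_self) fun z hz => ?_
  have := h.norm_apply_le (mul_nonneg hc hz.le) x
  rwa [← mul_assoc ω] at this

variable [IsScalarTower ℝ 𝕜 B]

lemma exists_subordinated (h : IsExpBoundedSemigroup U M ω) (h0 : 0 < α) (h1 : α < 1) {t : ℝ}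
    (ht : 0 ≤ t) : ∃ R : B →L[𝕜] B, ‖R‖ ≤ M * wrightAbsLaplace α (ω * t ^ α) ∧
      ∀ x, R x = ∫ z in Ioi (0 : ℝ), wright α z • U (t ^ α * z) x := by
  have hc : 0 ≤ t ^ α := Real.rpow_nonneg ht α
  obtain ⟨R, hR1, hR⟩ := exists_clm_integral (μ := volume.restrict (Ioi (0 : ℝ)))
    (V := fun z => wright α z • U (t ^ α * z))
    (fun x => (h.integrableOn_wright h0 h1 ht x).aestronglyMeasurable)
    ((integrableOn_abs_wright_mul_exp h0 h1 (ω * t ^ α)).const_mul M) (by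
      filter_upwards [self_mem_ae_restrict measurableSet_Ioi] with z hz
      rw [norm_smul, Real.norm_eq_abs]
      have := h.norm_le _ (mul_nonneg hc (le_of_lt hz))
      rw [← mul_assoc ω] at this
      calc _ ≤ |wright α z| * (M * Real.exp (ω * t ^ α * z)) := by gcongr
        _ = _ := by ring)
  rw [integral_const_mul] at hR1
  exact ⟨R, hR1, fun x => (hR x).2⟩

lemma subordinated_apply (h : IsExpBoundedSemigroup U M ω) (h0 : 0 < α) (h1 : α < 1) {t : ℝ}
    (ht : 0 ≤ t) (x : B) :
    subordinated α U t x = ∫ z in Ioi (0 : ℝ), wright α z • U (t ^ α * z) x := by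
  obtain ⟨R, -, hR⟩ := h.exists_subordinated h0 h1 ht
  have hex : ∃ R : B →L[𝕜] B, ∀ x, R x = ∫ z in Ioi (0 : ℝ), wright α z • U (t ^ α * z) x :=
    ⟨R, hR⟩
  rw [subordinated, dif_pos hex]
  exact Classical.choose_spec hex x

lemma norm_subordinated_le (h : IsExpBoundedSemigroup U M ω) (h0 : 0 < α) (h1 : α < 1) {t : ℝ}
    (ht : 0 ≤ t) : ‖subordinated α U t‖ ≤ M * wrightAbsLaplace α (ω * t ^ α) := by
  obtain ⟨R, hR1, hR⟩ := h.exists_subordinated h0 h1 ht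
  have : subordinated α U t = R := by
    ext x; rw [h.subordinated_apply h0 h1 ht, hR]
  rwa [this]

lemma norm_subordinated_le_of_le (h : IsExpBoundedSemigroup U M ω) (h0 : 0 < α) (h1 : α < 1)
    {t b : ℝ} (ht : 0 ≤ t) (htb : t ≤ b) :
    ‖subordinated α U t‖ ≤ M * wrightAbsLaplace α (ω * b ^ α) := by
  refine (h.norm_subordinated_le h0 h1 ht).trans ?_
  refine mul_le_mul_of_nonneg_left (wrightAbsLaplace_mono h0 h1 ?_) h.M_nonneg
  exact mul_le_mul_of_nonneg_left (Real.rpow_le_rpow ht htb h0.le) h.omega_nonneg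

lemma subordinated_zero [CompleteSpace B] (h : IsExpBoundedSemigroup U M ω) (h0 : 0 < α)
    (h1 : α < 1) : subordinated α U 0 = 1 := by
  ext x
  rw [h.subordinated_apply h0 h1 le_rfl, Real.zero_rpow h0.ne']
  simp only [zero_mul, h.map_zero]
  exact integral_wright_smul_const h0 h1 x

lemma commute_subordinated [CompleteSpace B] (h : IsExpBoundedSemigroup U M ω) (h0 : 0 < α)
    (h1 : α < 1) {X : B →L[𝕜] B} (hX : ∀ s, 0 ≤ s → Commute X (U s)) {t : ℝ} (ht : 0 ≤ t) :
    Commute X (subordinated α U t) := by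
  ext x
  change X (subordinated α U t x) = subordinated α U t (X x)
  rw [h.subordinated_apply h0 h1 ht, h.subordinated_apply h0 h1 ht,
    ← ContinuousLinearMap.integral_comp_comm _ (h.integrableOn_wright h0 h1 ht x)]
  refine setIntegral_congr_fun measurableSet_Ioi fun z hz => ?_
  have := congrArg (fun V : B →L[𝕜] B => V x)
    (hX (t ^ α * z) (mul_nonneg (Real.rpow_nonneg ht α) (le_of_lt hz))).eq
  simp only [RCLike.real_smul_eq_coe_smul (K := 𝕜), map_smul]
  congr 1

lemma continuousOn_subordinated (h : IsExpBoundedSemigroup U M ω) (h0 : 0 < α) (h1 : α < 1)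
    (x : B) : ContinuousOn (fun t => subordinated α U t x) (Ici 0) := by
  refine ContinuousOn.congr (f := fun t => ∫ z in Ioi (0 : ℝ), wright α z • U (t ^ α * z) x) ?_
    fun t ht => h.subordinated_apply h0 h1 ht x
  intro t ht
  have ht : 0 ≤ t := ht
  -- Only times below t + 1 matter near t, so (t+1)^α serves in the majorant.
  refine continuousWithinAt_of_dominated
    (bound := fun z => M * ‖x‖ * (|wright α z| * Real.exp (ω * (t + 1) ^ α * z))) ?_ ?_
    ((integrableOn_abs_wright_mul_exp h0 h1 _).const_mul _) ?_
  · filter_upwards [self_mem_nhdsWithin] with s hs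
    exact (h.integrableOn_wright h0 h1 hs x).aestronglyMeasurable
  · filter_upwards [self_mem_nhdsWithin, mem_nhdsWithin_of_mem_nhds (Iio_mem_nhds (lt_add_one t))]
      with s hs hst
    have hs : 0 ≤ s := hs
    have hst : s < t + 1 := hst
    filter_upwards [self_mem_ae_restrict measurableSet_Ioi] with z hz
    have hz : 0 < z := hz
    have hsa : 0 ≤ s ^ α := Real.rpow_nonneg hs α
    rw [norm_smul, Real.norm_eq_abs]
    have h2 := h.norm_apply_le (mul_nonneg hsa hz.le) x
    have h3 : Real.exp (ω * (s ^ α * z)) ≤ Real.exp (ω * (t + 1) ^ α * z) := by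
      rw [mul_assoc]
      have := h.omega_nonneg
      gcongr
    have hM := h.M_nonneg
    calc _ ≤ |wright α z| * (M * ‖x‖ * Real.exp (ω * (t + 1) ^ α * z)) := by
          gcongr; exact h2.trans (by gcongr)
      _ = _ := by ring
  · filter_upwards [self_mem_ae_restrict measurableSet_Ioi] with z hz
    refine ContinuousWithinAt.const_smul ?_ _
    have hc : ContinuousOn (fun s : ℝ => s ^ α * z) (Ici 0) :=
      ((Real.continuous_rpow_const h0.le).mul_const z).continuousOn
    exact ((h.continuousOn x).comp hc
      fun s hs => mul_nonneg (Real.rpow_nonneg hs α) (le_of_lt hz)) t ht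

end IsExpBoundedSemigroup

end Subordination

/-! ### Beta integrals and the fractional kernel -/

section Beta

lemma integral_rpow_mul_rpow_sub {a b t : ℝ} (ha : 0 < a) (hb : 0 < b) (ht : 0 < t) :
    ∫ τ in (0 : ℝ)..t, τ ^ (a - 1) * (t - τ) ^ (b - 1) =
      t ^ (a + b - 1) * (Real.Gamma a * Real.Gamma b / Real.Gamma (a + b)) := by
  have h1 := Complex.betaIntegral_scaled a b ht
  have h2 := Complex.Gamma_mul_Gamma_eq_betaIntegral (s := a) (t := b) (by simpa) (by simpa)
  have h3 : Complex.Gamma ((a : ℂ) + b) ≠ 0 := by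
    rw [← Complex.ofReal_add, Complex.Gamma_ofReal]
    exact_mod_cast (Real.Gamma_pos_of_pos (add_pos ha hb)).ne'
  have h4 : Complex.betaIntegral a b = ((Real.Gamma a * Real.Gamma b / Real.Gamma (a + b) : ℝ) : ℂ) := by
    push_cast
    rw [← Complex.Gamma_ofReal, ← Complex.Gamma_ofReal, ← Complex.Gamma_ofReal, Complex.ofReal_add,
      h2]
    field_simp
  rw [h4] at h1
  have h5 : ∫ x in (0 : ℝ)..t, (x : ℂ) ^ ((a : ℂ) - 1) * ((t : ℂ) - x) ^ ((b : ℂ) - 1) =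
      ((∫ τ in (0 : ℝ)..t, τ ^ (a - 1) * (t - τ) ^ (b - 1) : ℝ) : ℂ) := by
    rw [← intervalIntegral.integral_ofReal]
    refine intervalIntegral.integral_congr fun x hx => ?_
    rw [uIcc_of_le ht.le] at hx
    push_cast
    rw [Complex.ofReal_cpow hx.1, Complex.ofReal_cpow (sub_nonneg.2 hx.2)]
    push_cast; rfl
  rw [h5] at h1
  have h6 : ((t : ℂ)) ^ ((a : ℂ) + b - 1) = ((t ^ (a + b - 1) : ℝ) : ℂ) := by
    rw [Complex.ofReal_cpow ht.le]; push_cast; rfl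
  rw [h6] at h1
  exact_mod_cast h1

variable {α : ℝ}

lemma intervalIntegrable_fracKernel (h0 : 0 < α) (t : ℝ) :
    IntervalIntegrable (fun τ => fracKernel α (t - τ)) volume 0 t := by
  have := (intervalIntegral.intervalIntegrable_rpow' (a := 0) (b := t) (r := α - 1)
    (by linarith)).comp_sub_left t
  simp only [sub_zero, sub_self] at this
  exact (this.symm.div_const _)

lemma fracKernel_nonneg (h0 : 0 < α) {t : ℝ} (ht : 0 ≤ t) : 0 ≤ fracKernel α t :=
  div_nonneg (Real.rpow_nonneg ht _) (Real.Gamma_pos_of_pos h0).le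

/-- Convolution with g_α sends each Mittag-Leffler term to the next one, which is why the series
solves the Volterra equation. -/
lemma integral_fracKernel_mul_rpow (h0 : 0 < α) {t : ℝ} (ht : 0 ≤ t) (k : ℕ) :
    ∫ τ in (0 : ℝ)..t, fracKernel α (t - τ) * ((τ ^ α) ^ k / Real.Gamma (α * k + 1)) =
      (t ^ α) ^ (k + 1) / Real.Gamma (α * (k + 1 : ℕ) + 1) := by
  rcases ht.eq_or_lt with rfl | ht
  · simp [Real.zero_rpow h0.ne']
  have hk : 0 < α * k + 1 := by positivity
  have h1 := integral_rpow_mul_rpow_sub hk h0 ht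
  have e : ∫ τ in (0 : ℝ)..t, fracKernel α (t - τ) * ((τ ^ α) ^ k / Real.Gamma (α * k + 1)) =
      ∫ τ in (0 : ℝ)..t, (τ ^ (α * k + 1 - 1) * (t - τ) ^ (α - 1)) *
        (Real.Gamma (α * k + 1) * Real.Gamma α)⁻¹ := by
    refine intervalIntegral.integral_congr fun τ hτ => ?_
    rw [uIcc_of_le ht.le] at hτ
    simp only [fracKernel]
    rw [add_sub_cancel_right, Real.rpow_mul hτ.1, Real.rpow_natCast]
    have := (Real.Gamma_pos_of_pos hk).ne'
    have := (Real.Gamma_pos_of_pos h0).ne'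
    field_simp
  rw [e, intervalIntegral.integral_mul_const, h1, ← Real.rpow_natCast, ← Real.rpow_mul ht.le]
  have := (Real.Gamma_pos_of_pos hk).ne'
  have := (Real.Gamma_pos_of_pos h0).ne'
  have e2 : α * k + 1 + α - 1 = α * (k + 1 : ℕ) := by push_cast; ring
  have e3 : α * k + 1 + α = α * (k + 1 : ℕ) + 1 := by push_cast; ring
  rw [e2, e3]
  field_simp

end Beta

/-! ### Fractional resolvent families of bounded operators -/

section BoundedGenerator

variable {𝕜 B : Type*} [RCLike 𝕜] [NormedAddCommGroup B] [NormedSpace 𝕜 B]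

lemma opNorm_pow_le (X : B →L[𝕜] B) (k : ℕ) : ‖X ^ k‖ ≤ ‖X‖ ^ k := by
  rcases k.eq_zero_or_pos with rfl | hk
  -- The identity has norm at most 1, with equality failing on the zero space.
  · rw [pow_zero, pow_zero]; exact ContinuousLinearMap.norm_id_le
  · exact norm_pow_le' X hk

lemma opApply_ofBounded (X : B →L[𝕜] B) (x : B) : opApply (ofBounded X) x = X x := by
  have h : x ∈ (ofBounded X).domain := Submodule.mem_top
  rw [opApply, dif_pos h]; rfl

/-- The uniformly continuous semigroup generated by a bounded operator. -/
def expSemigroup (X : B →L[𝕜] B) (s : ℝ) : B →L[𝕜] B := NormedSpace.exp ((s : 𝕜) • X)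

lemma commute_expSemigroup {X Y : B →L[𝕜] B} (h : Commute Y X) (s : ℝ) :
    Commute Y (expSemigroup X s) :=
  Commute.exp_right (h.smul_right _)

lemma exp_real_smul_eq [NormedSpace ℝ B] [IsScalarTower ℝ 𝕜 B] (X : B →L[𝕜] B)
    (s : ℝ) : NormedSpace.exp (s • X) = expSemigroup X s := by
  rw [expSemigroup, RCLike.real_smul_eq_coe_smul (K := 𝕜)]

variable [CompleteSpace B]

lemma hasSum_expSemigroup (X : B →L[𝕜] B) (s : ℝ) (x : B) :
    HasSum (fun k : ℕ => ((s ^ k / k.factorial : ℝ) : 𝕜) • (X ^ k) x) (expSemigroup X s x) := by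
  have h := (ContinuousLinearMap.apply 𝕜 B x).hasSum (hasSum_exp_smul (s : 𝕜) X)
  convert! h using 1
  ext k
  simp

lemma continuous_expSemigroup (X : B →L[𝕜] B) : Continuous (expSemigroup X) := by
  have : Continuous fun u : 𝕜 => NormedSpace.exp (u • X) :=
    continuous_iff_continuousAt.2 fun u => (hasDerivAt_exp_smul_const X u).continuousAt
  exact this.comp RCLike.continuous_ofReal

lemma isExpBoundedSemigroup_expSemigroup (X : B →L[𝕜] B) :
    IsExpBoundedSemigroup (expSemigroup X) 1 ‖X‖ := by
  have hz : expSemigroup X 0 = 1 := by simp [expSemigroup, NormedSpace.exp_zero]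
  refine ⟨⟨hz, fun s t _ _ => ?_, fun x => ?_⟩, norm_nonneg _, fun t ht => ?_⟩
  · rw [expSemigroup, RCLike.ofReal_add, add_smul]
    exact exp_add_of_commute_rclike 𝕜 (((Commute.refl X).smul_left _).smul_right _)
  · have h := ((ContinuousLinearMap.apply 𝕜 B x).continuous.comp
      (continuous_expSemigroup X)).tendsto 0
    simp only [Function.comp_apply, hz] at h
    exact h.mono_left nhdsWithin_le_nhds
  · refine ContinuousLinearMap.opNorm_le_bound _ (by positivity) fun x => ?_
    have hs : HasSum (fun k : ℕ => ‖x‖ * ((‖X‖ * t) ^ k / k.factorial))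
        (‖x‖ * Real.exp (‖X‖ * t)) := hasSum_exp_div _ _
    rw [← (hasSum_expSemigroup X t x).tsum_eq, one_mul, mul_comm]
    refine tsum_of_norm_bounded hs fun k => ?_
    rw [norm_smul, RCLike.norm_ofReal, abs_of_nonneg (by positivity)]
    have h2 := ((X ^ k).le_opNorm x).trans
      (mul_le_mul_of_nonneg_right (opNorm_pow_le X k) (norm_nonneg x))
    calc _ ≤ t ^ k / k.factorial * (‖X‖ ^ k * ‖x‖) := by gcongr
      _ = _ := by rw [mul_pow]; ring

variable [NormedSpace ℝ B] [IsScalarTower ℝ 𝕜 B] {α : ℝ}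

/-- The moments k!/Γ(αk+1) cancel the factorials of the exponential series and leave the
Mittag-Leffler series of t^α X. -/
lemma hasSum_subordinated_expSemigroup (h0 : 0 < α) (h1 : α < 1) (X : B →L[𝕜] B) {t : ℝ}
    (ht : 0 ≤ t) (x : B) :
    HasSum (fun k : ℕ => ((t ^ α) ^ k / Real.Gamma (α * k + 1)) • (X ^ k) x)
      (subordinated α (expSemigroup X) t x) := by
  have hc : 0 ≤ t ^ α := Real.rpow_nonneg ht α
  have := hasSum_integral_wright h0 h1 (h := fun _ => 1) (H := 1) (c := 0)
    continuousOn_const (fun z _ => by simp) (K := ‖x‖) (r := t ^ α * ‖X‖)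
    (e := fun j => ((t ^ α) ^ j / j.factorial) • (X ^ j) x) (fun j => by
      rw [norm_smul, Real.norm_of_nonneg (by positivity), mul_pow]
      have h2 := ((X ^ j).le_opNorm x).trans
        (mul_le_mul_of_nonneg_right (opNorm_pow_le X j) (norm_nonneg x))
      calc _ ≤ (t ^ α) ^ j / j.factorial * (‖X‖ ^ j * ‖x‖) := by gcongr
        _ = _ := by ring)
    (g := fun z => expSemigroup X (t ^ α * z) x) (fun z _ => by
      convert! hasSum_expSemigroup X (t ^ α * z) x using 1
      ext j
      rw [smul_smul, ← RCLike.real_smul_eq_coe_smul (K := 𝕜), mul_pow]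
      congr 1; ring)
  rw [(isExpBoundedSemigroup_expSemigroup X).subordinated_apply h0 h1 ht]
  simp only [mul_one, one_mul] at this
  convert! this using 1
  ext j
  rw [integral_wright_mul_pow h0 h1, smul_smul]
  have : (j.factorial : ℝ) ≠ 0 := by positivity
  congr 1
  field_simp

/-- The Volterra equation is checked term by term: applying X and convolving with g_α shifts the
series by one index, and the missing zeroth term is x. -/
lemma isFracResolventFamily_expSemigroup (h0 : 0 < α) (h1 : α < 1) (X : B →L[𝕜] B) :
    IsFracResolventFamily α (ofBounded X) (subordinated α (expSemigroup X)) := by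
  have hU := isExpBoundedSemigroup_expSemigroup X
  have hcomm : ∀ t, 0 ≤ t → ∀ x, X (subordinated α (expSemigroup X) t x) =
      subordinated α (expSemigroup X) t (X x) := fun t ht x =>
    congrArg (fun V : B →L[𝕜] B => V x) (hU.commute_subordinated h0 h1
      (fun s _ => commute_expSemigroup (Commute.refl X) s) ht).eq
  refine ⟨hU.subordinated_zero h0 h1, hU.continuousOn_subordinated h0 h1,
    fun _ _ _ _ => Submodule.mem_top, fun t ht x _ => ?_, fun t ht x _ => ?_, fun t ht x _ => ?_⟩
  · rw [opApply_ofBounded, opApply_ofBounded]; exact hcomm t ht x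
  · simp only [opApply_ofBounded]
    refine (intervalIntegrable_fracKernel h0 t).smul_continuousOn ?_
    refine X.continuous.comp_continuousOn ((hU.continuousOn_subordinated h0 h1 x).mono ?_)
    rw [uIcc_of_le ht]; exact Icc_subset_Ici_self
  · simp only [opApply_ofBounded]
    have hs := hasSum_subordinated_expSemigroup h0 h1 X ht x
    have hint : HasSum (fun k : ℕ => ∫ τ in (0 : ℝ)..t,
        (fracKernel α (t - τ) * ((τ ^ α) ^ k / Real.Gamma (α * k + 1))) • (X ^ (k + 1)) x)
        (∫ τ in (0 : ℝ)..t, fracKernel α (t - τ) • X (subordinated α (expSemigroup X) τ x)) := by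
      -- The k-th Wright moment divided by k! is 1/Γ(αk+1), so summability comes from the Laplace
      -- transform series.
      have hsum : Summable fun k : ℕ => (t ^ α * ‖X‖) ^ k / Real.Gamma (α * k + 1) := by
        refine (hasSum_wrightMoment h0 h1 0 (t ^ α * ‖X‖)).summable.congr fun k => ?_
        have : (k.factorial : ℝ) ≠ 0 := by positivity
        rw [wrightMoment, add_zero]
        field_simp
      refine intervalIntegral.hasSum_integral_of_dominated_convergence
        (fun k τ => fracKernel α (t - τ) *
          (‖X‖ * ‖x‖ * ((t ^ α * ‖X‖) ^ k / Real.Gamma (α * k + 1))))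
        (fun k => ?_) (fun k => Eventually.of_forall fun τ hτ => ?_)
        (Eventually.of_forall fun τ _ => (hsum.mul_left _).mul_left _) ?_
        (Eventually.of_forall fun τ hτ => ?_)
      · have hm : Measurable fun τ : ℝ =>
            fracKernel α (t - τ) * ((τ ^ α) ^ k / Real.Gamma (α * k + 1)) := by
          unfold fracKernel; fun_prop
        exact (hm.aestronglyMeasurable).smul aestronglyMeasurable_const
      · rw [uIoc_of_le ht] at hτ
        have hG := Real.Gamma_pos_of_pos (show 0 < α * (k : ℝ) + 1 by positivity)
        have hk := fracKernel_nonneg h0 (sub_nonneg.2 hτ.2)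
        have hτ0 := Real.rpow_nonneg hτ.1.le α
        have hτt := Real.rpow_le_rpow hτ.1.le hτ.2 h0.le
        rw [norm_smul, Real.norm_of_nonneg (by positivity)]
        have h2 := ((X ^ (k + 1)).le_opNorm x).trans
          (mul_le_mul_of_nonneg_right (opNorm_pow_le X (k + 1)) (norm_nonneg x))
        calc _ ≤ fracKernel α (t - τ) * ((t ^ α) ^ k / Real.Gamma (α * k + 1)) *
              (‖X‖ ^ (k + 1) * ‖x‖) := by gcongr
          _ = _ := by rw [mul_pow]; ring
      · simp only [tsum_mul_left]
        exact (intervalIntegrable_fracKernel h0 t).mul_const _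
      · rw [uIoc_of_le ht] at hτ
        have h2 := X.hasSum (hasSum_subordinated_expSemigroup h0 h1 X hτ.1.le x)
        have h3 := h2.const_smul (fracKernel α (t - τ))
        convert! h3 using 1
        ext k
        simp only [RCLike.real_smul_eq_coe_smul (K := 𝕜), map_smul, pow_succ']
        rw [smul_smul, RCLike.ofReal_mul]; rfl
    simp only [intervalIntegral.integral_smul_const, integral_fracKernel_mul_rpow h0 ht] at hint
    have h2 := (hasSum_nat_add_iff' 1).2 hs
    have h3 := h2.unique hint
    rw [← h3]
    simp
end BoundedGenerator

/-! ### Yosida approximation -/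

section Yosida

/-- Here n ≥ 2ω enters: it gives μ/(μ - ω) ≤ 2 and so produces the 2ω of the exponential bound. -/
lemma mul_div_sub_le_two_mul {μ ω : ℝ} (hω : 0 ≤ ω) (hμ : ω < μ) (hμ2 : 2 * ω ≤ μ) :
    μ * ω / (μ - ω) ≤ 2 * ω := by
  rw [div_le_iff₀ (by linarith)]
  nlinarith

variable {𝕜 B : Type*} [RCLike 𝕜] [NormedAddCommGroup B] [NormedSpace 𝕜 B] [CompleteSpace B]

/-- The scalar part commutes with R and splits off; what remains is a power series in R whose
coefficients are nonnegative for s ≥ 0. -/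
lemma expSemigroup_sq_smul_sub (R : B →L[𝕜] B) (μ s : ℝ) :
    expSemigroup ((μ : 𝕜) ^ 2 • R - (μ : 𝕜) • (1 : B →L[𝕜] B)) s =
      ((Real.exp (-(μ * s)) : ℝ) : 𝕜) • expSemigroup R (s * μ ^ 2) := by
  have e : (s : 𝕜) • ((μ : 𝕜) ^ 2 • R - (μ : 𝕜) • (1 : B →L[𝕜] B)) =
      ((-(μ * s) : ℝ) : 𝕜) • (1 : B →L[𝕜] B) + ((s * μ ^ 2 : ℝ) : 𝕜) • R := by
    rw [smul_sub, smul_smul, smul_smul]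
    push_cast
    rw [neg_smul, mul_comm (μ : 𝕜)]
    abel
  have hc : Commute (((-(μ * s) : ℝ) : 𝕜) • (1 : B →L[𝕜] B)) (((s * μ ^ 2 : ℝ) : 𝕜) • R) :=
    (Commute.one_left _).smul_left _
  have he : NormedSpace.exp ((-(μ * s) : ℝ) : 𝕜) = ((Real.exp (-(μ * s)) : ℝ) : 𝕜) := by
    rw [Real.exp_eq_exp_ℝ]
    exact (NormedSpace.algebraMap_exp_comm (𝕂 := ℝ) (𝔸 := 𝕜) (-(μ * s))).symm
  rw [expSemigroup, e, exp_add_of_commute_rclike 𝕜 hc, exp_smul_one, he, smul_mul_assoc, one_mul]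
  rfl

lemma tendsto_slope_expSemigroup (X : B →L[𝕜] B) (x : B) :
    Tendsto (fun t : ℝ => ((t : 𝕜))⁻¹ • (expSemigroup X t x - x)) (𝓝[>] 0) (𝓝 (X x)) := by
  have h1 := (hasDerivAt_iff_tendsto_slope.1 (hasDerivAt_exp_smul_const X (0 : 𝕜)))
  rw [zero_smul, NormedSpace.exp_zero, one_mul] at h1
  have h2 : Tendsto (fun t : ℝ => (t : 𝕜)) (𝓝[>] 0) (𝓝[≠] 0) := by
    refine tendsto_nhdsWithin_iff.2 ⟨?_, ?_⟩
    · have := (RCLike.continuous_ofReal (K := 𝕜)).tendsto 0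
      rw [RCLike.ofReal_zero] at this
      exact this.mono_left nhdsWithin_le_nhds
    · filter_upwards [self_mem_nhdsWithin] with t ht
      exact RCLike.ofReal_ne_zero.2 (ne_of_gt ht)
  refine (((ContinuousLinearMap.apply 𝕜 B x).continuous.tendsto _).comp (h1.comp h2)).congr
    fun t => ?_
  simp [slope_def_module, expSemigroup, NormedSpace.exp_zero]

variable [NormedSpace ℝ B] [IsScalarTower ℝ 𝕜 B] {T : ℝ → B →L[𝕜] B} {M ω μ : ℝ}
  {R : B →L[𝕜] B}

namespace IsExpBoundedSemigroup

lemma commute_expSemigroup_yosida (h : IsExpBoundedSemigroup T M ω) (hμ : ω < μ)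
    (hR : ∀ x, R x = ∫ s in Ioi (0 : ℝ), Real.exp (-(μ * s)) • T s x) {t : ℝ} (ht : 0 ≤ t)
    (s : ℝ) : Commute (T t)
      (expSemigroup ((μ : 𝕜) ^ 2 • R - (μ : 𝕜) • (1 : B →L[𝕜] B)) s) :=
  commute_expSemigroup (((h.commute_laplace hμ hR ht).smul_right _).sub_right
    ((Commute.one_right _).smul_right _)) s

lemma norm_apply_expSemigroup_laplace_le (h : IsExpBoundedSemigroup T M ω) (hμ : ω < μ)
    (hR : ∀ x, R x = ∫ s in Ioi (0 : ℝ), Real.exp (-(μ * s)) • T s x) {t s : ℝ} (ht : 0 ≤ t)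
    (hs : 0 ≤ s) (y : B) : ‖T t (expSemigroup R s y)‖ ≤
      M * ‖y‖ * Real.exp (ω * t) * Real.exp (s / (μ - ω)) := by
  have h1 := (T t).hasSum (hasSum_expSemigroup R s y)
  have h2 : HasSum (fun k : ℕ => M * ‖y‖ * Real.exp (ω * t) * ((s / (μ - ω)) ^ k / k.factorial))
    (M * ‖y‖ * Real.exp (ω * t) * Real.exp (s / (μ - ω))) := hasSum_exp_div _ _
  rw [← h1.tsum_eq]
  refine tsum_of_norm_bounded h2 fun k => ?_
  rw [map_smul, norm_smul, RCLike.norm_ofReal, abs_of_nonneg (by positivity)]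
  calc _ ≤ s ^ k / k.factorial * (M * ‖y‖ / (μ - ω) ^ k * Real.exp (ω * t)) := by
        gcongr; exact h.norm_apply_laplace_pow_le hμ hR y k ht
    _ = _ := by rw [div_pow]; ring

/-- The rates combine as -μ + μ²/(μ - ω) = μω/(μ - ω). Keeping T(t) in front gives a single factor
M, where separate operator norms would give M². -/
lemma norm_apply_expSemigroup_yosida_le (h : IsExpBoundedSemigroup T M ω) (hμ : ω < μ)
    (hR : ∀ x, R x = ∫ s in Ioi (0 : ℝ), Real.exp (-(μ * s)) • T s x) {t s : ℝ} (ht : 0 ≤ t)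
    (hs : 0 ≤ s) (y : B) :
    ‖T t (expSemigroup ((μ : 𝕜) ^ 2 • R - (μ : 𝕜) • (1 : B →L[𝕜] B)) s y)‖ ≤
      M * ‖y‖ * Real.exp (ω * t) * Real.exp (μ * ω / (μ - ω) * s) := by
  rw [expSemigroup_sq_smul_sub, smul_apply, map_smul, norm_smul, RCLike.norm_ofReal, Real.abs_exp]
  have h1 := h.norm_apply_expSemigroup_laplace_le hμ hR ht (s := s * μ ^ 2) (by positivity) y
  have hne : μ - ω ≠ 0 := by linarith
  calc _ ≤ Real.exp (-(μ * s)) *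
        (M * ‖y‖ * Real.exp (ω * t) * Real.exp (s * μ ^ 2 / (μ - ω))) := by gcongr
    _ = M * ‖y‖ * Real.exp (ω * t) * (Real.exp (-(μ * s)) * Real.exp (s * μ ^ 2 / (μ - ω))) := by
        ring
    _ = _ := by
        rw [← Real.exp_add]
        congr 2
        field_simp
        ring

lemma isExpBoundedSemigroup_yosida (h : IsExpBoundedSemigroup T M ω) (hμ : ω < μ)
    (hR : ∀ x, R x = ∫ s in Ioi (0 : ℝ), Real.exp (-(μ * s)) • T s x) :
    IsExpBoundedSemigroup
      (expSemigroup ((μ : 𝕜) ^ 2 • R - (μ : 𝕜) • (1 : B →L[𝕜] B))) M (μ * ω / (μ - ω)) := by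
  have hμ0 := h.omega_nonneg.trans hμ.le
  have hM := h.M_nonneg
  refine ⟨(isExpBoundedSemigroup_expSemigroup _).toIsC0Semigroup,
    div_nonneg (mul_nonneg hμ0 h.omega_nonneg) (by linarith), fun t ht => ?_⟩
  refine ContinuousLinearMap.opNorm_le_bound _ (by positivity) fun x => ?_
  have := h.norm_apply_expSemigroup_yosida_le hμ hR le_rfl ht x
  rw [h.map_zero, mul_zero, Real.exp_zero, mul_one] at this
  exact this.trans (le_of_eq (by ring))

/-- Expanding in powers of R, the scalar weights ∫ Φ_α(z) z^j e^(-μuz) dz are nonnegative, so taking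
norms termwise costs nothing. The majorant series sums to M E_α(v), with no absolute value falling
on `wright`, and the Mittag-Leffler bound applies. -/
lemma norm_subordinated_yosida_le (h : IsExpBoundedSemigroup T M ω) {α C : ℝ} (h0 : 0 < α)
    (h1 : α < 1)
    (hC : ∀ y, 0 ≤ y → ∫ z in Ioi (0 : ℝ), wright α z * Real.exp (y ^ α * z) ≤ C * Real.exp y)
    (hC0 : 0 ≤ C) (hμ : ω < μ) (hμ2 : 2 * ω ≤ μ)
    (hR : ∀ x, R x = ∫ s in Ioi (0 : ℝ), Real.exp (-(μ * s)) • T s x) {t : ℝ} (ht : 0 ≤ t) :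
    ‖subordinated α (expSemigroup ((μ : 𝕜) ^ 2 • R - (μ : 𝕜) • (1 : B →L[𝕜] B))) t‖ ≤
      M * C * Real.exp ((2 * ω) ^ (1 / α) * t) := by
  have hω := h.omega_nonneg
  have hμ0 := hω.trans hμ.le
  have hM := h.M_nonneg
  have hne : 0 < μ - ω := by linarith
  refine ContinuousLinearMap.opNorm_le_bound _ (by positivity) fun x => ?_
  set u := t ^ α with hu
  have hu0 : 0 ≤ u := Real.rpow_nonneg ht α
  -- The rate of the majorant series; r - μu is the v introduced below.
  set r := u * μ ^ 2 / (μ - ω) with hr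
  have hr0 : 0 ≤ r := by positivity
  have hcoef : ∀ j : ℕ, ‖((u * μ ^ 2) ^ j / j.factorial) • (R ^ j) x‖ ≤
      M * ‖x‖ * r ^ j / j.factorial := fun j => by
    have := h.norm_apply_laplace_pow_le hμ hR x j le_rfl
    rw [h.map_zero, mul_zero, Real.exp_zero, mul_one] at this
    rw [norm_smul, Real.norm_of_nonneg (by positivity)]
    calc _ ≤ (u * μ ^ 2) ^ j / j.factorial * (M * ‖x‖ / (μ - ω) ^ j) := by
          gcongr; exact this
      _ = _ := by rw [hr, div_pow]; ring
  have hweight : ∀ z : ℝ, 0 < z → |Real.exp (-(μ * u) * z)| ≤ 1 * Real.exp (0 * z) := fun z hz => by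
    rw [Real.abs_exp, zero_mul, Real.exp_zero, mul_one, Real.exp_le_one_iff]
    have := mul_nonneg (mul_nonneg hμ0 hu0) hz.le
    linarith
  have s1 := hasSum_integral_wright h0 h1 (h := fun z => Real.exp (-(μ * u) * z))
    (by fun_prop) hweight hcoef (g := fun z => expSemigroup R (u * z * μ ^ 2) x) fun z _ => by
      convert! hasSum_expSemigroup R (u * z * μ ^ 2) x using 1
      ext j
      rw [smul_smul, ← RCLike.real_smul_eq_coe_smul (K := 𝕜), mul_pow, mul_pow, mul_pow]
      congr 1; ring
  have s2 := hasSum_integral_wright h0 h1 (h := fun z => Real.exp (-(μ * u) * z))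
    (by fun_prop) hweight (e := fun j => M * ‖x‖ * r ^ j / j.factorial)
    (fun j => by rw [Real.norm_of_nonneg (by positivity)])
    (g := fun z => M * ‖x‖ * Real.exp (r * z)) fun z _ => by
      convert! hasSum_exp_div (M * ‖x‖) (r * z) using 1
      ext j
      rw [smul_eq_mul, mul_pow]; ring
  have e1 : subordinated α (expSemigroup ((μ : 𝕜) ^ 2 • R - (μ : 𝕜) • (1 : B →L[𝕜] B))) t x =
      ∫ z in Ioi (0 : ℝ), (wright α z * Real.exp (-(μ * u) * z)) •
        expSemigroup R (u * z * μ ^ 2) x := by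
    rw [(h.isExpBoundedSemigroup_yosida hμ hR).subordinated_apply h0 h1 ht]
    congr 1
    ext z
    rw [expSemigroup_sq_smul_sub, smul_apply, ← RCLike.real_smul_eq_coe_smul (K := 𝕜), smul_smul]
    congr 4
    ring
  have hv : 0 ≤ u * (μ * ω / (μ - ω)) := by positivity
  set v := u * (μ * ω / (μ - ω)) with hvdef
  -- Writing v as (v^(1/α))^α puts the integral in the form of `hC` with y = v^(1/α).
  have e2 : ∫ z in Ioi (0 : ℝ), (wright α z * Real.exp (-(μ * u) * z)) •
      (M * ‖x‖ * Real.exp (r * z)) =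
      M * ‖x‖ * ∫ z in Ioi (0 : ℝ), wright α z * Real.exp ((v ^ (1 / α)) ^ α * z) := by
    rw [← integral_const_mul]
    congr 1
    ext z
    rw [← Real.rpow_mul hv, one_div_mul_cancel h0.ne', Real.rpow_one, smul_eq_mul]
    have : Real.exp (v * z) = Real.exp (-(μ * u) * z) * Real.exp (r * z) := by
      rw [← Real.exp_add, hvdef, hr]
      congr 1
      field_simp
      ring
    rw [this]; ring
  rw [e1, ← s1.tsum_eq]
  refine (tsum_of_norm_bounded s2 fun j => ?_).trans ?_
  · have hp := integral_wright_mul_pow_mul_exp_nonneg h0 h1 j (mul_nonneg hμ0 hu0)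
    have e3 : ∫ z in Ioi (0 : ℝ), wright α z * (Real.exp (-(μ * u) * z) * z ^ j) =
        ∫ z in Ioi (0 : ℝ), (wright α z * z ^ j) * Real.exp (-(μ * u) * z) := by
      congr 1; ext z; ring
    rw [e3, norm_smul, Real.norm_of_nonneg hp, smul_eq_mul]
    exact mul_le_mul_of_nonneg_left (hcoef j) hp
  · rw [e2]
    have hvle : v ^ (1 / α) ≤ (2 * ω) ^ (1 / α) * t := by
      have : t = u ^ (1 / α) := by
        rw [hu, ← Real.rpow_mul ht, mul_one_div_cancel h0.ne', Real.rpow_one]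
      rw [this, ← Real.mul_rpow (by linarith) hu0]
      refine Real.rpow_le_rpow hv ?_ (by positivity)
      rw [hvdef, mul_comm]
      exact mul_le_mul_of_nonneg_right (mul_div_sub_le_two_mul hω hμ hμ2) hu0
    calc _ ≤ M * ‖x‖ * (C * Real.exp (v ^ (1 / α))) := by
          gcongr; exact hC _ (Real.rpow_nonneg hv _)
      _ ≤ M * ‖x‖ * (C * Real.exp ((2 * ω) ^ (1 / α) * t)) := by gcongr
      _ = _ := by ring

/-- The curve r ↦ e^((s-r)X) T(r)x joins e^(sX)x to T(s)x, and its right derivative is e^((s-r)X)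
T(r)(Ax - Xx). The mean value inequality gives the factor s. -/
lemma norm_sub_expSemigroup_yosida_le (h : IsExpBoundedSemigroup T M ω) {A : B →ₗ.[𝕜] B}
    (hA : IsGenerator T A) (hμ : ω < μ) (hμ2 : 2 * ω ≤ μ)
    (hR : ∀ x, R x = ∫ s in Ioi (0 : ℝ), Real.exp (-(μ * s)) • T s x) {X : B →L[𝕜] B}
    (hX : X = (μ : 𝕜) ^ 2 • R - (μ : 𝕜) • (1 : B →L[𝕜] B)) {x : B} (hx : x ∈ A.domain) {s : ℝ}
    (hs : 0 ≤ s) :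
    ‖T s x - expSemigroup X s x‖ ≤ M * ‖opApply A x - X x‖ * Real.exp (2 * ω * s) * s := by
  have hcomm : ∀ t, 0 ≤ t → ∀ r y, T t (expSemigroup X r y) = expSemigroup X r (T t y) :=
    fun t ht r y => by
      rw [hX]
      exact congrArg (fun V : B →L[𝕜] B => V y) (h.commute_expSemigroup_yosida hμ hR ht r).eq
  have hV := isExpBoundedSemigroup_expSemigroup X
  set y := opApply A x - X x with hy
  set f : ℝ → B := fun r => expSemigroup X (s - r) (T r x) with hf
  have hfc : ContinuousOn f (Icc 0 s) :=
    ((continuous_expSemigroup X).comp (continuous_const.sub continuous_id)).continuousOn.clm_apply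
      ((h.continuousOn x).mono Icc_subset_Ici_self)
  have hslope : Tendsto (fun t : ℝ => t⁻¹ • (T t x - expSemigroup X t x)) (𝓝[>] 0) (𝓝 y) := by
    refine (((hA.mem_graph_iff _ _).1 (mem_graph_opApply hx)).sub
      (tendsto_slope_expSemigroup X x)).congr fun t => ?_
    rw [← RCLike.ofReal_inv, ← RCLike.real_smul_eq_coe_smul (K := 𝕜), ← smul_sub]
    congr 1; abel
  have hd : ∀ r ∈ Ico 0 s, HasDerivWithinAt f (expSemigroup X (s - r) (T r y)) (Ici r) r := by
    rintro r ⟨hr0, hrs⟩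
    rw [← hasDerivWithinAt_Ioi_iff_Ici, hasDerivWithinAt_iff_tendsto_slope' (by simp)]
    have hsub : Tendsto (fun q : ℝ => q - r) (𝓝[>] r) (𝓝[>] 0) := by
      refine tendsto_nhdsWithin_iff.2 ⟨?_, ?_⟩
      · have : Continuous fun q : ℝ => q - r := by fun_prop
        have := this.tendsto r
        rw [sub_self] at this
        exact this.mono_left nhdsWithin_le_nhds
      · filter_upwards [self_mem_nhdsWithin] with q hq
        exact sub_pos.2 (mem_Ioi.1 hq)
    have h1 : Tendsto (fun q : ℝ => expSemigroup X (s - q)) (𝓝[>] r)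
        (𝓝 (expSemigroup X (s - r))) :=
      (((continuous_expSemigroup X).comp (continuous_const.sub continuous_id)).tendsto r).mono_left
        nhdsWithin_le_nhds
    refine ((((isBoundedBilinearMap_apply (𝕜 := 𝕜) (E := B) (F := B)).continuous.tendsto
      (expSemigroup X (s - r), T r y)).comp (h1.prodMk_nhds
        (((T r).continuous.tendsto y).comp (hslope.comp hsub))))).congr' ?_
    filter_upwards [self_mem_nhdsWithin, mem_nhdsWithin_of_mem_nhds (Iio_mem_nhds hrs)] with q hq hqs
    have hq : r < q := hq
    have hqs : q < s := hqs
    -- Both values of f are written with e^((s-q)X) T(r) in front, so the quotient reduces to the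
    -- slope at 0 of T(t)x - e^(tX)x.
    have e1 : T q x = T r (T (q - r) x) := by
      rw [← h.map_add_apply hr0 (by linarith), add_sub_cancel]
    have e2 : expSemigroup X (s - r) (T r x) =
        expSemigroup X (s - q) (T r (expSemigroup X (q - r) x)) := by
      rw [hcomm r hr0, ← hV.map_add_apply (by linarith) (by linarith), sub_add_sub_cancel]
    simp only [Function.comp_apply, slope_def_module, hf]
    rw [e1, e2, ← map_sub, ← map_sub]
    simp only [RCLike.real_smul_eq_coe_smul (K := 𝕜), map_smul]
  have hbd : ∀ r ∈ Ico 0 s, ‖expSemigroup X (s - r) (T r y)‖ ≤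
      M * ‖y‖ * Real.exp (2 * ω * s) := by
    rintro r ⟨hr0, hrs⟩
    have hM := h.M_nonneg
    have hω := h.omega_nonneg
    rw [← hcomm r hr0, hX]
    refine (h.norm_apply_expSemigroup_yosida_le hμ hR hr0 (sub_nonneg.2 hrs.le) y).trans ?_
    rw [mul_assoc (M * ‖y‖), ← Real.exp_add]
    gcongr
    have := mul_le_mul_of_nonneg_right (mul_div_sub_le_two_mul hω hμ hμ2) (sub_nonneg.2 hrs.le)
    nlinarith [mul_nonneg hω hr0]
  have := norm_image_sub_le_of_norm_deriv_right_le_segment hfc hd hbd s (right_mem_Icc.2 hs)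
  simp only [hf, sub_self, sub_zero, h.map_zero, hV.map_zero] at this
  exact this

/-- Uniqueness of the resolvent identifies the operator chosen in `resolventOp` with the Laplace
transform, so the estimates above apply to `yosida A n`. -/
lemma exists_laplace_nat (h : IsExpBoundedSemigroup T M ω) {A : B →ₗ.[𝕜] B}
    (hA : IsGenerator T A) {n : ℕ} (hn : ω < n) :
    ∃ R : B →L[𝕜] B, (∀ x, R x = ∫ s in Ioi (0 : ℝ), Real.exp (-(n * s)) • T s x) ∧
      IsResolventOp A (n : 𝕜) R ∧ resolventOp A (n : 𝕜) = R ∧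
      yosida A n = (((n : ℝ) : 𝕜)) ^ 2 • R - ((n : ℝ) : 𝕜) • (1 : B →L[𝕜] B) := by
  obtain ⟨R, hR⟩ := h.exists_laplace hn
  have h1 := h.isResolventOp_laplace hA hn hR
  rw [RCLike.ofReal_natCast] at h1
  refine ⟨R, hR, h1, h1.resolventOp_eq, ?_⟩
  rw [yosida, h1.resolventOp_eq, RCLike.ofReal_natCast]

/-- Rescaling gives n R(n, A)y = ∫ e^(-u) T(u/n)y du, and T(u/n)y → y under dominated convergence.
-/
lemma tendsto_nat_smul_resolventOp (h : IsExpBoundedSemigroup T M ω) {A : B →ₗ.[𝕜] B}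
    (hA : IsGenerator T A) (y : B) :
    Tendsto (fun n : ℕ => (n : 𝕜) • resolventOp A (n : 𝕜) y) atTop (𝓝 y) := by
  have hω := h.omega_nonneg
  have hM := h.M_nonneg
  -- n > 2ω makes ω/n ≤ 1/2, so e^(-u/2) dominates; n > 1 keeps n invertible.
  obtain ⟨N, hN⟩ := exists_nat_gt (max (2 * ω) 1)
  have hNn : ∀ n : ℕ, N ≤ n → 2 * ω < n ∧ (1 : ℝ) < n := fun n hn => by
    have : (N : ℝ) ≤ n := by exact_mod_cast hn
    exact max_lt_iff.1 (hN.trans_le this)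
  have key : ∀ n : ℕ, N ≤ n → (n : 𝕜) • resolventOp A (n : 𝕜) y =
      ∫ u in Ioi (0 : ℝ), Real.exp (-u) • T ((n : ℝ)⁻¹ * u) y := fun n hn => by
    obtain ⟨hn1, hn2⟩ := hNn n hn
    obtain ⟨R, hR, -, hRe, -⟩ := h.exists_laplace_nat hA (n := n) (by linarith)
    have hn0 : (0 : ℝ) < (n : ℝ)⁻¹ := by positivity
    have := integral_comp_mul_left_Ioi (fun s => Real.exp (-(n * s)) • T s y) 0 hn0
    rw [mul_zero, inv_inv, ← hR, RCLike.real_smul_eq_coe_smul (K := 𝕜),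
      RCLike.ofReal_natCast] at this
    rw [hRe, ← this]
    congr 1
    ext u
    rw [mul_inv_cancel_left₀ (by positivity)]
  have hlim : Tendsto (fun n : ℕ => ∫ u in Ioi (0 : ℝ), Real.exp (-u) • T ((n : ℝ)⁻¹ * u) y) atTop
      (𝓝 (∫ u in Ioi (0 : ℝ), Real.exp (-u) • y)) := by
    refine tendsto_integral_filter_of_dominated_convergence
      (fun u => M * ‖y‖ * Real.exp (-(1 / 2) * u)) ?_ ?_
      ((integrableOn_exp_mul_Ioi (by norm_num) 0).const_mul _) ?_
    · filter_upwards with n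
      refine ContinuousOn.aestronglyMeasurable (ContinuousOn.smul (by fun_prop) ?_)
        measurableSet_Ioi
      exact (h.continuousOn_comp_mul (by positivity) y).mono Ioi_subset_Ici_self
    · filter_upwards [eventually_ge_atTop N] with n hn
      obtain ⟨hn1, hn2⟩ := hNn n hn
      filter_upwards [self_mem_ae_restrict measurableSet_Ioi] with u hu
      have hu : 0 < u := hu
      have hn0 : (0 : ℝ) < (n : ℝ)⁻¹ := by positivity
      have hq : ω * (n : ℝ)⁻¹ ≤ 1 / 2 := by
        rw [← div_eq_mul_inv, div_le_iff₀ (by positivity)]; linarith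
      rw [norm_smul, Real.norm_eq_abs, Real.abs_exp]
      calc _ ≤ Real.exp (-u) * (M * ‖y‖ * Real.exp (ω * ((n : ℝ)⁻¹ * u))) := by
            gcongr; exact h.norm_apply_le (by positivity) y
        _ = M * ‖y‖ * (Real.exp (-u) * Real.exp (ω * ((n : ℝ)⁻¹ * u))) := by ring
        _ ≤ _ := by
            rw [← Real.exp_add]
            gcongr
            have := mul_le_mul_of_nonneg_right hq hu.le
            linarith
    · filter_upwards [self_mem_ae_restrict measurableSet_Ioi] with u hu
      have hu : 0 < u := hu
      refine Tendsto.const_smul ?_ _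
      refine (h.tendsto_zero' y).comp (tendsto_nhdsWithin_iff.2 ⟨?_, Eventually.of_forall
        fun n => mul_nonneg (by positivity) hu.le⟩)
      have := (tendsto_inv_atTop_nhds_zero_nat (𝕜 := ℝ)).mul_const u
      rwa [zero_mul] at this
  rw [integral_smul_const, integral_exp_neg_Ioi_zero, one_smul] at hlim
  refine hlim.congr' ?_
  filter_upwards [eventually_ge_atTop N] with n hn
  exact (key n hn).symm

lemma dense_domain (h : IsExpBoundedSemigroup T M ω) {A : B →ₗ.[𝕜] B} (hA : IsGenerator T A) :
    Dense (A.domain : Set B) := fun y => by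
  refine mem_closure_of_tendsto (h.tendsto_nat_smul_resolventOp hA y) ?_
  obtain ⟨N, hN⟩ := exists_nat_gt ω
  filter_upwards [eventually_ge_atTop N] with n hn
  obtain ⟨R, -, hRA, hRe, -⟩ := h.exists_laplace_nat hA
    (n := n) (hN.trans_le (by exact_mod_cast hn))
  rw [hRe]
  exact A.domain.smul_mem _ (hRA.mem_domain y)

/-- On D(A) the approximation is A_n x = n R(n, A)Ax. -/
lemma tendsto_yosida (h : IsExpBoundedSemigroup T M ω) {A : B →ₗ.[𝕜] B} (hA : IsGenerator T A)
    {x : B} (hx : x ∈ A.domain) :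
    Tendsto (fun n : ℕ => yosida A n x) atTop (𝓝 (opApply A x)) := by
  refine (h.tendsto_nat_smul_resolventOp hA (opApply A x)).congr' ?_
  obtain ⟨N, hN⟩ := exists_nat_gt ω
  filter_upwards [eventually_ge_atTop N] with n hn
  obtain ⟨R, -, hRA, hRe, -⟩ := h.exists_laplace_nat hA
    (n := n) (hN.trans_le (by exact_mod_cast hn))
  have h1 := hRA.left_inv x hx
  rw [map_sub, map_smul, sub_eq_iff_eq_add, ← sub_eq_iff_eq_add'] at h1
  rw [yosida, hRe, ← h1, smul_sub, smul_smul, sub_apply, smul_apply, smul_apply, sq]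
  rfl

end IsExpBoundedSemigroup

end Yosida

/-! ### Convergence of the subordinated families -/

section Approximation

variable {𝕜 B : Type*} [RCLike 𝕜] [NormedAddCommGroup B] [NormedSpace 𝕜 B] [CompleteSpace B]
  [NormedSpace ℝ B] [IsScalarTower ℝ 𝕜 B] {T : ℝ → B →L[𝕜] B} {M ω α : ℝ} {A : B →ₗ.[𝕜] B}

namespace IsExpBoundedSemigroup

/-- The semigroup error is integrated against |Φ_α|; its factor s is absorbed by s ≤ e^s, which
turns the rate 2ω into 2ω + 1. -/
lemma norm_sub_subordinated_yosida_le (h : IsExpBoundedSemigroup T M ω) (hA : IsGenerator T A)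
    (h0 : 0 < α) (h1 : α < 1) {n : ℕ} (hn : ω < n) (hn2 : 2 * ω ≤ n) {x : B}
    (hx : x ∈ A.domain) {t b : ℝ} (ht : 0 ≤ t) (htb : t ≤ b) :
    ‖subordinated α T t x - subordinated α (expSemigroup (yosida A n)) t x‖ ≤
      ‖opApply A x - yosida A n x‖ * (M * wrightAbsLaplace α ((2 * ω + 1) * b ^ α)) := by
  have hω := h.omega_nonneg
  have hM := h.M_nonneg
  obtain ⟨R, hR, -, -, hX⟩ := h.exists_laplace_nat hA hn
  have hV := isExpBoundedSemigroup_expSemigroup (yosida A n)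
  have hu : 0 ≤ t ^ α := Real.rpow_nonneg ht α
  have hub : t ^ α ≤ b ^ α := Real.rpow_le_rpow ht htb h0.le
  rw [h.subordinated_apply h0 h1 ht, hV.subordinated_apply h0 h1 ht,
    ← integral_sub (h.integrableOn_wright h0 h1 ht x) (hV.integrableOn_wright h0 h1 ht x),
    wrightAbsLaplace, ← integral_const_mul, ← integral_const_mul]
  refine norm_integral_le_of_norm_le
    (((integrableOn_abs_wright_mul_exp h0 h1 _).const_mul _).const_mul _) ?_
  filter_upwards [self_mem_ae_restrict measurableSet_Ioi] with z hz
  have hz : 0 < z := hz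
  have hs : 0 ≤ t ^ α * z := mul_nonneg hu hz.le
  rw [← smul_sub, norm_smul, Real.norm_eq_abs]
  have hle : Real.exp (2 * ω * (t ^ α * z)) * (t ^ α * z) ≤
      Real.exp ((2 * ω + 1) * b ^ α * z) := by
    calc _ ≤ Real.exp (2 * ω * (t ^ α * z)) * Real.exp (t ^ α * z) := by
          gcongr
          linarith [Real.add_one_le_exp (t ^ α * z)]
      _ = Real.exp ((2 * ω + 1) * (t ^ α * z)) := by rw [← Real.exp_add]; congr 1; ring
      _ ≤ _ := by rw [mul_assoc]; gcongr
  calc _ ≤ |wright α z| * (M * ‖opApply A x - yosida A n x‖ *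
        Real.exp (2 * ω * (t ^ α * z)) * (t ^ α * z)) := by
        gcongr
        exact h.norm_sub_expSemigroup_yosida_le hA hn hn2 hR hX hx hs
    _ = ‖opApply A x - yosida A n x‖ * (M * (|wright α z| *
        (Real.exp (2 * ω * (t ^ α * z)) * (t ^ α * z)))) := by ring
    _ ≤ _ := by gcongr

/-- A cruder bound with |Φ_α|: for the limit arguments it only has to be uniform in n and in t ≤ b.
-/
lemma norm_subordinated_yosida_le_of_le (h : IsExpBoundedSemigroup T M ω) (hA : IsGenerator T A)
    (h0 : 0 < α) (h1 : α < 1) {n : ℕ} (hn : ω < n) (hn2 : 2 * ω ≤ n) {t b : ℝ} (ht : 0 ≤ t)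
    (htb : t ≤ b) :
    ‖subordinated α (expSemigroup (yosida A n)) t‖ ≤ M * wrightAbsLaplace α (2 * ω * b ^ α) := by
  obtain ⟨R, hR, -, -, hX⟩ := h.exists_laplace_nat hA hn
  rw [hX]
  refine ((h.isExpBoundedSemigroup_yosida hn hR).norm_subordinated_le_of_le h0 h1 ht htb).trans
    (mul_le_mul_of_nonneg_left (wrightAbsLaplace_mono h0 h1 ?_) h.M_nonneg)
  exact mul_le_mul_of_nonneg_right (mul_div_sub_le_two_mul h.omega_nonneg hn hn2)
    (Real.rpow_nonneg (ht.trans htb) α)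

lemma tendstoUniformlyOn_subordinated_yosida (h : IsExpBoundedSemigroup T M ω)
    (hA : IsGenerator T A) (h0 : 0 < α) (h1 : α < 1) (x : B) (b : ℝ) :
    TendstoUniformlyOn (fun (n : ℕ) t => subordinated α (expSemigroup (yosida A n)) t x)
      (fun t => subordinated α T t x) atTop (Icc 0 b) := by
  have hω := h.omega_nonneg
  have hM := h.M_nonneg
  rw [Metric.tendstoUniformlyOn_iff]
  intro ε hε
  set Q := M * wrightAbsLaplace α (2 * ω * b ^ α) with hQ
  set D := M * wrightAbsLaplace α ((2 * ω + 1) * b ^ α) with hD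
  have hQ0 : 0 ≤ Q := mul_nonneg hM (wrightAbsLaplace_nonneg _ _)
  -- The two terms in x - y cost less than ε/4 each, leaving ε/2 for the error at y ∈ D(A).
  obtain ⟨y, hy, hxy⟩ := (h.dense_domain hA).exists_dist_lt x
    (show 0 < ε / (4 * (Q + 1)) by positivity)
  rw [dist_eq_norm, lt_div_iff₀ (by positivity)] at hxy
  have hlim : Tendsto (fun n : ℕ => ‖opApply A y - yosida A n y‖ * D) atTop (𝓝 0) := by
    have := ((h.tendsto_yosida hA hy).const_sub (opApply A y)).norm.mul_const D
    simpa using this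
  obtain ⟨N, hN⟩ := exists_nat_gt (2 * ω)
  filter_upwards [eventually_gt_atTop N, hlim.eventually_lt_const (half_pos hε)] with n hn hnε t ht
  have hn' : (N : ℝ) < n := by exact_mod_cast hn
  have b1 := h.norm_sub_subordinated_yosida_le hA h0 h1 (n := n) (by linarith) (by linarith) hy
    ht.1 ht.2
  have b2 := h.norm_subordinated_yosida_le_of_le hA h0 h1 (n := n) (by linarith) (by linarith)
    ht.1 ht.2
  have b3 : ‖subordinated α T t‖ ≤ Q :=
    (h.norm_subordinated_le_of_le h0 h1 ht.1 ht.2).trans (mul_le_mul_of_nonneg_left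
      (wrightAbsLaplace_mono h0 h1 (mul_le_mul_of_nonneg_right (by linarith)
        (Real.rpow_nonneg (ht.1.trans ht.2) α))) hM)
  set S := subordinated α T t
  set V := subordinated α (expSemigroup (yosida A n)) t
  have e : S x - V x = S (x - y) + (S y - V y) - V (x - y) := by
    rw [map_sub, map_sub]; abel
  rw [dist_eq_norm, e]
  have c1 := (S.le_opNorm (x - y)).trans (mul_le_mul_of_nonneg_right b3 (norm_nonneg _))
  have c2 := (V.le_opNorm (x - y)).trans (mul_le_mul_of_nonneg_right b2 (norm_nonneg _))
  have c3 := norm_sub_le (S (x - y) + (S y - V y)) (V (x - y))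
  have c4 := norm_add_le (S (x - y)) (S y - V y)
  nlinarith [norm_nonneg (x - y)]

/-- Commutation with A is inherited from T; the resolvent equation is the limit of those for the
bounded operators `yosida A n`. -/
lemma isFracResolventFamily_subordinated (h : IsExpBoundedSemigroup T M ω)
    (hA : IsGenerator T A) (h0 : 0 < α) (h1 : α < 1) :
    IsFracResolventFamily α A (subordinated α T) := by
  have hM := h.M_nonneg
  have hω := h.omega_nonneg
  have hcomm : ∀ t, 0 ≤ t → ∀ x ∈ A.domain, subordinated α T t x ∈ A.domain ∧
      opApply A (subordinated α T t x) = subordinated α T t (opApply A x) := fun t ht x hx =>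
    hA.commute (fun s hs => h.commute_subordinated h0 h1 (fun r hr => h.comm hs hr) ht) hx
  refine ⟨h.subordinated_zero h0 h1, h.continuousOn_subordinated h0 h1,
    fun t ht x hx => (hcomm t ht x hx).1, fun t ht x hx => (hcomm t ht x hx).2,
    fun t ht x hx => ?_, fun t ht x hx => ?_⟩
  · refine (intervalIntegrable_fracKernel h0 t).smul_continuousOn ?_
    rw [uIcc_of_le ht]
    exact ((h.continuousOn_subordinated h0 h1 (opApply A x)).mono Icc_subset_Ici_self).congr
      fun τ hτ => (hcomm τ hτ.1 x hx).2
  -- This holds for every n, even where `resolventOp` takes its default value, since only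
  -- boundedness of `yosida A n` is used.
  · have hS := fun n : ℕ => isFracResolventFamily_expSemigroup h0 h1 (yosida A n)
    have hSc : ∀ (n : ℕ) τ, 0 ≤ τ →
        opApply (ofBounded (yosida A n)) (subordinated α (expSemigroup (yosida A n)) τ x) =
          subordinated α (expSemigroup (yosida A n)) τ (yosida A n x) := fun n τ hτ => by
      rw [(hS n).commutes τ hτ x Submodule.mem_top, opApply_ofBounded]
    have hlim : ∀ τ ∈ Icc 0 t, ∀ y, Tendsto
        (fun n : ℕ => subordinated α (expSemigroup (yosida A n)) τ y) atTop
        (𝓝 (subordinated α T τ y)) := fun τ hτ y =>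
      (h.tendstoUniformlyOn_subordinated_yosida hA h0 h1 y t).tendsto_at hτ
    have hAx := h.tendsto_yosida hA hx
    set Q := M * wrightAbsLaplace α (2 * ω * t ^ α) with hQ
    have hQ0 : 0 ≤ Q := mul_nonneg hM (wrightAbsLaplace_nonneg _ _)
    obtain ⟨N, hN⟩ := exists_nat_gt (2 * ω)
    have hbd : ∀ᶠ n : ℕ in atTop, ∀ τ ∈ Icc 0 t,
        ‖subordinated α (expSemigroup (yosida A n)) τ‖ ≤ Q := by
      filter_upwards [eventually_gt_atTop N] with n hn τ hτ
      have hn' : (N : ℝ) < n := by exact_mod_cast hn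
      exact h.norm_subordinated_yosida_le_of_le hA h0 h1 (by linarith) (by linarith) hτ.1 hτ.2
    -- Operator and vector both vary with n; the uniform bound Q controls the change of vector.
    have hconv : ∀ τ ∈ Icc 0 t, Tendsto
        (fun n : ℕ => subordinated α (expSemigroup (yosida A n)) τ (yosida A n x)) atTop
        (𝓝 (subordinated α T τ (opApply A x))) := fun τ hτ => by
      have hz : Tendsto (fun n : ℕ => subordinated α (expSemigroup (yosida A n)) τ
          (yosida A n x - opApply A x)) atTop (𝓝 0) := by
        refine squeeze_zero_norm' (a := fun n : ℕ => Q * ‖yosida A n x - opApply A x‖) ?_ ?_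
        · filter_upwards [hbd] with n hn
          exact (ContinuousLinearMap.le_opNorm _ _).trans
            (mul_le_mul_of_nonneg_right (hn τ hτ) (norm_nonneg _))
        · have := ((hAx.sub_const (opApply A x)).norm).const_mul Q
          simpa using this
      have := hz.add (hlim τ hτ (opApply A x))
      rw [zero_add] at this
      refine this.congr fun n => ?_
      rw [map_sub, sub_add_cancel]
    have hint : Tendsto (fun n : ℕ => ∫ τ in (0 : ℝ)..t, fracKernel α (t - τ) •
        opApply (ofBounded (yosida A n)) (subordinated α (expSemigroup (yosida A n)) τ x)) atTop
        (𝓝 (∫ τ in (0 : ℝ)..t, fracKernel α (t - τ) • opApply A (subordinated α T τ x))) := by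
      refine intervalIntegral.tendsto_integral_filter_of_dominated_convergence
        (fun τ => fracKernel α (t - τ) * (Q * (‖opApply A x‖ + 1))) ?_ ?_
        ((intervalIntegrable_fracKernel h0 t).mul_const _) ?_
      · filter_upwards with n
        have := ((hS n).intervalIntegrable t ht x Submodule.mem_top).aestronglyMeasurable
        rwa [uIoc_of_le ht]
      · filter_upwards [hbd, hAx.norm.eventually_lt_const (lt_add_one ‖opApply A x‖)] with n hn hn2
        refine Eventually.of_forall fun τ hτ => ?_
        rw [uIoc_of_le ht] at hτ
        have hk := fracKernel_nonneg h0 (sub_nonneg.2 hτ.2)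
        rw [hSc n τ hτ.1.le, norm_smul, Real.norm_of_nonneg hk]
        gcongr
        refine (ContinuousLinearMap.le_opNorm _ _).trans ?_
        gcongr
        exact hn τ ⟨hτ.1.le, hτ.2⟩
      · refine Eventually.of_forall fun τ hτ => ?_
        rw [uIoc_of_le ht] at hτ
        rw [(hcomm τ hτ.1.le x hx).2]
        refine ((hconv τ ⟨hτ.1.le, hτ.2⟩).const_smul (fracKernel α (t - τ))).congr fun n => ?_
        rw [hSc n τ hτ.1.le]
    refine tendsto_nhds_unique (hlim t ⟨ht, le_rfl⟩ x) ((hint.const_add x).congr fun n => ?_)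
    exact ((hS n).resolvent_eq t ht x Submodule.mem_top).symm

end IsExpBoundedSemigroup

/-- A bounded generator makes the semigroup norm continuous, so the integral converges in operator
norm and not only strongly. -/
lemma integrableOn_wright_smul_expSemigroup (h0 : 0 < α) (h1 : α < 1) (X : B →L[𝕜] B) {t : ℝ}
    (ht : 0 < t) : IntegrableOn (fun s => wrightKernel α t s • NormedSpace.exp (s • X)) (Ioi 0) := by
  have hc : 0 < t ^ α := Real.rpow_pos_of_pos ht α
  simp only [exp_real_smul_eq]
  refine (integrableOn_wrightKernel_iff (expSemigroup X) ht).2 ?_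
  refine integrableOn_wright_of_le h0 h1 (K := 1) (c := ‖X‖ * t ^ α)
    ((continuous_expSemigroup X).comp (continuous_const.mul continuous_id)).continuousOn
    fun z hz => ?_
  have := (isExpBoundedSemigroup_expSemigroup X).norm_le (t ^ α * z) (by positivity)
  rwa [← mul_assoc] at this

lemma subordinated_expSemigroup_eq_integral (h0 : 0 < α) (h1 : α < 1) (X : B →L[𝕜] B) {t : ℝ}
    (ht : 0 < t) : subordinated α (expSemigroup X) t =
      ∫ s in Ioi (0 : ℝ), wrightKernel α t s • NormedSpace.exp (s • X) := by
  ext x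
  rw [ContinuousLinearMap.integral_apply (integrableOn_wright_smul_expSemigroup h0 h1 X ht),
    (isExpBoundedSemigroup_expSemigroup X).subordinated_apply h0 h1 ht.le]
  simp only [exp_real_smul_eq, smul_apply]
  exact (integral_wrightKernel (fun s => expSemigroup X s x) ht).symm

end Approximation

end FracVolterra

end

theorem theorem5 (α : ℝ) (hα₀ : 0 < α) (hα₁ : α < 1) :
    ∃ C : ℝ, 0 < C ∧
      ∀ {𝕜 B : Type*} [RCLike 𝕜] [NormedAddCommGroup B] [NormedSpace 𝕜 B] [NormedSpace ℝ B]
        [IsScalarTower ℝ 𝕜 B] [CompleteSpace B]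
        (T : ℝ → B →L[𝕜] B) (A : B →ₗ.[𝕜] B) (M ω : ℝ),
        FracVolterra.IsC0Semigroup T →
        FracVolterra.IsGenerator T A →
        0 ≤ ω →
        (∀ t : ℝ, 0 ≤ t → ‖T t‖ ≤ M * Real.exp (ω * t)) →
        ∃ (S : ℝ → B →L[𝕜] B) (Sn : ℕ → ℝ → B →L[𝕜] B),
          -- the `α`-times resolvent family of `A`, subordinated to `T`
          FracVolterra.IsFracResolventFamily α A S ∧
          (∀ t : ℝ, 0 < t → ∀ x : B,
            IntegrableOn (fun s : ℝ => FracVolterra.wrightKernel α t s • T s x) (Ioi 0) ∧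
            S t x = ∫ s in Ioi (0 : ℝ), FracVolterra.wrightKernel α t s • T s x) ∧
          -- the Yosida approximations and their `α`-times resolvent families
          (∀ n : ℕ, ω < n →
            (n : 𝕜) ∈ FracVolterra.resolventSetOp A ∧
            FracVolterra.IsFracResolventFamily α
              (FracVolterra.ofBounded (FracVolterra.yosida A n)) (Sn n) ∧
            ∀ t : ℝ, 0 < t →
              IntegrableOn (fun s : ℝ => FracVolterra.wrightKernel α t s •
                NormedSpace.exp (s • FracVolterra.yosida A n)) (Ioi 0) ∧
              Sn n t = ∫ s in Ioi (0 : ℝ), FracVolterra.wrightKernel α t s •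
                NormedSpace.exp (s • FracVolterra.yosida A n)) ∧
          -- the uniform exponential bound
          (∀ n : ℕ, ω < n → 2 * ω ≤ n → ∀ t : ℝ, 0 ≤ t →
            ‖Sn n t‖ ≤ M * C * Real.exp ((2 * ω) ^ (1 / α) * t)) ∧
          -- strong convergence, uniform on compact subsets of the half-line
          (∀ (x : B) (K : Set ℝ), IsCompact K → K ⊆ Ici 0 →
            TendstoUniformlyOn (fun (n : ℕ) (t : ℝ) => Sn n t x) (fun t : ℝ => S t x) atTop K) := by
  -- C is the Mittag-Leffler growth constant, fixed before any space or semigroup and so depending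
  -- on α alone.
  obtain ⟨C, hC0, hC⟩ := FracVolterra.exists_integral_wright_mul_exp_le hα₀ hα₁
  refine ⟨C, hC0, fun T A M ω hT hA hω hTM => ?_⟩
  have h : FracVolterra.IsExpBoundedSemigroup T M ω := ⟨hT, hω, hTM⟩
  refine ⟨FracVolterra.subordinated α T,
    fun n => FracVolterra.subordinated α (FracVolterra.expSemigroup (FracVolterra.yosida A n)),
    h.isFracResolventFamily_subordinated hA hα₀ hα₁, fun t ht x => ⟨?_, ?_⟩,
    fun n hn => ⟨?_, FracVolterra.isFracResolventFamily_expSemigroup hα₀ hα₁ _,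
      fun t ht => ⟨FracVolterra.integrableOn_wright_smul_expSemigroup hα₀ hα₁ _ ht,
        FracVolterra.subordinated_expSemigroup_eq_integral hα₀ hα₁ _ ht⟩⟩,
    fun n hn hn2 t ht => ?_, fun x K hK hK0 => ?_⟩
  · rw [FracVolterra.integrableOn_wrightKernel_iff (fun s => T s x) ht]
    exact h.integrableOn_wright hα₀ hα₁ ht.le x
  · rw [FracVolterra.integral_wrightKernel (fun s => T s x) ht]
    exact h.subordinated_apply hα₀ hα₁ ht.le x
  · obtain ⟨R, -, hRA, -⟩ := h.exists_laplace_nat hA hn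
    exact ⟨R, hRA⟩
  · obtain ⟨R, hR, -, -, hX⟩ := h.exists_laplace_nat hA hn
    beta_reduce
    rw [hX]
    exact h.norm_subordinated_yosida_le hα₀ hα₁ hC hC0.le hn hn2 hR ht
  · obtain ⟨b, hb⟩ := hK.bddAbove
    exact (h.tendstoUniformlyOn_subordinated_yosida hA hα₀ hα₁ x b).mono
      fun t ht => ⟨hK0 ht, hb ht⟩
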